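/- Let $\Theta=\mathbb R^d\setminus\{0\}$ and let $\Theta_1\subset\Theta$ be the set of vectors whose first nonzero coordinate is positive. For $\theta\in\mathbb R^d$ and a probability measure $Q$ on $\{-1,1\}^n$ let $P^{(n)}_{\theta,Q}$ be the law of $X^n=(X_1,\dots,X_n)$ when $Z^n\sim Q$ and, given $Z^n$, the $X_i$ are independent with $X_i\sim N_d(Z_i\theta,I_d)$. Let $\beta\ge 0$, let $A_n$ be nonnegative symmetric $n\times n$ matrices with zero diagonal, and let $Q_{0,n}(z)\propto e^{\frac\beta2 z^\top A_nz}$ be the corresponding Ising models on $\{-1,1\}^n$. Given data $X^n$, let $Q_\theta(w)\propto e^{\frac\beta2 w^\top A_nw+\theta^\top\sum_i X_iw_i}$ on $\{-1,1\}^n$. Let $\theta_0\in\operatorname{int}(\Theta_1)$ and suppose that, under $X^n\sim P^{(n)}_{\theta_0,Q_{0,n}}$, $$\sup_{\theta\in\Theta}\Big\|\mathbb E^{Q_\theta}\Big[\sum_{i=1}^nX_iW_i\Big]-\sum_{i=1}^nX_i\tanh(\theta^\top X_i)\Big\|=o_p(\sqrt n).$$ Let $\hat\theta_n^{\mathrm{iid}}$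 be a measurable minimizer over $\theta\in\Theta_1$ of $\frac12\theta^\top\theta-\frac1n\sum_{i=1}^n\log\cosh(\theta^\top X_i)$ (with an arbitrary value when no minimizer exists), and let $$I_0(\theta_0)=I_d-\mathbb E_{X\sim N_d(\theta_0,I_d)}\big[XX^\top\operatorname{sech}^2(\theta_0^\top X)\big].$$ Then: (i) $I_0(\theta_0)$ is positive definite, and $\hat\theta_n^{\mathrm{iid}}$ is regular at $\theta_0$: for every $h\in\mathbb R^d$, with $\theta_n=\theta_0+h/\sqrt n$, under $P^{(n)}_{\theta_n,Q_{0,n}}$, $$\sqrt n(\hat\theta_n^{\mathrm{iid}}-\theta_n)\xrightarrow{d}N_d\big(0,I_0(\theta_0)^{-1}\big).$$ (ii) $\hat\theta_n^{\mathrm{iid}}$ is efficient: if $T_n=T_n(X^n)$ is any estimator sequence that is regular at $\theta_0$, that is, for some probability measure $L$ on $\mathbb R^d$ and every $h\in\mathbb R^d$, $\sqrt n(T_n-\theta_n)\xrightarrow{d}L$ under $P^{(n)}_{\theta_n,Q_{0,n}}$, then $L=N_d(0,I_0(\theta_0)^{-1})*M$ for some probability measure $M$; in particular, if $L$ has finite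 second moments, its covariance matrix $\Sigma$ satisfies $\Sigma\succeq I_0(\theta_0)^{-1}$. (iii) The Ising dependence of the labels gives no gain over i.i.d. labels: (i) and (ii) hold, with the same matrix $I_0(\theta_0)^{-1}$, when $Q_{0,n}$ is replaced by the uniform distribution on $\{-1,1\}^n$ (i.i.d. symmetric labels). -/

import Mathlib

open MeasureTheory ProbabilityTheory Filter Topology
open scoped ENNReal Matrix

noncomputable section

namespace HiddenIsing

/-- The space `ℝ^d` of observations and parameters. -/
abbrev Vec (d : ℕ) : Type := EuclideanSpace ℝ (Fin d)

/-- Label configurations `{-1, 1}^n`. -/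
abbrev Labels (n : ℕ) : Type := Fin n → ℤˣ

/-- A label configuration as a real vector. -/
def spin {n : ℕ} (z : Labels n) : Fin n → ℝ := fun i => ((z i : ℤ) : ℝ)

/-- The full parameter space `ℝ^d ∖ {0}`. -/
def Theta (d : ℕ) : Set (Vec d) := {θ | θ ≠ 0}

/-- The half-space of vectors whose first nonzero coordinate is positive. -/
def ThetaOne (d : ℕ) : Set (Vec d) := {θ | ∃ k, (∀ j < k, θ j = 0) ∧ 0 < θ k}

/-- The probability mass function proportional to `exp H` on a finite set. -/
def gibbs {α : Type*} [Fintype α] [Nonempty α] (H : α → ℝ) : PMF α :=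
  PMF.ofFintype (fun a => ENNReal.ofReal (Real.exp (H a) / ∑ b, Real.exp (H b))) (by
    have hpos : 0 < ∑ b, Real.exp (H b) :=
      Finset.sum_pos (fun b _ => Real.exp_pos _) Finset.univ_nonempty
    rw [← ENNReal.ofReal_sum_of_nonneg (fun a _ => (div_pos (Real.exp_pos _) hpos).le),
      ← Finset.sum_div, div_self hpos.ne', ENNReal.ofReal_one])

/-- Coupling matrices: nonnegative, symmetric, with zero diagonal. -/
structure IsCoupling {n : ℕ} (A : Matrix (Fin n) (Fin n) ℝ) : Prop where
  nonneg : ∀ i j, 0 ≤ A i j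
  symm : A.IsSymm
  diag : ∀ i, A i i = 0

/-- The Ising model: `Q(z) ∝ exp (β/2 zᵀ A z)`. -/
def ising (β : ℝ) {n : ℕ} (A : Matrix (Fin n) (Fin n) ℝ) : PMF (Labels n) :=
  gibbs fun z => β / 2 * (spin z ⬝ᵥ A *ᵥ spin z)

/-- Independent labels, each uniform on `{-1, 1}`. -/
def iidLabels (n : ℕ) : PMF (Labels n) := PMF.uniformOfFintype (Labels n)

/-- The random field Ising model given the data `x`:
`Q_θ(w) ∝ exp (β/2 wᵀ A w + ∑ i, w i * θᵀ x i)`. -/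
def rfim (β : ℝ) {n d : ℕ} (A : Matrix (Fin n) (Fin n) ℝ) (x : Fin n → Vec d) (θ : Vec d) :
    PMF (Labels n) :=
  gibbs fun w => β / 2 * (spin w ⬝ᵥ A *ᵥ spin w) + inner ℝ θ (∑ i, spin w i • x i)

/-- The expectation of `∑ i, W i • x i` when `W` follows the random field Ising model given `x`. -/
def rfimMean (β : ℝ) {n d : ℕ} (A : Matrix (Fin n) (Fin n) ℝ) (x : Fin n → Vec d) (θ : Vec d) :
    Vec d :=
  ∑ w : Labels n, (rfim β A x θ w).toReal • ∑ i, spin w i • x i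

/-- The law of `(X_1, …, X_n)` when the labels `Z` have law `Q` and, given `Z`, the `X_i` are
independent with `X_i ∼ N(Z_i θ, I)`. -/
def dataLaw {n d : ℕ} (θ : Vec d) (Q : PMF (Labels n)) : Measure (Fin n → Vec d) :=
  ∑ z : Labels n, Q z • Measure.pi fun i => multivariateGaussian (spin z i • θ) 1

instance {n d : ℕ} (θ : Vec d) (Q : PMF (Labels n)) : IsProbabilityMeasure (dataLaw θ Q) := by
  constructor
  simp only [dataLaw, Measure.coe_finsetSum, Finset.sum_apply, Measure.smul_apply,
    measure_univ, smul_eq_mul, mul_one]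
  rw [← tsum_fintype (L := .unconditional _), Q.tsum_coe]

/-- `sup_{θ ≠ 0} ‖E^{Q_θ}[∑ X_i W_i] - ∑ X_i tanh(θᵀ X_i)‖ = o_p(√n)` when the data have
parameter `θ₀` and Ising labels. -/
def UniformExpansion {d : ℕ} (β : ℝ) (A : ∀ n : ℕ, Matrix (Fin n) (Fin n) ℝ) (θ₀ : Vec d) : Prop :=
  ∀ ε : ℝ, 0 < ε →
    Tendsto (fun n : ℕ => dataLaw θ₀ (ising β (A n))
      {x | ENNReal.ofReal (ε * √n) ≤
        ⨆ θ ∈ Theta d, ‖rfimMean β (A n) x θ - ∑ i, Real.tanh (inner ℝ θ (x i)) • x i‖ₑ})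
      atTop (𝓝 0)

/-- The rescaled negative log-likelihood `N_n` under i.i.d. labels. -/
def negLogLik {n d : ℕ} (x : Fin n → Vec d) (θ : Vec d) : ℝ :=
  inner ℝ θ θ / 2 - (1 / (n : ℝ)) * ∑ i, Real.log (Real.cosh (inner ℝ θ (x i)))

/-- `T` is a (measurable) version of the minimizer of `N_n` over `ThetaOne d`. Its value is
unrestricted for data for which no minimizer exists. -/
structure IsIIDEstimator {d : ℕ} (T : ∀ n : ℕ, (Fin n → Vec d) → Vec d) : Prop where
  measurable : ∀ n, Measurable (T n)
  isMinOn : ∀ n (x : Fin n → Vec d),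
    (∃ θ ∈ ThetaOne d, IsMinOn (negLogLik x) (ThetaOne d) θ) →
      T n x ∈ ThetaOne d ∧ IsMinOn (negLogLik x) (ThetaOne d) (T n x)

/-- `I_0(θ₀) = I - E[X Xᵀ sech²(θ₀ᵀ X)]` for `X ∼ N(θ₀, I)`. -/
def infoMatrix {d : ℕ} (θ₀ : Vec d) : Matrix (Fin d) (Fin d) ℝ :=
  1 - Matrix.of fun i j =>
    ∫ x, x i * x j * (1 / Real.cosh (inner ℝ θ₀ x)) ^ 2 ∂(multivariateGaussian θ₀ 1)

/-- The local alternatives `θ₀ + h / √n`. -/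
def localAlt {d : ℕ} (θ₀ h : Vec d) (n : ℕ) : Vec d := θ₀ + (1 / √(n : ℝ)) • h

/-- The estimator sequence `T` is regular at `θ₀` with limit law `L`, when the label laws are `Q`:
for every `h`, `√n (T_n - θ_n)` converges in distribution to `L` under `θ_n = θ₀ + h / √n`. -/
def IsRegularEst {d : ℕ} (Q : ∀ n, PMF (Labels n)) (θ₀ : Vec d)
    (T : ∀ n : ℕ, (Fin n → Vec d) → Vec d) (L : Measure (Vec d)) [IsProbabilityMeasure L] : Prop :=
  ∀ h : Vec d, TendstoInDistribution
    (fun (n : ℕ) x => √(n : ℝ) • (T n x - localAlt θ₀ h n)) atTop (id : Vec d → Vec d)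
    (fun n => dataLaw (localAlt θ₀ h n) (Q n)) L

/-- The covariance matrix of a law on `ℝ^d`. -/
def covMat {d : ℕ} (L : Measure (Vec d)) : Matrix (Fin d) (Fin d) ℝ :=
  Matrix.of fun i j => cov[fun y => y i, fun y => y j; L]

/-- `V` is a lower bound for all regular estimators at `θ₀`: every limit law `L` of a regular
estimator sequence is a convolution of `N(0, V)` with some probability measure and, if it has
finite second moments, its covariance matrix dominates `V` in the Loewner order. -/
def IsEfficiencyBound {d : ℕ} (Q : ∀ n, PMF (Labels n)) (θ₀ : Vec d)
    (V : Matrix (Fin d) (Fin d) ℝ) : Prop :=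
  ∀ T : ∀ n : ℕ, (Fin n → Vec d) → Vec d, (∀ n, Measurable (T n)) →
    ∀ (L : Measure (Vec d)) [IsProbabilityMeasure L], IsRegularEst Q θ₀ T L →
      (∃ M : Measure (Vec d), IsProbabilityMeasure M ∧
        L = Measure.conv (multivariateGaussian 0 V) M) ∧
      (MemLp id 2 L → (covMat L - V).PosSemidef)

end HiddenIsing

end

open HiddenIsing

/-! Relative to i.i.d. standard normal data, the Ising-label model has density proportional to
exp(`logPart` - n‖θ‖²/2), where `logPart` is the log-partition function of the random field Ising
model given the data. Its gradient in θ is the Gibbs mean `rfimMean`; for i.i.d. labels the gradient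
is ∑ tanh⟪θ, x_i⟫ x_i. The hypothesis makes these agree up to o_p(√n), uniformly in θ ≠ 0.
Integrating along a segment of length ‖h‖/√n, the two log-likelihood ratios at a local alternative
differ by o_p(1) (`isLAN_of_uniformExpansion`). So both label laws give the same local asymptotic
normality, with the normalized score Δ_n and information form I, and everything after that depends
on `IsLAN` alone. I.i.d. labels are the Ising model with zero inverse temperature and zero coupling.

A second principle is sign symmetry. Given the labels, the data are sign flips of i.i.d. N(θ, I)
vectors, so a statistic invariant under flips has the same law for every label distribution. The
score and the criterion are invariant, so laws of large numbers and central limit statements are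
proved for i.i.d. N(θ₀, I) data and transferred.

For the estimator: the limiting criterion is minimized only at ±θ₀, and interiority of θ₀ keeps -θ₀
away from the half-space. This gives consistency; linearizing the likelihood equation then gives
√n(T_n - θ₀) = I⁻¹Δ_n + o_p(1). A Scheffé-type argument (`tendsto_integral_abs_exp_sub`) replaces
expectations under the alternative by expectations under θ₀ weighted by exp(⟪h, Δ_n⟫ - I(h,h)/2),
and the limits of the exponential moments of Δ_n give regularity.

For the convolution theorem, regularity says that E[exp(i⟪√n(T_n - θ₀), t⟫ + ⟪h, Δ_n⟫)] tends to
φ_L(t) exp(i⟪h, t⟫ + I(h,h)/2) for real h. Both sides continue analytically in h, and convergence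
persists (`tendsto_of_tendsto_on_reals`). At h = -i I⁻¹t the left side is the characteristic
function of √n(T_n - θ₀) - I⁻¹Δ_n and the limit is φ_L(t) exp(⟪I⁻¹t, t⟫/2). By Lévy's theorem this
is the characteristic function of some M, which is the factor sought. The covariance bound follows
by additivity of covariance under convolution. -/

noncomputable section

namespace HiddenIsing

/-! ### Taylor and Lipschitz bounds for tanh and log cosh. -/

section Hyperbolic

theorem hasDerivAt_tanh (a : ℝ) : HasDerivAt Real.tanh ((1 / Real.cosh a) ^ 2) a := by
  have h := (Real.hasDerivAt_sinh a).div (Real.hasDerivAt_cosh a) (Real.cosh_pos a).ne'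
  have h1 : Real.tanh = fun x => Real.sinh x / Real.cosh x :=
    funext Real.tanh_eq_sinh_div_cosh
  rw [h1]
  convert! h using 1
  have h2 := Real.cosh_sq_sub_sinh_sq a
  have h3 := (Real.cosh_pos a).ne'
  field_simp
  linarith

@[fun_prop]
theorem continuous_tanh : Continuous Real.tanh :=
  continuous_iff_continuousAt.2 fun a => (hasDerivAt_tanh a).continuousAt

theorem abs_tanh_le_one (a : ℝ) : |Real.tanh a| ≤ 1 := (Real.abs_tanh_lt_one a).le

theorem abs_one_div_cosh_le_one (a : ℝ) : |1 / Real.cosh a| ≤ 1 := by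
  rw [abs_of_pos (one_div_pos.2 (Real.cosh_pos a))]
  exact (div_le_one (Real.cosh_pos a)).2 (Real.one_le_cosh a)

theorem one_div_cosh_sq_le_one (a : ℝ) : (1 / Real.cosh a) ^ 2 ≤ 1 := by
  rw [← sq_abs]; exact pow_le_one₀ (abs_nonneg _) (abs_one_div_cosh_le_one a)

theorem tanh_sq_add (a : ℝ) : Real.tanh a ^ 2 + (1 / Real.cosh a) ^ 2 = 1 := by
  rw [Real.tanh_eq_sinh_div_cosh]
  have h2 := Real.cosh_sq_sub_sinh_sq a
  have h3 := (Real.cosh_pos a).ne'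
  field_simp
  linarith

theorem hasDerivAt_log_cosh (a : ℝ) :
    HasDerivAt (fun x => Real.log (Real.cosh x)) (Real.tanh a) a := by
  have := (Real.hasDerivAt_cosh a).log (Real.cosh_pos a).ne'
  rwa [← Real.tanh_eq_sinh_div_cosh] at this

theorem abs_log_cosh_sub_le (a b : ℝ) :
    |Real.log (Real.cosh b) - Real.log (Real.cosh a)| ≤ |b - a| := by
  have := Convex.norm_image_sub_le_of_norm_hasDerivWithin_le (s := Set.univ) (C := 1) (x := a)
    (y := b) (fun x _ => (hasDerivAt_log_cosh x).hasDerivWithinAt) (fun x _ => abs_tanh_le_one x)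
    convex_univ trivial trivial
  simpa using this

/-- Since sech² = 1 - tanh², the difference factors as a sum times a difference of tanh values. The
sum is at most 2, and tanh is 1-Lipschitz. -/
theorem abs_sech_sq_sub_le (a b : ℝ) :
    |(1 / Real.cosh b) ^ 2 - (1 / Real.cosh a) ^ 2| ≤ 2 * |b - a| := by
  have ht : |Real.tanh b - Real.tanh a| ≤ |b - a| := by
    have := Convex.norm_image_sub_le_of_norm_hasDerivWithin_le (s := Set.univ) (C := 1) (x := a)
      (y := b) (fun x _ => (hasDerivAt_tanh x).hasDerivWithinAt) (fun x _ => by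
        rw [Real.norm_eq_abs, abs_of_nonneg (by positivity)]; exact one_div_cosh_sq_le_one x)
      convex_univ trivial trivial
    simpa using this
  have h : (1 / Real.cosh b) ^ 2 - (1 / Real.cosh a) ^ 2 =
      -((Real.tanh b + Real.tanh a) * (Real.tanh b - Real.tanh a)) := by
    linarith [tanh_sq_add a, tanh_sq_add b]
  rw [h, abs_neg, abs_mul]
  refine mul_le_mul ?_ ht (abs_nonneg _) (by norm_num)
  linarith [abs_add_le (Real.tanh b) (Real.tanh a), abs_tanh_le_one a, abs_tanh_le_one b]

theorem abs_tanh_taylor_le (a b : ℝ) :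
    |Real.tanh b - Real.tanh a - (b - a) * (1 / Real.cosh a) ^ 2| ≤ 2 * |b - a| ^ 2 := by
  have hd : ∀ x, HasDerivAt (fun y => Real.tanh y - Real.tanh a - (y - a) * (1 / Real.cosh a) ^ 2)
      ((1 / Real.cosh x) ^ 2 - 1 * (1 / Real.cosh a) ^ 2) x := fun x =>
    ((hasDerivAt_tanh x).sub_const _).sub (((hasDerivAt_id x).sub_const a).mul_const _)
  have := Convex.norm_image_sub_le_of_norm_hasDerivWithin_le (s := Set.uIcc a b)
    (C := 2 * |b - a|) (x := a) (y := b) (fun x _ => (hd x).hasDerivWithinAt) (fun x hx => by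
      rw [one_mul, Real.norm_eq_abs]
      exact (abs_sech_sq_sub_le a x).trans
        (mul_le_mul_of_nonneg_left (Set.abs_sub_left_of_mem_uIcc hx) (by norm_num)))
    (convex_uIcc a b) Set.left_mem_uIcc Set.right_mem_uIcc
  simp only [sub_self, zero_mul, sub_zero, Real.norm_eq_abs] at this
  linarith

/-- The derivative of the remainder is the tanh remainder already bounded, so the mean value
inequality on the segment raises the order by one. -/
theorem abs_log_cosh_taylor_le (a b : ℝ) :
    |Real.log (Real.cosh b) - Real.log (Real.cosh a) - (b - a) * Real.tanh a -
      (b - a) ^ 2 / 2 * (1 / Real.cosh a) ^ 2| ≤ 2 * |b - a| ^ 3 := by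
  have hd : ∀ x, HasDerivAt (fun y => Real.log (Real.cosh y) - Real.log (Real.cosh a) -
      (y - a) * Real.tanh a - (y - a) ^ 2 / 2 * (1 / Real.cosh a) ^ 2)
      (Real.tanh x - 1 * Real.tanh a - ((2 : ℕ) * (x - a) ^ (2 - 1) * 1) / 2 *
        (1 / Real.cosh a) ^ 2) x := fun x =>
    (((hasDerivAt_log_cosh x).sub_const _).sub (((hasDerivAt_id x).sub_const a).mul_const _)).sub
      (((((hasDerivAt_id x).sub_const a).pow 2).div_const 2).mul_const _)
  have := Convex.norm_image_sub_le_of_norm_hasDerivWithin_le (s := Set.uIcc a b)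
    (C := 2 * |b - a| ^ 2) (x := a) (y := b) (fun x _ => (hd x).hasDerivWithinAt) (fun x hx => by
      have h1 := abs_tanh_taylor_le a x
      have h2 := Set.abs_sub_left_of_mem_uIcc hx
      have h3 : |x - a| ^ 2 ≤ |b - a| ^ 2 := pow_le_pow_left₀ (abs_nonneg _) h2 2
      have h4 : Real.tanh x - 1 * Real.tanh a - ((2 : ℕ) * (x - a) ^ (2 - 1) * 1) / 2 *
        (1 / Real.cosh a) ^ 2 = Real.tanh x - Real.tanh a - (x - a) * (1 / Real.cosh a) ^ 2 := by
        norm_num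
      rw [h4, Real.norm_eq_abs]
      linarith)
    (convex_uIcc a b) Set.left_mem_uIcc Set.right_mem_uIcc
  have h0 : Real.log (Real.cosh a) - Real.log (Real.cosh a) - (a - a) * Real.tanh a -
      (a - a) ^ 2 / 2 * (1 / Real.cosh a) ^ 2 = 0 := by ring
  rw [h0, sub_zero, Real.norm_eq_abs, Real.norm_eq_abs] at this
  linarith

end Hyperbolic

/-! ### Gaussian integrals, exponential tilting and the odd-function identity. -/

section Gaussian

variable {d : ℕ}

/-- The law `N(θ, I)`. -/
abbrev gaussLaw (θ : Vec d) : Measure (Vec d) := multivariateGaussian θ 1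

/-- Fernique's theorem makes some exp(C‖x‖²) integrable, and completing the square dominates every
exp(c‖x‖) by a multiple of it. -/
theorem integrable_exp_mul_norm (θ : Vec d) (c : ℝ) :
    Integrable (fun x => Real.exp (c * ‖x‖)) (gaussLaw θ) := by
  obtain ⟨C, hC, hint⟩ := IsGaussian.exists_integrable_exp_sq (gaussLaw θ)
  refine (hint.const_mul (Real.exp (c ^ 2 / (4 * C)))).mono' (by fun_prop) (ae_of_all _ fun x => ?_)
  rw [Real.norm_eq_abs, abs_of_pos (Real.exp_pos _), ← Real.exp_add]
  refine Real.exp_le_exp.2 ?_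
  have h : c ^ 2 / (4 * C) + C * ‖x‖ ^ 2 - c * ‖x‖ = (c - 2 * C * ‖x‖) ^ 2 / (4 * C) := by
    field_simp; ring
  have : 0 ≤ (c - 2 * C * ‖x‖) ^ 2 / (4 * C) := by positivity
  linarith

theorem integrable_of_norm_le_exp {F : Type*} [NormedAddCommGroup F] (θ : Vec d) {f : Vec d → F}
    (hf : AEStronglyMeasurable f (gaussLaw θ)) (C c : ℝ)
    (h : ∀ x, ‖f x‖ ≤ C * Real.exp (c * ‖x‖)) : Integrable f (gaussLaw θ) :=
  ((integrable_exp_mul_norm θ c).const_mul C).mono' hf (ae_of_all _ h)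

/-- Complex exponents let one formula serve both as moment generating function and as characteristic
function of a tilted law. -/
theorem integral_cexp_gaussLaw_zero (w : Fin d → ℂ) :
    ∫ x, Complex.exp (∑ j, w j * (x j : ℂ)) ∂(gaussLaw (0 : Vec d)) =
      Complex.exp (∑ j, w j ^ 2 / 2) := by
  have hg (j : Fin d) : ∫ x : ℝ, Complex.exp (w j * x) ∂(gaussianReal 0 1) =
      Complex.exp (w j ^ 2 / 2) := by
    have := complexMGF_id_gaussianReal (μ := 0) (v := 1) (w j)
    simpa [complexMGF] using this
  rw [gaussLaw, multivariateGaussian_zero_one, ← map_pi_eq_stdGaussian, integral_map (by fun_prop)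
    (by fun_prop)]
  simp only [Complex.exp_sum]
  rw [integral_fintype_prod_eq_prod (f := fun j (x : ℝ) => Complex.exp (w j * (x : ℂ)))]
  simp [hg]

theorem inner_eq_sum (a x : Vec d) : inner ℝ a x = ∑ j, a j * x j := by
  simp [PiLp.inner_apply, mul_comm]

theorem integral_exp_inner (θ : Vec d) :
    ∫ x, Real.exp (inner ℝ θ x) ∂(gaussLaw (0 : Vec d)) = Real.exp (‖θ‖ ^ 2 / 2) := by
  have h := integral_cexp_gaussLaw_zero (fun j => (θ j : ℂ))
  have h1 : ∀ x : Vec d, Complex.exp (∑ j, (θ j : ℂ) * (x j : ℂ)) =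
      ((Real.exp (inner ℝ θ x) : ℝ) : ℂ) := fun x => by
    rw [inner_eq_sum]; push_cast; rfl
  simp only [h1] at h
  rw [integral_complex_ofReal] at h
  have h2 : Complex.exp (∑ j, (θ j : ℂ) ^ 2 / 2) = ((Real.exp (‖θ‖ ^ 2 / 2) : ℝ) : ℂ) := by
    rw [EuclideanSpace.real_norm_sq_eq, Finset.sum_div]; push_cast; rfl
  rw [h2] at h
  exact_mod_cast h

theorem integrable_exp_inner (θ θ' : Vec d) :
    Integrable (fun x => Real.exp (inner ℝ θ x)) (gaussLaw θ') := by
  refine integrable_of_norm_le_exp θ' (by fun_prop) 1 ‖θ‖ fun x => ?_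
  rw [Real.norm_eq_abs, abs_of_pos (Real.exp_pos _), one_mul]
  exact Real.exp_le_exp.2 (real_inner_le_norm _ _)

/-- The density of `N(θ, I)` with respect to `N(0, I)`. -/
def gaussDensity (θ x : Vec d) : ℝ := Real.exp (inner ℝ θ x - ‖θ‖ ^ 2 / 2)

theorem gaussDensity_pos (θ x : Vec d) : 0 < gaussDensity θ x := Real.exp_pos _

@[fun_prop]
theorem continuous_gaussDensity (θ : Vec d) : Continuous (gaussDensity θ) := by
  unfold gaussDensity; fun_prop

theorem gaussDensity_eq (θ x : Vec d) :
    gaussDensity θ x = Real.exp (-(‖θ‖ ^ 2 / 2)) * Real.exp (inner ℝ θ x) := by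
  rw [gaussDensity, ← Real.exp_add]; ring_nf

theorem integrable_gaussDensity (θ : Vec d) : Integrable (gaussDensity θ) (gaussLaw 0) := by
  have : gaussDensity θ = fun x => Real.exp (-(‖θ‖ ^ 2 / 2)) * Real.exp (inner ℝ θ x) :=
    funext (gaussDensity_eq θ)
  rw [this]
  exact (integrable_exp_inner θ 0).const_mul _

/-- The two characteristic functions agree: tilting by θ turns the frequency t into the complex
exponent θ + it. -/
theorem gaussLaw_eq_withDensity (θ : Vec d) :
    gaussLaw θ = (gaussLaw 0).withDensity fun x => ENNReal.ofReal (gaussDensity θ x) := by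
  have : IsFiniteMeasure ((gaussLaw 0).withDensity fun x => ENNReal.ofReal (gaussDensity θ x)) :=
    isFiniteMeasure_withDensity_ofReal (integrable_gaussDensity θ).2
  refine Measure.ext_of_charFun (funext fun t => ?_)
  rw [charFun_multivariateGaussian Matrix.PosSemidef.one, charFun_apply,
    integral_withDensity_eq_integral_toReal_smul (by fun_prop) (by simp)]
  have h := integral_cexp_gaussLaw_zero (fun j => (θ j : ℂ) + t j * Complex.I)
  have h1 : ∀ x : Vec d, (ENNReal.ofReal (gaussDensity θ x)).toReal •
      Complex.exp ((inner ℝ x t : ℝ) * Complex.I) = Complex.exp (-(‖θ‖ ^ 2 / 2)) *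
      Complex.exp (∑ j, ((θ j : ℂ) + t j * Complex.I) * (x j : ℂ)) := fun x => by
    rw [ENNReal.toReal_ofReal (gaussDensity_pos θ x).le, gaussDensity, Complex.real_smul,
      Complex.ofReal_exp, ← Complex.exp_add, ← Complex.exp_add, inner_eq_sum, inner_eq_sum]
    congr 1
    push_cast
    simp only [add_mul, Finset.sum_add_distrib, Finset.sum_mul]
    have : ∀ j, (x j : ℂ) * t j * Complex.I = t j * Complex.I * x j := fun j => by ring
    simp only [this]
    ring
  simp only [h1]
  rw [integral_const_mul, h, ← Complex.exp_add]
  congr 1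
  have h2 : ((‖θ‖ : ℝ) : ℂ) ^ 2 = ∑ j, (θ j : ℂ) ^ 2 := by
    rw [← Complex.ofReal_pow, EuclideanSpace.real_norm_sq_eq]; push_cast; rfl
  have h3 : ∀ j, ((θ j : ℂ) + t j * Complex.I) ^ 2 / 2 =
      (θ j : ℂ) ^ 2 / 2 + t j * θ j * Complex.I - t j * t j / 2 := fun j => by
    ring_nf; rw [Complex.I_sq]; ring
  simp only [h3, Finset.sum_sub_distrib, Finset.sum_add_distrib, h2, inner_eq_sum, dotProduct,
    Matrix.one_mulVec, Finset.sum_div]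
  push_cast
  simp only [Finset.sum_mul, Finset.sum_div]
  ring

theorem integral_gaussLaw {F : Type*} [NormedAddCommGroup F] [NormedSpace ℝ F] (θ : Vec d)
    (f : Vec d → F) : ∫ x, f x ∂(gaussLaw θ) = ∫ x, gaussDensity θ x • f x ∂(gaussLaw 0) := by
  rw [gaussLaw_eq_withDensity, integral_withDensity_eq_integral_toReal_smul (by fun_prop) (by simp)]
  simp only [ENNReal.toReal_ofReal (gaussDensity_pos _ _).le]

theorem map_neg_gaussLaw (θ : Vec d) : (gaussLaw θ).map (fun x => -x) = gaussLaw (-θ) := by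
  refine Measure.ext_of_charFun (funext fun t => ?_)
  have : (fun x : Vec d => -x) = fun x => (-1 : ℝ) • x := by ext; simp
  rw [this, charFun_map_smul, charFun_multivariateGaussian Matrix.PosSemidef.one,
    charFun_multivariateGaussian Matrix.PosSemidef.one]
  simp

theorem integral_odd {g : Vec d → ℝ} (hg : ∀ x, g (-x) = -g x) : ∫ x, g x ∂(gaussLaw 0) = 0 := by
  have h : ∫ x, g x ∂(gaussLaw (0 : Vec d)) = ∫ x, g (-x) ∂(gaussLaw (0 : Vec d)) := by
    conv_lhs => rw [← neg_zero (G := Vec d), ← map_neg_gaussLaw]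
    exact integral_map_equiv (MeasurableEquiv.neg (Vec d)) g
  simp only [hg, integral_neg] at h
  linarith

/-- The right side is even in a. Hence 1 - tanh⟪θ, x⟫ times the N(θ, I) density is even in x and
annihilates odd functions. -/
theorem one_sub_tanh_mul_exp (a : ℝ) : (1 - Real.tanh a) * Real.exp a = 1 / Real.cosh a := by
  rw [Real.tanh_eq_sinh_div_cosh]
  have h := (Real.cosh_pos a).ne'
  have h2 : Real.cosh a - Real.sinh a = Real.exp (-a) := Real.cosh_sub_sinh a
  field_simp
  rw [h2, ← Real.exp_add]; simp

/-- For odd `f`, weighting by `tanh ⟪θ, x⟫` does not change the mean under `N(θ, I)`. -/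
theorem integral_mul_tanh_of_odd (θ : Vec d) {f : Vec d → ℝ} (hf : ∀ x, f (-x) = -f x)
    (hint : Integrable f (gaussLaw θ)) :
    ∫ x, f x * Real.tanh (inner ℝ θ x) ∂(gaussLaw θ) = ∫ x, f x ∂(gaussLaw θ) := by
  have h0 : ∫ x, f x * (1 - Real.tanh (inner ℝ θ x)) ∂(gaussLaw θ) = 0 := by
    rw [integral_gaussLaw]
    refine integral_odd fun x => ?_
    have h : ∀ y : Vec d, gaussDensity θ y • (f y * (1 - Real.tanh (inner ℝ θ y))) =
        Real.exp (-(‖θ‖ ^ 2 / 2)) * (f y * (1 / Real.cosh (inner ℝ θ y))) := fun y => by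
      rw [gaussDensity_eq, smul_eq_mul, ← one_sub_tanh_mul_exp]; ring
    rw [h, h, hf]
    simp
  have hint2 : Integrable (fun x => f x * Real.tanh (inner ℝ θ x)) (gaussLaw θ) := by
    refine hint.mul_bdd (c := 1) ?_ (ae_of_all _ fun x => abs_tanh_le_one _)
    fun_prop
  simp only [mul_sub, mul_one] at h0
  rw [integral_sub hint hint2] at h0
  linarith

end Gaussian

/-! ### The score and the Fisher information. -/

section Information

variable {d : ℕ}

/-- Full support upgrades almost everywhere equality of continuous functions to equality at every
point. -/
instance isOpenPosMeasure_gaussLaw (θ : Vec d) : (gaussLaw θ).IsOpenPosMeasure := by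
  have h1 : (gaussianReal 0 1).IsOpenPosMeasure :=
    (gaussianReal_absolutelyContinuous' 0 one_ne_zero).isOpenPosMeasure
  have h0 : (gaussLaw (0 : Vec d)).IsOpenPosMeasure := by
    rw [gaussLaw, multivariateGaussian_zero_one, ← map_pi_eq_stdGaussian]
    exact (PiLp.continuous_toLp 2 _).isOpenPosMeasure_map (WithLp.toLp_surjective 2)
  rw [gaussLaw_eq_withDensity]
  refine (withDensity_absolutelyContinuous' (μ := gaussLaw (0 : Vec d)) (by fun_prop)
    (ae_of_all _ fun x => ?_)).isOpenPosMeasure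
  exact (ENNReal.ofReal_pos.2 (gaussDensity_pos _ _)).ne'

theorem integrable_of_norm_le_pow {F : Type*} [NormedAddCommGroup F] (θ : Vec d) {f : Vec d → F}
    (hf : AEStronglyMeasurable f (gaussLaw θ)) {C : ℝ} (hC : 0 ≤ C) (k : ℕ)
    (h : ∀ x, ‖f x‖ ≤ C * (1 + ‖x‖) ^ k) : Integrable f (gaussLaw θ) := by
  refine integrable_of_norm_le_exp θ hf (C * (k.factorial * Real.exp 1)) 1 fun x => (h x).trans ?_
  have h1 := Real.pow_div_factorial_le_exp (x := 1 + ‖x‖) (by positivity) k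
  rw [div_le_iff₀ (by positivity), Real.exp_add] at h1
  calc C * (1 + ‖x‖) ^ k ≤ C * (Real.exp 1 * Real.exp ‖x‖ * k.factorial) := by gcongr
    _ = _ := by rw [one_mul]; ring

theorem abs_inner_le_mul (h x : Vec d) : |inner ℝ h x| ≤ ‖h‖ * (1 + ‖x‖) :=
  (abs_real_inner_le_norm h x).trans (by gcongr; linarith)

/-- The score `∇_θ log p_θ(x)` of the symmetric two-component mixture. -/
def score (θ x : Vec d) : Vec d := Real.tanh (inner ℝ θ x) • x - θ

@[fun_prop]
theorem continuous_score (θ : Vec d) : Continuous (score θ) := by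
  unfold score; fun_prop

theorem score_neg (θ x : Vec d) : score θ (-x) = score θ x := by
  simp [score, Real.tanh_neg]

theorem norm_score_le (θ x : Vec d) : ‖score θ x‖ ≤ ‖x‖ + ‖θ‖ := by
  refine (norm_sub_le _ _).trans ?_
  rw [norm_smul]
  gcongr
  exact (mul_le_mul_of_nonneg_right (abs_tanh_le_one _) (norm_nonneg x)).trans (by simp)

theorem integrable_inner (h θ : Vec d) : Integrable (fun x => inner ℝ h x) (gaussLaw θ) :=
  integrable_of_norm_le_pow θ (by fun_prop) (norm_nonneg h) 1 fun x => by
    rw [pow_one]; exact abs_inner_le_mul h x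

theorem integrable_inner_mul_inner (h k θ : Vec d) :
    Integrable (fun x => inner ℝ h x * inner ℝ k x) (gaussLaw θ) :=
  integrable_of_norm_le_pow θ (by fun_prop) (C := ‖h‖ * ‖k‖) (by positivity) 2 fun x => by
    rw [norm_mul]
    calc _ ≤ ‖h‖ * (1 + ‖x‖) * (‖k‖ * (1 + ‖x‖)) :=
          mul_le_mul (abs_inner_le_mul h x) (abs_inner_le_mul k x) (abs_nonneg _) (by positivity)
      _ = _ := by ring

theorem integrable_inner_mul_inner_mul_bdd (h k θ : Vec d) {f : Vec d → ℝ} (hf : Continuous f)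
    (hb : ∀ x, |f x| ≤ 1) :
    Integrable (fun x => inner ℝ h x * inner ℝ k x * f x) (gaussLaw θ) :=
  (integrable_inner_mul_inner h k θ).mul_bdd (c := 1) (by fun_prop) (ae_of_all _ hb)

@[fun_prop]
theorem continuous_one_div_cosh : Continuous fun a => 1 / Real.cosh a :=
  continuous_const.div Real.continuous_cosh fun a => (Real.cosh_pos a).ne'

theorem continuous_sech_sq (θ : Vec d) :
    Continuous fun x => (1 / Real.cosh (inner ℝ θ x)) ^ 2 :=
  (continuous_one_div_cosh.comp (by fun_prop : Continuous fun x : Vec d => inner ℝ θ x)).pow 2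

theorem abs_sech_sq_le_one (a : ℝ) : |(1 / Real.cosh a) ^ 2| ≤ 1 := by
  rw [abs_of_nonneg (by positivity)]; exact one_div_cosh_sq_le_one a

theorem integral_inner_gaussLaw (h θ : Vec d) :
    ∫ x, inner ℝ h x ∂(gaussLaw θ) = inner ℝ h θ := by
  rw [integral_inner IsGaussian.integrable_fun_id, integral_id_multivariateGaussian]

theorem integral_inner_mul_inner (h k θ : Vec d) :
    ∫ x, inner ℝ h x * inner ℝ k x ∂(gaussLaw θ) =
      inner ℝ h k + inner ℝ h θ * inner ℝ k θ := by
  have h1 := covarianceBilin_multivariateGaussian (μ := θ) (S := 1) Matrix.PosSemidef.one h k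
  rw [covarianceBilin_apply_eq_cov IsGaussian.memLp_two_id, covariance_eq_sub] at h1
  · simp only [Pi.mul_apply] at h1
    rw [integral_inner_gaussLaw, integral_inner_gaussLaw, Matrix.one_mulVec] at h1
    rw [inner_eq_sum h k]
    simp only [dotProduct] at h1
    linarith
  · exact IsGaussian.memLp_two_id.const_inner h
  · exact IsGaussian.memLp_two_id.const_inner k

/-- The Fisher information as a bilinear form. -/
def infoForm (θ h k : Vec d) : ℝ :=
  inner ℝ h k - ∫ x, inner ℝ h x * inner ℝ k x * (1 / Real.cosh (inner ℝ θ x)) ^ 2 ∂(gaussLaw θ)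

theorem infoForm_eq_dotProduct (θ h k : Vec d) :
    infoForm θ h k = h ⬝ᵥ infoMatrix θ *ᵥ k := by
  have h1 : ∀ x : Vec d, inner ℝ h x * inner ℝ k x * (1 / Real.cosh (inner ℝ θ x)) ^ 2 =
      ∑ i, ∑ j, h i * (x i * x j * (1 / Real.cosh (inner ℝ θ x)) ^ 2 * k j) := fun x => by
    rw [inner_eq_sum h x, inner_eq_sum k x, Finset.sum_mul_sum, Finset.sum_mul]
    refine Finset.sum_congr rfl fun i _ => ?_
    rw [Finset.sum_mul]
    exact Finset.sum_congr rfl fun j _ => by ring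
  have h2 : ∀ i j : Fin d, Integrable (fun x : Vec d =>
      x i * x j * (1 / Real.cosh (inner ℝ θ x)) ^ 2) (gaussLaw θ) := fun i j => by
    have := integrable_inner_mul_inner_mul_bdd (EuclideanSpace.single i (1 : ℝ))
      (EuclideanSpace.single j (1 : ℝ)) θ (continuous_sech_sq θ) (fun x => abs_sech_sq_le_one _)
    simpa [EuclideanSpace.inner_single_left] using this
  rw [infoForm, infoMatrix, Matrix.sub_mulVec, dotProduct_sub, Matrix.one_mulVec, inner_eq_sum]
  congr 1
  simp only [h1]
  rw [integral_finsetSum _ fun i _ => integrable_finsetSum _ fun j _ =>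
    ((h2 i j).mul_const _).const_mul _]
  simp only [dotProduct, Matrix.mulVec, Finset.mul_sum]
  refine Finset.sum_congr rfl fun i _ => ?_
  rw [integral_finsetSum _ fun j _ => ((h2 i j).mul_const _).const_mul _]
  refine Finset.sum_congr rfl fun j _ => ?_
  rw [integral_const_mul, integral_mul_const]
  rfl

theorem integral_inner_mul_tanh (h θ : Vec d) :
    ∫ x, inner ℝ h x * Real.tanh (inner ℝ θ x) ∂(gaussLaw θ) = inner ℝ h θ := by
  rw [integral_mul_tanh_of_odd θ (fun x => inner_neg_right h x) (integrable_inner h θ),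
    integral_inner_gaussLaw]

theorem inner_score (h θ x : Vec d) :
    inner ℝ h (score θ x) = inner ℝ h x * Real.tanh (inner ℝ θ x) - inner ℝ h θ := by
  rw [score, inner_sub_right, inner_smul_right, mul_comm]

@[fun_prop]
theorem continuous_inner_score (h θ : Vec d) : Continuous fun x => inner ℝ h (score θ x) :=
  continuous_const.inner (continuous_score θ)

theorem integrable_inner_mul_tanh (h θ : Vec d) :
    Integrable (fun x => inner ℝ h x * Real.tanh (inner ℝ θ x)) (gaussLaw θ) :=
  (integrable_inner h θ).mul_bdd (c := 1) (by fun_prop) (ae_of_all _ fun x => abs_tanh_le_one _)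

theorem integral_inner_score (h θ : Vec d) : ∫ x, inner ℝ h (score θ x) ∂(gaussLaw θ) = 0 := by
  simp only [inner_score]
  rw [integral_sub (integrable_inner_mul_tanh h θ) (integrable_const _), integral_inner_mul_tanh]
  simp

/-- The information identity: expand the product, write tanh² as 1 - sech², and use that weighting
⟪h, x⟫ by tanh⟪θ, x⟫ leaves its mean ⟪h, θ⟫ unchanged. -/
theorem integral_inner_score_mul (h k θ : Vec d) :
    ∫ x, inner ℝ h (score θ x) * inner ℝ k (score θ x) ∂(gaussLaw θ) = infoForm θ h k := by
  have h1 : ∀ x, inner ℝ h (score θ x) * inner ℝ k (score θ x) =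
      inner ℝ h x * inner ℝ k x -
        inner ℝ h x * inner ℝ k x * (1 / Real.cosh (inner ℝ θ x)) ^ 2 -
        inner ℝ k θ * (inner ℝ h x * Real.tanh (inner ℝ θ x)) -
        inner ℝ h θ * (inner ℝ k x * Real.tanh (inner ℝ θ x)) + inner ℝ h θ * inner ℝ k θ := by
    intro x
    rw [inner_score, inner_score]
    linear_combination (inner ℝ h x * inner ℝ k x) * tanh_sq_add (inner ℝ θ x)
  simp only [h1]
  have i1 := integrable_inner_mul_inner h k θ
  have i2 := integrable_inner_mul_inner_mul_bdd h k θ (continuous_sech_sq θ)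
    (fun x => abs_sech_sq_le_one _)
  have i3 := (integrable_inner_mul_tanh h θ).const_mul (inner ℝ k θ)
  have i4 := (integrable_inner_mul_tanh k θ).const_mul (inner ℝ h θ)
  rw [integral_add (by exact ((i1.sub i2).sub i3).sub i4) (integrable_const _),
    integral_sub (by exact (i1.sub i2).sub i3) i4, integral_sub (by exact i1.sub i2) i3,
    integral_sub i1 i2,
    integral_const_mul, integral_const_mul, integral_inner_mul_tanh, integral_inner_mul_tanh,
    integral_inner_mul_inner, infoForm]
  simp
  ring

theorem infoForm_comm (θ h k : Vec d) : infoForm θ h k = infoForm θ k h := by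
  rw [← integral_inner_score_mul, ← integral_inner_score_mul]
  simp only [mul_comm]

theorem infoForm_self_pos {θ : Vec d} (hθ : θ ≠ 0) {h : Vec d} (hh : h ≠ 0) :
    0 < infoForm θ h h := by
  have hnn : 0 ≤ infoForm θ h h := by
    rw [← integral_inner_score_mul]
    exact integral_nonneg fun x => mul_self_nonneg _
  refine lt_of_le_of_ne hnn fun h0 => hh ?_
  rw [← integral_inner_score_mul, eq_comm, integral_eq_zero_iff_of_nonneg
    (fun x => mul_self_nonneg _)] at h0
  · have h1 := (Continuous.ae_eq_iff_eq (gaussLaw θ)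
      ((continuous_inner_score h θ).mul (continuous_inner_score h θ)) continuous_const).1 h0
    have h2 : ∀ x, inner ℝ h (score θ x) = 0 := fun x => mul_self_eq_zero.1 (congrFun h1 x)
    have h3 : inner ℝ h θ = 0 := by simpa [inner_score] using h2 0
    have h4 := h2 (h + θ)
    rw [inner_score, h3, sub_zero, inner_add_right, inner_add_right, h3, add_zero,
      real_inner_comm h θ, h3, zero_add, mul_eq_zero] at h4
    rcases h4 with h4 | h4
    · exact inner_self_eq_zero.1 h4
    · rw [← Real.tanh_zero, Real.tanh_injective.eq_iff] at h4
      exact absurd (inner_self_eq_zero.1 h4) hθ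
  · refine integrable_of_norm_le_pow θ
      ((continuous_inner_score h θ).mul (continuous_inner_score h θ)).aestronglyMeasurable
      (C := (‖h‖ * (1 + ‖θ‖)) ^ 2) (by positivity) 2 fun x => ?_
    rw [norm_mul, ← sq, ← mul_pow]
    refine pow_le_pow_left₀ (norm_nonneg _) ?_ 2
    calc ‖inner ℝ h (score θ x)‖ ≤ ‖h‖ * (‖x‖ + ‖θ‖) :=
          (abs_real_inner_le_norm _ _).trans (by gcongr; exact norm_score_le θ x)
      _ ≤ ‖h‖ * (1 + ‖θ‖) * (1 + ‖x‖) := by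
        rw [mul_assoc]; gcongr; nlinarith [norm_nonneg x, norm_nonneg θ]

theorem infoMatrix_posDef {θ : Vec d} (hθ : θ ≠ 0) : (infoMatrix θ).PosDef := by
  refine Matrix.PosDef.of_dotProduct_mulVec_pos ?_ fun x hx => ?_
  · ext i j
    simp only [infoMatrix, Matrix.conjTranspose_apply, Matrix.sub_apply, Matrix.of_apply,
      star_trivial, Matrix.one_apply, eq_comm (a := j)]
    congr 2
    ext x
    ring
  · have := infoForm_self_pos hθ (h := WithLp.toLp 2 x) (fun h => hx (by simpa using h))
    rw [infoForm_eq_dotProduct] at this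
    simpa using this

end Information

/-! ### The expected log-likelihood identifies the parameter up to sign. -/

section Identifiability

variable {d : ℕ}

/-- The log-density of the symmetric mixture relative to `N(0, I)`. -/
def logMix (θ x : Vec d) : ℝ := Real.log (Real.cosh (inner ℝ θ x)) - ‖θ‖ ^ 2 / 2

@[fun_prop]
theorem continuous_log_cosh : Continuous fun a => Real.log (Real.cosh a) :=
  Real.continuous_cosh.log fun a => (Real.cosh_pos a).ne'

@[fun_prop]
theorem continuous_logMix (θ : Vec d) : Continuous (logMix θ) := by
  unfold logMix
  exact (continuous_log_cosh.comp (by fun_prop : Continuous fun x : Vec d => inner ℝ θ x)).sub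
    continuous_const

theorem abs_log_cosh_inner_le (θ x : Vec d) :
    |Real.log (Real.cosh (inner ℝ θ x))| ≤ ‖θ‖ * ‖x‖ := by
  have := abs_log_cosh_sub_le 0 (inner ℝ θ x)
  simp only [Real.cosh_zero, Real.log_one, sub_zero] at this
  exact this.trans (abs_real_inner_le_norm _ _)

theorem integrable_logMix (θ θ₀ : Vec d) : Integrable (logMix θ) (gaussLaw θ₀) := by
  refine integrable_of_norm_le_pow θ₀ (by fun_prop) (C := ‖θ‖ + ‖θ‖ ^ 2 / 2) (by positivity) 1
    fun x => ?_
  rw [pow_one, logMix]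
  refine (norm_sub_le _ _).trans ?_
  rw [Real.norm_eq_abs, Real.norm_eq_abs, abs_of_nonneg (by positivity : 0 ≤ ‖θ‖ ^ 2 / 2)]
  have := abs_log_cosh_inner_le θ x
  nlinarith [norm_nonneg x, norm_nonneg θ, sq_nonneg ‖θ‖, mul_nonneg (sq_nonneg ‖θ‖) (norm_nonneg x)]

theorem exp_logMix (θ x : Vec d) :
    Real.exp (logMix θ x) = Real.cosh (inner ℝ θ x) * Real.exp (-(‖θ‖ ^ 2 / 2)) := by
  rw [logMix, sub_eq_add_neg, Real.exp_add, Real.exp_log (Real.cosh_pos _)]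

theorem integrable_cosh_inner (θ θ' : Vec d) :
    Integrable (fun x => Real.cosh (inner ℝ θ x)) (gaussLaw θ') := by
  simp only [Real.cosh_eq, ← inner_neg_left]
  exact ((integrable_exp_inner θ θ').add (integrable_exp_inner (-θ) θ')).div_const 2

theorem integral_cosh_inner (θ : Vec d) :
    ∫ x, Real.cosh (inner ℝ θ x) ∂(gaussLaw 0) = Real.exp (‖θ‖ ^ 2 / 2) := by
  simp only [Real.cosh_eq, ← inner_neg_left]
  rw [integral_div, integral_add (integrable_exp_inner θ 0) (integrable_exp_inner (-θ) 0),
    integral_exp_inner, integral_exp_inner, norm_neg]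
  ring

theorem integrable_exp_logMix_sub (θ θ₀ : Vec d) :
    Integrable (fun x => Real.exp (logMix θ x - logMix θ₀ x)) (gaussLaw θ₀) := by
  refine integrable_of_norm_le_exp θ₀ ?_ (Real.exp (‖θ‖ ^ 2 / 2 + ‖θ₀‖ ^ 2 / 2)) (‖θ‖ + ‖θ₀‖)
    fun x => ?_
  · exact (Real.continuous_exp.comp ((continuous_logMix θ).sub
      (continuous_logMix θ₀))).aestronglyMeasurable
  · rw [Real.norm_eq_abs, abs_of_pos (Real.exp_pos _), ← Real.exp_add, Real.exp_le_exp]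
    have h1 := abs_le.1 (abs_log_cosh_inner_le θ x)
    have h2 := abs_le.1 (abs_log_cosh_inner_le θ₀ x)
    simp only [logMix]
    nlinarith [sq_nonneg ‖θ‖, sq_nonneg ‖θ₀‖]

/-- The ratio of mixture densities is even, so one component integrates it as the mixture does: the
component density is the mixture density times 1 + tanh⟪θ₀, x⟫, and the tanh part contributes an odd
integrand. -/
theorem integral_exp_logMix_sub (θ θ₀ : Vec d) :
    ∫ x, Real.exp (logMix θ x - logMix θ₀ x) ∂(gaussLaw θ₀) = 1 := by
  rw [integral_gaussLaw]
  have h : ∀ x : Vec d, gaussDensity θ₀ x • Real.exp (logMix θ x - logMix θ₀ x) =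
      Real.exp (-(‖θ‖ ^ 2 / 2)) * Real.cosh (inner ℝ θ x) +
        Real.exp (-(‖θ‖ ^ 2 / 2)) * (Real.cosh (inner ℝ θ x) * Real.tanh (inner ℝ θ₀ x)) := by
    intro x
    rw [Real.exp_sub, exp_logMix, exp_logMix, gaussDensity_eq, smul_eq_mul,
      Real.tanh_eq_sinh_div_cosh, ← Real.cosh_add_sinh (inner ℝ θ₀ x)]
    have := (Real.cosh_pos (inner ℝ θ₀ x)).ne'
    field_simp
  simp only [h]
  have hi : Integrable (fun x => Real.cosh (inner ℝ θ x) * Real.tanh (inner ℝ θ₀ x))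
      (gaussLaw (0 : Vec d)) :=
    (integrable_cosh_inner θ 0).mul_bdd (c := 1) (by fun_prop)
      (ae_of_all _ fun x => abs_tanh_le_one _)
  rw [integral_add ((integrable_cosh_inner θ 0).const_mul _) (hi.const_mul _), integral_const_mul,
    integral_const_mul, integral_cosh_inner, integral_odd (fun x => by simp [Real.tanh_neg]),
    ← Real.exp_add]
  simp

/-- The expected log-density is uniquely maximized, up to sign, at the true parameter. -/
theorem eq_or_eq_neg_of_integral_logMix_le {θ θ₀ : Vec d}
    (h : ∫ x, logMix θ₀ x ∂(gaussLaw θ₀) ≤ ∫ x, logMix θ x ∂(gaussLaw θ₀)) :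
    θ = θ₀ ∨ θ = -θ₀ := by
  have hnn : 0 ≤ fun x => Real.exp (logMix θ x - logMix θ₀ x) -
      ((logMix θ x - logMix θ₀ x) + 1) := fun x => by
    have := Real.add_one_le_exp (logMix θ x - logMix θ₀ x)
    simp only [Pi.zero_apply]; linarith
  have i1 := integrable_exp_logMix_sub θ θ₀
  have i2 : Integrable (fun x => logMix θ x - logMix θ₀ x) (gaussLaw θ₀) :=
    (integrable_logMix θ θ₀).sub (integrable_logMix θ₀ θ₀)
  have i3 : Integrable (fun x => (logMix θ x - logMix θ₀ x) + 1) (gaussLaw θ₀) :=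
    i2.add (integrable_const _)
  -- The strict form of Gibbs' inequality: the integral of exp u - (u + 1) ≥ 0 is minus the mean of
  -- u, hence nonpositive by hypothesis, so u vanishes everywhere.
  have h0 : ∫ x, (Real.exp (logMix θ x - logMix θ₀ x) -
      ((logMix θ x - logMix θ₀ x) + 1)) ∂(gaussLaw θ₀) = 0 := by
    refine le_antisymm ?_ (integral_nonneg hnn)
    have e : ∫ x, ((logMix θ x - logMix θ₀ x) + 1) ∂(gaussLaw θ₀) =
        ∫ x, logMix θ x ∂(gaussLaw θ₀) - ∫ x, logMix θ₀ x ∂(gaussLaw θ₀) + 1 := by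
      rw [integral_add i2 (integrable_const _),
        integral_sub (integrable_logMix θ θ₀) (integrable_logMix θ₀ θ₀)]
      simp
    rw [integral_sub i1 i3, integral_exp_logMix_sub, e]
    linarith
  rw [integral_eq_zero_iff_of_nonneg hnn (i1.sub i3)] at h0
  have h1 := (Continuous.ae_eq_iff_eq (gaussLaw θ₀) ((Real.continuous_exp.comp
    ((continuous_logMix θ).sub (continuous_logMix θ₀))).sub (((continuous_logMix θ).sub
    (continuous_logMix θ₀)).add continuous_const)) continuous_const).1 h0
  have h2 : ∀ x, logMix θ x = logMix θ₀ x := fun x => by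
    by_contra hne
    have := Real.add_one_lt_exp (sub_ne_zero.2 hne)
    have h3 := congrFun h1 x
    change Real.exp (logMix θ x - logMix θ₀ x) - (logMix θ x - logMix θ₀ x + 1) = 0 at h3
    linarith
  -- Two evaluations suffice: x = 0 equates the norms, and x = θ₀ then forces equality in
  -- Cauchy–Schwarz, so θ = ±θ₀.
  have hn : ‖θ‖ ^ 2 = ‖θ₀‖ ^ 2 := by
    have := h2 0
    simp only [logMix, inner_zero_right, Real.cosh_zero, Real.log_one] at this
    linarith
  have h3 : |inner ℝ θ θ₀| = |inner ℝ θ₀ θ₀| := by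
    have := h2 θ₀
    simp only [logMix, hn, sub_left_inj] at this
    have h4 := Real.log_injOn_pos (Real.cosh_pos _) (Real.cosh_pos _) this
    exact le_antisymm (Real.cosh_le_cosh.1 h4.le) (Real.cosh_le_cosh.1 h4.ge)
  rcases abs_eq_abs.1 h3 with h4 | h4
  · left
    rw [← sub_eq_zero, ← norm_eq_zero, ← sq_eq_zero_iff, norm_sub_sq_real, h4, hn,
      real_inner_self_eq_norm_sq]
    ring
  · right
    rw [eq_neg_iff_add_eq_zero, ← norm_eq_zero, ← sq_eq_zero_iff, norm_add_sq_real, h4, hn,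
      real_inner_self_eq_norm_sq]
    ring

/-- The parameter 0 has zero log-density and is not ±θ₀. Strict positivity makes the empirical
criterion eventually negative at θ₀, which is what guarantees a minimizer in the half-space. -/
theorem integral_logMix_pos {θ₀ : Vec d} (h : θ₀ ≠ 0) : 0 < ∫ x, logMix θ₀ x ∂(gaussLaw θ₀) := by
  by_contra! hle
  have := eq_or_eq_neg_of_integral_logMix_le (θ := 0) (θ₀ := θ₀) (by simpa [logMix] using hle)
  rcases this with h1 | h1
  · exact h h1.symm
  · exact h (neg_eq_zero.1 h1.symm)

end Identifiability

/-! ### Products of measures with densities. -/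

section Product

theorem pi_withDensity_ofReal {ι α : Type*} [Fintype ι] [MeasurableSpace α] (μ : Measure α)
    [IsFiniteMeasure μ] {g : ι → α → ℝ} (h0 : ∀ i a, 0 ≤ g i a)
    (hint : ∀ i, Integrable (g i) μ) :
    Measure.pi (fun i => μ.withDensity fun a => ENNReal.ofReal (g i a)) =
      (Measure.pi fun _ : ι => μ).withDensity fun x => ENNReal.ofReal (∏ i, g i (x i)) := by
  have hf : ∀ i, IsFiniteMeasure (μ.withDensity fun a => ENNReal.ofReal (g i a)) := fun i =>
    isFiniteMeasure_withDensity_ofReal (hint i).2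
  refine Measure.pi_eq fun s hs => ?_
  have hprod : Integrable (fun x : ι → α => ∏ i, g i (x i)) (Measure.pi fun _ : ι => μ) :=
    Integrable.fintype_prod hint
  rw [withDensity_apply _ (MeasurableSet.univ_pi hs), ← ofReal_integral_eq_lintegral_ofReal
    hprod.restrict (ae_of_all _ fun x => Finset.prod_nonneg fun i _ => h0 i _),
    Measure.restrict_pi_pi, integral_fintype_prod_eq_prod (f := fun i a => g i a),
    ENNReal.ofReal_prod_of_nonneg fun i _ => integral_nonneg fun a => h0 i a]
  refine Finset.prod_congr rfl fun i _ => ?_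
  rw [withDensity_apply _ (hs i), ofReal_integral_eq_lintegral_ofReal (hint i).restrict
    (ae_of_all _ fun x => h0 i _)]

end Product

/-! ### Density and likelihood ratio of the Ising-label model. -/

section Density

variable {n d : ℕ}

/-- The sum over sites of the spin-weighted observations. -/
def spinSum (w : Labels n) (x : Fin n → Vec d) : Vec d := ∑ i, spin w i • x i

@[fun_prop]
theorem continuous_spinSum (w : Labels n) : Continuous (spinSum (d := d) w) := by
  unfold spinSum; fun_prop

theorem spin_sq (z : Labels n) (i : Fin n) : spin z i * spin z i = 1 := by
  rcases Int.units_eq_one_or (z i) with h | h <;> simp [spin, h]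

theorem spin_eq_or (z : Labels n) (i : Fin n) : spin z i = 1 ∨ spin z i = -1 := by
  rcases Int.units_eq_one_or (z i) with h | h <;> simp [spin, h]

/-- The log-partition function of the random field Ising model given the data. -/
def logPart (β : ℝ) (A : Matrix (Fin n) (Fin n) ℝ) (x : Fin n → Vec d) (θ : Vec d) : ℝ :=
  Real.log (∑ w : Labels n,
    Real.exp (β / 2 * (spin w ⬝ᵥ A *ᵥ spin w) + inner ℝ θ (spinSum w x)))

theorem part_pos (β : ℝ) (A : Matrix (Fin n) (Fin n) ℝ) (x : Fin n → Vec d) (θ : Vec d) :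
    0 < ∑ w : Labels n,
      Real.exp (β / 2 * (spin w ⬝ᵥ A *ᵥ spin w) + inner ℝ θ (spinSum w x)) :=
  Finset.sum_pos (fun _ _ => Real.exp_pos _) Finset.univ_nonempty

@[fun_prop]
theorem continuous_logPart (β : ℝ) (A : Matrix (Fin n) (Fin n) ℝ) (θ : Vec d) :
    Continuous fun x => logPart β A x θ := by
  unfold logPart
  exact Continuous.log (by fun_prop) fun x => (part_pos β A x θ).ne'

/-- The density of the data law with Ising labels relative to i.i.d. standard normal data. -/
def isingDensity (β : ℝ) (A : Matrix (Fin n) (Fin n) ℝ) (θ : Vec d) (x : Fin n → Vec d) : ℝ :=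
  Real.exp (logPart β A x θ - n * (‖θ‖ ^ 2 / 2)) /
    ∑ b : Labels n, Real.exp (β / 2 * (spin b ⬝ᵥ A *ᵥ spin b))

theorem isingDensity_pos (β : ℝ) (A : Matrix (Fin n) (Fin n) ℝ) (θ : Vec d) (x : Fin n → Vec d) :
    0 < isingDensity β A θ x :=
  div_pos (Real.exp_pos _) (Finset.sum_pos (fun _ _ => Real.exp_pos _) Finset.univ_nonempty)

@[fun_prop]
theorem continuous_isingDensity (β : ℝ) (A : Matrix (Fin n) (Fin n) ℝ) (θ : Vec d) :
    Continuous (isingDensity β A θ) := by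
  unfold isingDensity; fun_prop

theorem norm_spin_smul (z : Labels n) (i : Fin n) (x : Vec d) : ‖spin z i • x‖ = ‖x‖ := by
  rcases spin_eq_or z i with h | h <;> simp [h]

theorem prod_gaussDensity_spin (z : Labels n) (θ : Vec d) (x : Fin n → Vec d) :
    ∏ i, gaussDensity (spin z i • θ) (x i) =
      Real.exp (inner ℝ θ (spinSum z x) - n * (‖θ‖ ^ 2 / 2)) := by
  simp only [gaussDensity]
  rw [← Real.exp_sum, Finset.sum_sub_distrib, spinSum, inner_sum]
  simp [norm_spin_smul, inner_smul_left, inner_smul_right]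

/-- Given labels z, the product density is exp(⟪θ, `spinSum z x`⟫ - n‖θ‖²/2), since signs do not
change ‖θ‖. Averaging over the Ising weights produces the random field partition function. -/
theorem dataLaw_ising_eq_withDensity (β : ℝ) (A : Matrix (Fin n) (Fin n) ℝ) (θ : Vec d) :
    dataLaw θ (ising β A) = (Measure.pi fun _ : Fin n => gaussLaw (0 : Vec d)).withDensity
      fun x => ENNReal.ofReal (isingDensity β A θ x) := by
  have h1 : ∀ z : Labels n, Measure.pi (fun i => multivariateGaussian (spin z i • θ) 1) =
      (Measure.pi fun _ : Fin n => gaussLaw (0 : Vec d)).withDensity fun x =>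
        ENNReal.ofReal (Real.exp (inner ℝ θ (spinSum z x) - n * (‖θ‖ ^ 2 / 2))) := fun z => by
    have := pi_withDensity_ofReal (gaussLaw (0 : Vec d))
      (g := fun i => gaussDensity (spin z i • θ))
      (fun i a => (gaussDensity_pos _ a).le) (fun i => integrable_gaussDensity _)
    simp only [← gaussLaw_eq_withDensity, prod_gaussDensity_spin] at this
    exact this
  ext s hs
  rw [withDensity_apply _ hs]
  simp only [dataLaw, Measure.coe_finsetSum, Finset.sum_apply, Measure.smul_apply, h1,
    withDensity_apply _ hs, smul_eq_mul]
  simp_rw [← lintegral_const_mul' _ _ (PMF.apply_ne_top _ _)]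
  rw [← lintegral_finsetSum _ fun z _ => by fun_prop]
  refine lintegral_congr fun x => ?_
  have h2 : ∀ z : Labels n, ising β A z = ENNReal.ofReal (Real.exp (β / 2 * (spin z ⬝ᵥ A *ᵥ spin z))
    / ∑ b : Labels n, Real.exp (β / 2 * (spin b ⬝ᵥ A *ᵥ spin b))) := fun z => rfl
  have hp : 0 < ∑ b : Labels n, Real.exp (β / 2 * (spin b ⬝ᵥ A *ᵥ spin b)) :=
    Finset.sum_pos (fun _ _ => Real.exp_pos _) Finset.univ_nonempty
  simp only [h2]
  simp_rw [← ENNReal.ofReal_mul (div_nonneg (Real.exp_pos _).le hp.le)]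
  rw [← ENNReal.ofReal_sum_of_nonneg fun z _ =>
    mul_nonneg (div_nonneg (Real.exp_pos _).le hp.le) (Real.exp_pos _).le]
  congr 1
  rw [isingDensity, Real.exp_sub, logPart, Real.exp_log (part_pos β A x θ), Finset.sum_div,
    Finset.sum_div]
  refine Finset.sum_congr rfl fun z _ => ?_
  rw [Real.exp_sub, Real.exp_add]
  ring

/-- The log-likelihood ratio between two parameters, with Ising labels. -/
def isingLLR (β : ℝ) (A : Matrix (Fin n) (Fin n) ℝ) (θ θ' : Vec d) (x : Fin n → Vec d) : ℝ :=
  logPart β A x θ' - logPart β A x θ - n * ((‖θ'‖ ^ 2 - ‖θ‖ ^ 2) / 2)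

@[fun_prop]
theorem continuous_isingLLR (β : ℝ) (A : Matrix (Fin n) (Fin n) ℝ) (θ θ' : Vec d) :
    Continuous (isingLLR β A θ θ') := by
  unfold isingLLR; fun_prop

theorem integral_dataLaw_ising {F : Type*} [NormedAddCommGroup F] [NormedSpace ℝ F]
    (β : ℝ) (A : Matrix (Fin n) (Fin n) ℝ) (θ θ' : Vec d) (f : (Fin n → Vec d) → F) :
    ∫ x, f x ∂(dataLaw θ' (ising β A)) =
      ∫ x, Real.exp (isingLLR β A θ θ' x) • f x ∂(dataLaw θ (ising β A)) := by
  rw [dataLaw_ising_eq_withDensity, dataLaw_ising_eq_withDensity,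
    integral_withDensity_eq_integral_toReal_smul (by fun_prop) (by simp),
    integral_withDensity_eq_integral_toReal_smul (by fun_prop) (by simp)]
  refine integral_congr_ae (ae_of_all _ fun x => ?_)
  simp only [ENNReal.toReal_ofReal (isingDensity_pos _ _ _ _).le, smul_smul]
  congr 1
  rw [isingDensity, isingDensity, div_mul_eq_mul_div, ← Real.exp_add, isingLLR]
  ring_nf

theorem integrable_exp_isingLLR (β : ℝ) (A : Matrix (Fin n) (Fin n) ℝ) (θ θ' : Vec d) :
    Integrable (fun x => Real.exp (isingLLR β A θ θ' x)) (dataLaw θ (ising β A)) := by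
  -- The change of measure identity needs no integrability. For the constant 1 it equates the
  -- integral with total mass 1, whereas a non-integrable function has integral 0 by convention.
  by_contra h
  have h1 := integral_dataLaw_ising β A θ θ' (fun _ => (1 : ℝ))
  simp only [smul_eq_mul, mul_one] at h1
  rw [integral_undef h] at h1
  simp at h1

theorem integral_exp_isingLLR (β : ℝ) (A : Matrix (Fin n) (Fin n) ℝ) (θ θ' : Vec d) :
    ∫ x, Real.exp (isingLLR β A θ θ' x) ∂(dataLaw θ (ising β A)) = 1 := by
  have h1 := integral_dataLaw_ising β A θ θ' (fun _ => (1 : ℝ))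
  simpa using h1.symm

end Density

/-! ### I.i.d. labels as a degenerate Ising model. -/

section Independent

variable {n d : ℕ}

theorem iidLabels_eq_ising (n : ℕ) : iidLabels n = ising 0 (0 : Matrix (Fin n) (Fin n) ℝ) := by
  ext z
  rw [iidLabels, PMF.uniformOfFintype_apply, ising, gibbs, PMF.ofFintype_apply]
  simp only [zero_div, zero_mul, Real.exp_zero, Finset.sum_const, Finset.card_univ, nsmul_eq_mul,
    mul_one]
  rw [one_div, ENNReal.ofReal_inv_of_pos (by exact_mod_cast Fintype.card_pos),
    ENNReal.ofReal_natCast]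

/-- Without coupling the partition function factors over sites. The constant n log 2 cancels in
likelihood ratios. -/
theorem logPart_zero (x : Fin n → Vec d) (θ : Vec d) :
    logPart 0 (0 : Matrix (Fin n) (Fin n) ℝ) x θ =
      ∑ i, Real.log (Real.cosh (inner ℝ θ (x i))) + n * Real.log 2 := by
  have h1 : ∑ w : Labels n, Real.exp (0 / 2 * (spin w ⬝ᵥ (0 : Matrix (Fin n) (Fin n) ℝ) *ᵥ spin w) +
      inner ℝ θ (spinSum w x)) = ∏ i, (2 * Real.cosh (inner ℝ θ (x i))) := by
    have h2 : ∀ i, 2 * Real.cosh (inner ℝ θ (x i)) =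
        ∑ s : ℤˣ, Real.exp (((s : ℤ) : ℝ) * inner ℝ θ (x i)) := fun i => by
      rw [Real.cosh_eq]
      have : (Finset.univ : Finset ℤˣ) = {1, -1} := rfl
      rw [this, Finset.sum_pair (by decide)]
      simp
      ring
    simp only [h2]
    rw [Finset.prod_univ_sum]
    simp only [Fintype.piFinset_univ]
    refine Finset.sum_congr rfl fun w _ => ?_
    rw [← Real.exp_sum, spinSum, inner_sum]
    simp [inner_smul_right, spin]
  rw [logPart, h1, Real.log_prod fun i _ => (mul_pos two_pos (Real.cosh_pos _)).ne']
  simp only [Real.log_mul two_ne_zero (Real.cosh_pos _).ne', Finset.sum_add_distrib]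
  simp
  ring

end Independent

/-! ### Sign flips and label-free statistics. -/

section Flip

variable {n d : ℕ}

/-- Multiplication of the observations by the labels. -/
def flip (z : Labels n) (y : Fin n → Vec d) : Fin n → Vec d := fun i => spin z i • y i

@[fun_prop]
theorem continuous_flip (z : Labels n) : Continuous (flip (d := d) z) := by
  unfold flip; fun_prop

theorem flip_flip (z : Labels n) (y : Fin n → Vec d) : flip z (flip z y) = y := by
  ext i : 1
  simp [flip, smul_smul, spin_sq]

theorem map_smul_gaussLaw (z : Labels n) (i : Fin n) (θ : Vec d) :
    (gaussLaw θ).map (fun x => spin z i • x) = gaussLaw (spin z i • θ) := by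
  rcases spin_eq_or z i with h | h
  · simp [h]
  · simp only [h, neg_smul, one_smul]; exact map_neg_gaussLaw θ

theorem pi_gaussLaw_spin (z : Labels n) (θ : Vec d) :
    Measure.pi (fun i => multivariateGaussian (spin z i • θ) 1) =
      (Measure.pi fun _ : Fin n => gaussLaw θ).map (flip z) := by
  have hp : ∀ i, IsProbabilityMeasure ((gaussLaw θ).map fun x => spin z i • x) := fun i =>
    Measure.isProbabilityMeasure_map (by fun_prop)
  have := Measure.pi_map_pi (μ := fun _ : Fin n => gaussLaw θ) (f := fun i x => spin z i • x)
    (fun i => by fun_prop)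
  simp only [map_smul_gaussLaw] at this
  exact this.symm

/-- The law of the data is dominated by that of i.i.d. data with all labels allowed. -/
theorem dataLaw_le_of_flip (θ : Vec d) (Q : PMF (Labels n)) {s t : Set (Fin n → Vec d)}
    (h : ∀ z, flip z ⁻¹' s ⊆ t) :
    dataLaw θ Q s ≤ (Measure.pi fun _ : Fin n => gaussLaw θ) t := by
  have hz : ∀ z : Labels n, Measure.pi (fun i => multivariateGaussian (spin z i • θ) 1) s ≤
      (Measure.pi fun _ : Fin n => gaussLaw θ) t := fun z => by
    -- A flip is an involution, hence a measurable equivalence, and image measures under it can be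
    -- computed on arbitrary sets: no measurability of `s` is required.
    let e : (Fin n → Vec d) ≃ᵐ (Fin n → Vec d) :=
      { toFun := flip z, invFun := flip z, left_inv := flip_flip z, right_inv := flip_flip z,
        measurable_toFun := (continuous_flip z).measurable
        measurable_invFun := (continuous_flip z).measurable }
    rw [pi_gaussLaw_spin]
    change Measure.map e _ s ≤ _
    rw [e.map_apply]
    exact measure_mono (h z)
  simp only [dataLaw, Measure.coe_finsetSum, Finset.sum_apply, Measure.smul_apply, smul_eq_mul]
  calc _ ≤ ∑ z, Q z * (Measure.pi fun _ : Fin n => gaussLaw θ) t := by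
        exact Finset.sum_le_sum fun z _ => mul_le_mul' le_rfl (hz z)
    _ = (Measure.pi fun _ : Fin n => gaussLaw θ) t := by
      rw [← Finset.sum_mul, ← tsum_fintype (L := .unconditional _), Q.tsum_coe, one_mul]

/-- Every mixture component is a flip of the same product law, so an invariant function has the same
integral against each, whatever the label weights. -/
theorem integral_dataLaw_of_even {F : Type*} [NormedAddCommGroup F] [NormedSpace ℝ F]
    (θ : Vec d) (Q : PMF (Labels n)) {f : (Fin n → Vec d) → F} (hf : StronglyMeasurable f)
    (heven : ∀ z y, f (flip z y) = f y)
    (hint : Integrable f (Measure.pi fun _ : Fin n => gaussLaw θ)) :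
    Integrable f (dataLaw θ Q) ∧
    ∫ x, f x ∂(dataLaw θ Q) = ∫ y, f y ∂(Measure.pi fun _ : Fin n => gaussLaw θ) := by
  have hz : ∀ z : Labels n, Integrable f (Q z •
      Measure.pi (fun i => multivariateGaussian (spin z i • θ) 1)) := fun z => by
    refine Integrable.smul_measure ?_ (PMF.apply_ne_top _ _)
    rw [pi_gaussLaw_spin, integrable_map_measure hf.aestronglyMeasurable (by fun_prop)]
    exact hint.congr (ae_of_all _ fun y => (heven z y).symm)
  refine ⟨integrable_finsetSum_measure.2 fun z _ => hz z, ?_⟩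
  rw [dataLaw, integral_finsetSum_measure fun z _ => hz z]
  have h1 : ∀ z : Labels n, ∫ x, f x ∂(Q z •
      Measure.pi (fun i => multivariateGaussian (spin z i • θ) 1)) =
      (Q z).toReal • ∫ y, f y ∂(Measure.pi fun _ : Fin n => gaussLaw θ) := fun z => by
    rw [integral_smul_measure, pi_gaussLaw_spin, integral_map (by fun_prop)
      hf.aestronglyMeasurable]
    simp only [heven]
  simp only [h1]
  rw [← Finset.sum_smul, ← ENNReal.toReal_sum fun z _ => PMF.apply_ne_top _ _,
    ← tsum_fintype (L := .unconditional _), Q.tsum_coe, ENNReal.toReal_one, one_smul]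

end Flip

/-- Convergence to zero in probability, along a sequence of probability spaces. -/
def TendstoZeroInProb {Ω : ℕ → Type*} [∀ n, MeasurableSpace (Ω n)] (P : ∀ n, Measure (Ω n))
    {F : Type*} [Norm F] (f : ∀ n, Ω n → F) : Prop :=
  ∀ ε : ℝ, 0 < ε → Tendsto (fun n => P n {x | ε ≤ ‖f n x‖}) atTop (𝓝 0)

/-! ### Calculus of convergence in probability. -/

section InProb

variable {Ω : ℕ → Type*} [∀ n, MeasurableSpace (Ω n)] {P : ∀ n, Measure (Ω n)}
  {F : Type*} [NormedAddCommGroup F]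

theorem TendstoZeroInProb.of_forall_le {f : ∀ n, Ω n → F}
    (h : ∀ ε : ℝ, 0 < ε → ∀ δ : ℝ≥0∞, 0 < δ → ∃ u : ℕ → ℝ≥0∞, Tendsto u atTop (𝓝 0) ∧
      ∀ᶠ n in atTop, P n {x | ε ≤ ‖f n x‖} ≤ u n + δ) : TendstoZeroInProb P f := by
  intro ε hε
  rw [ENNReal.tendsto_nhds_zero]
  intro δ hδ
  obtain ⟨u, hu, hle⟩ := h ε hε (δ / 2) (ENNReal.half_pos hδ.ne')
  filter_upwards [hle, ENNReal.tendsto_nhds_zero.1 hu (δ / 2) (ENNReal.half_pos hδ.ne')] with n h1 h2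
  calc _ ≤ u n + δ / 2 := h1
    _ ≤ δ / 2 + δ / 2 := by gcongr
    _ = δ := ENNReal.add_halves δ

theorem TendstoZeroInProb.add {f g : ∀ n, Ω n → F} (hf : TendstoZeroInProb P f)
    (hg : TendstoZeroInProb P g) : TendstoZeroInProb P fun n x => f n x + g n x := by
  intro ε hε
  have h := (hf (ε / 2) (half_pos hε)).add (hg (ε / 2) (half_pos hε))
  rw [add_zero] at h
  refine tendsto_of_tendsto_of_tendsto_of_le_of_le tendsto_const_nhds h (fun _ => zero_le) fun n => ?_
  refine (measure_mono fun x hx => ?_).trans (measure_union_le _ _)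
  by_contra hc
  simp only [Set.mem_union, Set.mem_ofPred_eq, not_or, not_le] at hc hx
  linarith [norm_add_le (f n x) (g n x)]

theorem TendstoZeroInProb.congr {f g : ∀ n, Ω n → F} (hf : TendstoZeroInProb P f)
    (h : ∀ᶠ n in atTop, ∀ x, f n x = g n x) : TendstoZeroInProb P g := fun ε hε =>
  (hf ε hε).congr' (h.mono fun n hn => by simp only [hn])

theorem TendstoZeroInProb.mono {G : Type*} [NormedAddCommGroup G] {f : ∀ n, Ω n → F}
    {g : ∀ n, Ω n → G} (hf : TendstoZeroInProb P f) (h : ∀ n x, ‖g n x‖ ≤ ‖f n x‖) :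
    TendstoZeroInProb P g := fun ε hε =>
  tendsto_of_tendsto_of_tendsto_of_le_of_le tendsto_const_nhds (hf ε hε) (fun _ => zero_le)
    fun n => measure_mono fun x hx => le_trans hx (h n x)

end InProb

/-! ### From almost sure statements on one sequence space to convergence in probability. -/

section Sequence

variable {d : ℕ}

/-- The law of an infinite i.i.d. sequence of `N(θ, I)` vectors. -/
abbrev seqLaw (θ : Vec d) : Measure (ℕ → Vec d) := Measure.infinitePi fun _ : ℕ => gaussLaw θ

/-- The first `n` terms of a sequence. -/
def trunc (n : ℕ) (ω : ℕ → Vec d) : Fin n → Vec d := fun i => ω i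

theorem measurable_trunc (n : ℕ) : Measurable (trunc (d := d) n) :=
  measurable_pi_lambda _ fun i => measurable_pi_apply (i : ℕ)

theorem iIndepFun_eval (θ : Vec d) :
    iIndepFun (fun (i : ℕ) (ω : ℕ → Vec d) => ω i) (seqLaw θ) :=
  iIndepFun_infinitePi (X := fun _ x => x) fun _ => measurable_id

theorem map_trunc (n : ℕ) (θ : Vec d) :
    (seqLaw θ).map (trunc n) = Measure.pi fun _ : Fin n => gaussLaw θ := by
  have h := (iIndepFun_eval θ).precomp (g := fun i : Fin n => (i : ℕ)) Fin.val_injective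
  rw [iIndepFun_iff_map_fun_eq_pi_map (fun i => (measurable_pi_apply _).aemeasurable)] at h
  simp only [Measure.infinitePi_map_eval] at h
  exact h

theorem strong_law_seqLaw_smul {F : Type*} [NormedAddCommGroup F] [NormedSpace ℝ F]
    [CompleteSpace F] [MeasurableSpace F] [BorelSpace F] (θ : Vec d) {g : Vec d → F}
    (hg : Measurable g) (hint : Integrable g (gaussLaw θ)) :
    ∀ᵐ ω ∂(seqLaw θ), Tendsto (fun n : ℕ => (n : ℝ)⁻¹ • ∑ i : Fin n, g (trunc n ω i)) atTop
      (𝓝 (∫ x, g x ∂(gaussLaw θ))) := by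
  have hmp := fun i : ℕ => measurePreserving_eval_infinitePi (fun _ : ℕ => gaussLaw θ) i
  have h := strong_law_ae (μ := seqLaw θ) (fun (i : ℕ) ω => g (ω i))
    ((hmp 0).integrable_comp_of_integrable hint)
    (fun i j hij => ((iIndepFun_eval θ).indepFun hij).comp hg hg)
    (fun i => IdentDistrib.comp ⟨(hmp i).measurable.aemeasurable, (hmp 0).measurable.aemeasurable,
      (hmp i).map_eq.trans (hmp 0).map_eq.symm⟩ hg)
  have he : ∫ ω, g (ω 0) ∂(seqLaw θ) = ∫ x, g x ∂(gaussLaw θ) := by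
    conv_rhs => rw [← (hmp 0).map_eq]
    rw [integral_map (hmp 0).measurable.aemeasurable]
    rw [(hmp 0).map_eq]
    exact hint.aestronglyMeasurable
  rw [he] at h
  filter_upwards [h] with ω hω
  refine hω.congr fun n => ?_
  rw [Finset.sum_range]
  rfl

theorem strong_law_seqLaw (θ : Vec d) {g : Vec d → ℝ} (hg : Measurable g)
    (hint : Integrable g (gaussLaw θ)) :
    ∀ᵐ ω ∂(seqLaw θ), Tendsto (fun n : ℕ => (n : ℝ)⁻¹ * ∑ i : Fin n, g (trunc n ω i)) atTop
      (𝓝 (∫ x, g x ∂(gaussLaw θ))) :=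
  strong_law_seqLaw_smul θ hg hint

/-- The product laws for different n are realized as truncations of one infinite sequence. There
dominated convergence applies to the indicators of the events. -/
theorem tendsto_pi_measure_zero (θ : Vec d) {S : ∀ n : ℕ, Set (Fin n → Vec d)}
    (hS : ∀ n, MeasurableSet (S n)) (h : ∀ᵐ ω ∂(seqLaw θ), ∀ᶠ n in atTop, trunc n ω ∉ S n) :
    Tendsto (fun n => (Measure.pi fun _ : Fin n => gaussLaw θ) (S n)) atTop (𝓝 0) := by
  have h1 := tendsto_measure_of_ae_tendsto_indicator_of_isFiniteMeasure (μ := seqLaw θ) atTop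
    (A := ∅) (As := fun n => trunc n ⁻¹' S n) MeasurableSet.empty
    (fun n => measurable_trunc n (hS n)) (by
      filter_upwards [h] with ω hω
      filter_upwards [hω] with n hn
      simpa using hn)
  rw [measure_empty] at h1
  refine h1.congr fun n => ?_
  rw [← map_trunc n θ, Measure.map_apply (measurable_trunc n) (hS n)]

theorem tendstoZeroInProb_pi_of_ae {F : Type*} [NormedAddCommGroup F] [MeasurableSpace F]
    [OpensMeasurableSpace F] (θ : Vec d) {g : ∀ n : ℕ, (Fin n → Vec d) → F}
    (hg : ∀ n, Measurable (g n))
    (h : ∀ᵐ ω ∂(seqLaw θ), Tendsto (fun n => g n (trunc n ω)) atTop (𝓝 0)) :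
    TendstoZeroInProb (fun n => Measure.pi fun _ : Fin n => gaussLaw θ) g := by
  intro ε hε
  refine tendsto_pi_measure_zero θ (fun n => measurableSet_le measurable_const (hg n).norm) ?_
  filter_upwards [h] with ω hω
  filter_upwards [(tendsto_zero_iff_norm_tendsto_zero.1 hω).eventually (gt_mem_nhds hε)] with n hn
  simpa using hn

theorem tendstoZeroInProb_dataLaw {F : Type*} [NormedAddCommGroup F] (θ : Vec d)
    (Q : ∀ n, PMF (Labels n)) {f : ∀ n : ℕ, (Fin n → Vec d) → F}
    (hf : ∀ n z y, f n (flip z y) = f n y)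
    (h : TendstoZeroInProb (fun n => Measure.pi fun _ : Fin n => gaussLaw θ) f) :
    TendstoZeroInProb (fun n => dataLaw θ (Q n)) f := fun ε hε =>
  tendsto_of_tendsto_of_tendsto_of_le_of_le tendsto_const_nhds (h ε hε) (fun _ => zero_le)
    fun n => dataLaw_le_of_flip θ (Q n) fun z y hy => by
      simpa only [Set.mem_preimage, Set.mem_ofPred_eq, hf] using hy

end Sequence

/-! ### Quadratic expansion of the i.i.d. log-likelihood ratio. -/

section LocalExpansion

variable {d : ℕ}

/-- The normalized score. -/
def normScore {n : ℕ} (θ : Vec d) (x : Fin n → Vec d) : Vec d :=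
  (1 / √(n : ℝ)) • ∑ i, score θ (x i)

@[fun_prop]
theorem continuous_normScore {n : ℕ} (θ : Vec d) : Continuous (normScore (n := n) θ) := by
  unfold normScore
  have : Continuous fun x : Fin n → Vec d => ∑ i, score θ (x i) :=
    continuous_finsetSum _ fun i _ => (continuous_score θ).comp (continuous_apply i)
  exact this.const_smul (1 / √(n : ℝ))

theorem score_spin {n : ℕ} (z : Labels n) (i : Fin n) (θ x : Vec d) :
    score θ (spin z i • x) = score θ x := by
  rcases spin_eq_or z i with h | h
  · simp [h]
  · simp only [h, neg_smul, one_smul]; exact score_neg θ x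

theorem normScore_flip {n : ℕ} (θ : Vec d) (z : Labels n) (y : Fin n → Vec d) :
    normScore θ (flip z y) = normScore θ y := by
  simp only [normScore, flip, score_spin]

theorem logMix_spin {n : ℕ} (z : Labels n) (i : Fin n) (θ x : Vec d) :
    logMix θ (spin z i • x) = logMix θ x := by
  rcases spin_eq_or z i with h | h <;> simp [logMix, h]

theorem sqrt_inv_mul_self {n : ℕ} : (1 / √(n : ℝ)) * (1 / √(n : ℝ)) = (n : ℝ)⁻¹ := by
  rw [← one_div, div_mul_div_comm, Real.mul_self_sqrt n.cast_nonneg, one_mul]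

/-- The deterministic bound behind local asymptotic normality. -/
theorem abs_sum_logMix_sub_le {n : ℕ} (hn : n ≠ 0) (θ₀ h : Vec d) (x : Fin n → Vec d) :
    |∑ i, (logMix (localAlt θ₀ h n) (x i) - logMix θ₀ (x i)) -
      (inner ℝ h (normScore θ₀ x) - infoForm θ₀ h h / 2)| ≤
    |(n : ℝ)⁻¹ * ∑ i, inner ℝ h (x i) * inner ℝ h (x i) * (1 / Real.cosh (inner ℝ θ₀ (x i))) ^ 2 -
      (‖h‖ ^ 2 - infoForm θ₀ h h)| / 2 +
    2 * (1 / √(n : ℝ)) * ((n : ℝ)⁻¹ * ∑ i, |inner ℝ h (x i)| ^ 3) := by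
  set r := 1 / √(n : ℝ) with hr
  have hr0 : 0 ≤ r := by positivity
  have hrr : r * r = (n : ℝ)⁻¹ := sqrt_inv_mul_self
  have hn' : (n : ℝ) ≠ 0 := by exact_mod_cast hn
  have hnr : (n : ℝ) * (r * r) = 1 := by rw [hrr, mul_inv_cancel₀ hn']
  have hin : ∀ y : Vec d, inner ℝ (localAlt θ₀ h n) y = inner ℝ θ₀ y + r * inner ℝ h y := fun y => by
    rw [localAlt, inner_add_left, real_inner_smul_left]
  have hnorm : ‖localAlt θ₀ h n‖ ^ 2 = ‖θ₀‖ ^ 2 + 2 * r * inner ℝ θ₀ h + r * r * ‖h‖ ^ 2 := by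
    rw [localAlt, norm_add_sq_real, real_inner_smul_right, norm_smul, mul_pow, ← hr,
      Real.norm_eq_abs, sq_abs]
    ring
  let R : Fin n → ℝ := fun i => Real.log (Real.cosh (inner ℝ θ₀ (x i) + r * inner ℝ h (x i))) -
    Real.log (Real.cosh (inner ℝ θ₀ (x i))) - r * inner ℝ h (x i) * Real.tanh (inner ℝ θ₀ (x i)) -
    (r * inner ℝ h (x i)) ^ 2 / 2 * (1 / Real.cosh (inner ℝ θ₀ (x i))) ^ 2
  have hR : ∀ i, |R i| ≤ 2 * (r * (r * r)) * |inner ℝ h (x i)| ^ 3 := fun i => by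
    have := abs_log_cosh_taylor_le (inner ℝ θ₀ (x i)) (inner ℝ θ₀ (x i) + r * inner ℝ h (x i))
    simp only [add_sub_cancel_left] at this
    refine this.trans (le_of_eq ?_)
    rw [abs_mul, abs_of_nonneg hr0]; ring
  -- The cross term of ‖θ₀ + rh‖² centers the tanh term into the score; its square term is left
  -- over.
  have hterm : ∀ i, logMix (localAlt θ₀ h n) (x i) - logMix θ₀ (x i) =
      r * inner ℝ h (score θ₀ (x i)) + (r * r) / 2 * (inner ℝ h (x i) * inner ℝ h (x i) *
        (1 / Real.cosh (inner ℝ θ₀ (x i))) ^ 2) + R i - r * r * ‖h‖ ^ 2 / 2 := fun i => by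
    simp only [logMix, hin, hnorm, inner_score, R, real_inner_comm θ₀ h]
    ring
  -- The averaged curvature has limit ‖h‖² - I(h,h). Half of it minus the leftover ‖h‖²/2 gives the
  -- -I(h,h)/2 of local asymptotic normality.
  have hsum : ∑ i, (logMix (localAlt θ₀ h n) (x i) - logMix θ₀ (x i)) -
      (inner ℝ h (normScore θ₀ x) - infoForm θ₀ h h / 2) =
      ((n : ℝ)⁻¹ * ∑ i, inner ℝ h (x i) * inner ℝ h (x i) *
        (1 / Real.cosh (inner ℝ θ₀ (x i))) ^ 2 - (‖h‖ ^ 2 - infoForm θ₀ h h)) / 2 + ∑ i, R i := by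
    simp only [hterm, Finset.sum_sub_distrib, Finset.sum_add_distrib, ← Finset.mul_sum]
    rw [normScore, real_inner_smul_right, inner_sum, ← hr, ← hrr]
    simp only [Finset.sum_const, Finset.card_univ, Fintype.card_fin, nsmul_eq_mul]
    linear_combination (-‖h‖ ^ 2 / 2) * hnr
  rw [hsum]
  refine (abs_add_le _ _).trans (add_le_add ?_ ?_)
  · rw [abs_div, abs_two]
  · refine (Finset.abs_sum_le_sum_abs _ _).trans ((Finset.sum_le_sum fun i _ => hR i).trans ?_)
    rw [← Finset.mul_sum, ← hrr]
    exact le_of_eq (by ring)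

theorem tendsto_one_div_sqrt : Tendsto (fun n : ℕ => 1 / √(n : ℝ)) atTop (𝓝 0) := by
  simp only [one_div]
  exact tendsto_inv_atTop_zero.comp (Real.tendsto_sqrt_atTop.comp tendsto_natCast_atTop_atTop)

theorem integrable_norm_pow (θ : Vec d) (k : ℕ) : Integrable (fun x => ‖x‖ ^ k) (gaussLaw θ) :=
  integrable_of_norm_le_pow θ (by fun_prop) zero_le_one k fun x => by
    rw [one_mul, Real.norm_eq_abs, abs_of_nonneg (by positivity)]
    gcongr; linarith

theorem ae_tendsto_sum_logMix_sub (θ₀ h : Vec d) :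
    ∀ᵐ ω ∂(seqLaw θ₀), Tendsto (fun n : ℕ =>
      ∑ i, (logMix (localAlt θ₀ h n) (trunc n ω i) - logMix θ₀ (trunc n ω i)) -
        (inner ℝ h (normScore θ₀ (trunc n ω)) - infoForm θ₀ h h / 2)) atTop (𝓝 0) := by
  have h1 := strong_law_seqLaw θ₀
    (g := fun x => inner ℝ h x * inner ℝ h x * (1 / Real.cosh (inner ℝ θ₀ x)) ^ 2)
    ((by fun_prop : Continuous fun x : Vec d => inner ℝ h x * inner ℝ h x).mul
      (continuous_sech_sq θ₀)).measurable
    (integrable_inner_mul_inner_mul_bdd h h θ₀ (continuous_sech_sq θ₀)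
      (fun x => abs_sech_sq_le_one _))
  have h2 := strong_law_seqLaw θ₀ (g := fun x => |inner ℝ h x| ^ 3)
    (by fun_prop : Continuous fun x : Vec d => |inner ℝ h x| ^ 3).measurable
    (integrable_of_norm_le_pow θ₀ (by fun_prop) (C := ‖h‖ ^ 3) (by positivity) 3 fun x => by
      rw [Real.norm_eq_abs, abs_pow, abs_abs, ← mul_pow]
      exact pow_le_pow_left₀ (abs_nonneg _) (abs_inner_le_mul h x) 3)
  have he : ∫ x, inner ℝ h x * inner ℝ h x * (1 / Real.cosh (inner ℝ θ₀ x)) ^ 2 ∂(gaussLaw θ₀) =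
      ‖h‖ ^ 2 - infoForm θ₀ h h := by
    rw [infoForm, real_inner_self_eq_norm_sq]; ring
  rw [he] at h1
  filter_upwards [h1, h2] with ω h1 h2
  have hb := ((tendsto_sub_nhds_zero_iff.2 h1).abs.div_const 2).add
    ((tendsto_one_div_sqrt.const_mul 2).mul h2)
  simp only [abs_zero, zero_div, mul_zero, zero_mul, add_zero] at hb
  refine squeeze_zero_norm' ?_ hb
  filter_upwards [eventually_ne_atTop 0] with n hn
  exact abs_sum_logMix_sub_le hn θ₀ h (trunc n ω)

theorem tendstoZeroInProb_sum_logMix_sub (θ₀ h : Vec d) (Q : ∀ n, PMF (Labels n)) :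
    TendstoZeroInProb (fun n => dataLaw θ₀ (Q n)) fun (n : ℕ) (x : Fin n → Vec d) =>
      ∑ i, (logMix (localAlt θ₀ h n) (x i) - logMix θ₀ (x i)) -
        (inner ℝ h (normScore θ₀ x) - infoForm θ₀ h h / 2) := by
  refine tendstoZeroInProb_dataLaw θ₀ Q (fun n z y => ?_)
    (tendstoZeroInProb_pi_of_ae θ₀ (fun n => Continuous.measurable ?_)
      (ae_tendsto_sum_logMix_sub θ₀ h))
  · rw [normScore_flip]
    simp only [flip, logMix_spin]
  · refine (continuous_finsetSum _ fun i _ => ?_).sub ((continuous_const.inner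
      (continuous_normScore θ₀)).sub continuous_const)
    exact ((continuous_logMix _).comp (continuous_apply i)).sub
      ((continuous_logMix _).comp (continuous_apply i))

end LocalExpansion

/-! ### Transfer of the expansion to Ising labels. -/

section Coupling

variable {n d : ℕ}

theorem rfim_toReal (β : ℝ) (A : Matrix (Fin n) (Fin n) ℝ) (x : Fin n → Vec d) (θ : Vec d)
    (w : Labels n) : (rfim β A x θ w).toReal =
      Real.exp (β / 2 * (spin w ⬝ᵥ A *ᵥ spin w) + inner ℝ θ (spinSum w x)) /
        ∑ b : Labels n, Real.exp (β / 2 * (spin b ⬝ᵥ A *ᵥ spin b) + inner ℝ θ (spinSum b x)) := by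
  rw [rfim, gibbs, PMF.ofFintype_apply]
  exact ENNReal.toReal_ofReal (div_nonneg (Real.exp_pos _).le (part_pos β A x θ).le)

/-- Differentiating a log-partition function in its external field gives the Gibbs mean. This links
the mean expansion assumed in the theorem to likelihood ratios. -/
theorem hasDerivAt_logPart (β : ℝ) (A : Matrix (Fin n) (Fin n) ℝ) (x : Fin n → Vec d)
    (θ k : Vec d) (t : ℝ) :
    HasDerivAt (fun s : ℝ => logPart β A x (θ + s • k))
      (inner ℝ k (rfimMean β A x (θ + t • k))) t := by
  have h1 : ∀ w : Labels n, HasDerivAt (fun s : ℝ => Real.exp (β / 2 * (spin w ⬝ᵥ A *ᵥ spin w) +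
      inner ℝ (θ + s • k) (spinSum w x))) (Real.exp (β / 2 * (spin w ⬝ᵥ A *ᵥ spin w) +
      inner ℝ (θ + t • k) (spinSum w x)) * inner ℝ k (spinSum w x)) t := fun w => by
    refine HasDerivAt.exp ?_
    simp only [inner_add_left, real_inner_smul_left]
    have := (((hasDerivAt_id t).mul_const (inner ℝ k (spinSum w x))).const_add
      (inner ℝ θ (spinSum w x))).const_add (β / 2 * (spin w ⬝ᵥ A *ᵥ spin w))
    simpa using this
  have h2 := (HasDerivAt.fun_sum (u := Finset.univ) fun w _ => h1 w).log
    (part_pos β A x (θ + t • k)).ne'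
  unfold logPart
  convert! h2 using 1
  rw [rfimMean, inner_sum, Finset.sum_div]
  refine Finset.sum_congr rfl fun w _ => ?_
  rw [rfim_toReal, real_inner_smul_right]
  change _ * inner ℝ k (spinSum w x) = _
  ring

theorem hasDerivAt_sum_log_cosh (x : Fin n → Vec d) (θ k : Vec d) (t : ℝ) :
    HasDerivAt (fun s : ℝ => ∑ i, Real.log (Real.cosh (inner ℝ (θ + s • k) (x i))))
      (inner ℝ k (∑ i, Real.tanh (inner ℝ (θ + t • k) (x i)) • x i)) t := by
  have h1 : ∀ i, HasDerivAt (fun s : ℝ => Real.log (Real.cosh (inner ℝ (θ + s • k) (x i))))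
      (Real.tanh (inner ℝ (θ + t • k) (x i)) * inner ℝ k (x i)) t := fun i => by
    refine (hasDerivAt_log_cosh _).comp t (h := fun s : ℝ => inner ℝ (θ + s • k) (x i)) ?_
    simp only [inner_add_left, real_inner_smul_left]
    simpa using ((hasDerivAt_id t).mul_const (inner ℝ k (x i))).const_add (inner ℝ θ (x i))
  simp only [inner_sum, real_inner_smul_right]
  exact HasDerivAt.fun_sum fun i _ => h1 i

/-- A uniform bound on the mean discrepancy controls the discrepancy of log-likelihood ratios. -/
theorem abs_logPart_sub_le (β : ℝ) (A : Matrix (Fin n) (Fin n) ℝ) (x : Fin n → Vec d)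
    {θ k : Vec d} (hk : ‖k‖ < ‖θ‖) {C : ℝ} (hC : ∀ θ' ∈ Theta d,
      ‖rfimMean β A x θ' - ∑ i, Real.tanh (inner ℝ θ' (x i)) • x i‖ ≤ C) :
    |(logPart β A x (θ + k) - logPart β A x θ) -
      ∑ i, (Real.log (Real.cosh (inner ℝ (θ + k) (x i))) -
        Real.log (Real.cosh (inner ℝ θ (x i))))| ≤ ‖k‖ * C := by
  have h := Convex.norm_image_sub_le_of_norm_hasDerivWithin_le (s := Set.Icc (0 : ℝ) 1)
    (C := ‖k‖ * C) (x := 0) (y := 1)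
    (fun t _ => ((hasDerivAt_logPart β A x θ k t).sub
      (hasDerivAt_sum_log_cosh x θ k t)).hasDerivWithinAt) (fun t ht => by
        rw [← inner_sub_right]
        refine (norm_inner_le_norm _ _).trans (mul_le_mul_of_nonneg_left (hC _ ?_) (norm_nonneg _))
        -- The bound is available only at nonzero parameters; ‖k‖ < ‖θ‖ keeps the segment from θ to
        -- θ + k away from 0.
        intro h0
        have h1 : ‖θ‖ = t * ‖k‖ := by
          rw [eq_neg_of_add_eq_zero_left h0, norm_neg, norm_smul, Real.norm_eq_abs,
            abs_of_nonneg ht.1]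
        nlinarith [ht.2, norm_nonneg k])
    (convex_Icc 0 1) (Set.left_mem_Icc.2 zero_le_one) (Set.right_mem_Icc.2 zero_le_one)
  simp only [Pi.sub_apply, one_smul, zero_smul, add_zero, sub_zero, norm_one, mul_one] at h
  rw [Finset.sum_sub_distrib]
  convert! h using 1
  rw [Real.norm_eq_abs]
  congr 1
  ring

theorem isingLLR_sub_sum_logMix (β : ℝ) (A : Matrix (Fin n) (Fin n) ℝ) (θ θ' : Vec d)
    (x : Fin n → Vec d) :
    isingLLR β A θ θ' x - ∑ i, (logMix θ' (x i) - logMix θ (x i)) =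
      (logPart β A x θ' - logPart β A x θ) - ∑ i, (Real.log (Real.cosh (inner ℝ θ' (x i))) -
        Real.log (Real.cosh (inner ℝ θ (x i)))) := by
  simp only [isingLLR, logMix, Finset.sum_sub_distrib]
  simp
  ring

/-- Local asymptotic normality: the log-likelihood ratio is asymptotically quadratic. -/
def IsLAN (β : ℝ) (A : ∀ n : ℕ, Matrix (Fin n) (Fin n) ℝ) (θ₀ : Vec d) : Prop :=
  ∀ h : Vec d, TendstoZeroInProb (fun n => dataLaw θ₀ (ising β (A n))) fun n x =>
    isingLLR β (A n) θ₀ (localAlt θ₀ h n) x -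
      (inner ℝ h (normScore θ₀ x) - infoForm θ₀ h h / 2)

/-- A gradient error of o_p(√n) over a displacement of length ‖h‖/√n changes the log-likelihood
ratio by o_p(1). -/
theorem isLAN_of_uniformExpansion {β : ℝ} {A : ∀ n : ℕ, Matrix (Fin n) (Fin n) ℝ} {θ₀ : Vec d}
    (hθ : θ₀ ≠ 0) (hU : UniformExpansion β A θ₀) : IsLAN β A θ₀ := by
  intro h
  have key : TendstoZeroInProb (fun n => dataLaw θ₀ (ising β (A n))) fun n x =>
      isingLLR β (A n) θ₀ (localAlt θ₀ h n) x -
        ∑ i, (logMix (localAlt θ₀ h n) (x i) - logMix θ₀ (x i)) := by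
    intro ε hε
    -- Chosen so that ‖h‖δ < ε; the +1 covers h = 0.
    set δ := ε / (2 * (‖h‖ + 1)) with hδ
    have hδ0 : 0 < δ := by positivity
    have hsmall : ∀ᶠ n : ℕ in atTop, 1 / √(n : ℝ) * ‖h‖ < ‖θ₀‖ := by
      have := tendsto_one_div_sqrt.mul_const ‖h‖
      rw [zero_mul] at this
      exact this.eventually (gt_mem_nhds (norm_pos_iff.2 hθ))
    refine tendsto_of_tendsto_of_tendsto_of_le_of_le' tendsto_const_nhds (hU δ hδ0)
      (Eventually.of_forall fun _ => zero_le) ?_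
    filter_upwards [hsmall, eventually_ne_atTop 0] with n hn hn0
    refine measure_mono fun x hx => ?_
    by_contra hc
    simp only [Set.mem_ofPred_eq, not_le] at hc hx
    have hk : ‖(1 / √(n : ℝ)) • h‖ = 1 / √(n : ℝ) * ‖h‖ := by
      rw [norm_smul, Real.norm_eq_abs, abs_of_nonneg (by positivity)]
    have hb := abs_logPart_sub_le β (A n) x (θ := θ₀) (k := (1 / √(n : ℝ)) • h)
      (by rw [hk]; exact hn) (C := δ * √n) (fun θ' hθ' => by
        have h1 := (le_iSup₂ (f := fun θ (_ : θ ∈ Theta d) =>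
          ‖rfimMean β (A n) x θ - ∑ i, Real.tanh (inner ℝ θ (x i)) • x i‖ₑ) θ' hθ').trans hc.le
        rw [← ofReal_norm] at h1
        exact (ENNReal.ofReal_le_ofReal_iff (by positivity)).1 h1)
    rw [isingLLR_sub_sum_logMix, Real.norm_eq_abs] at hx
    have hx' := hx.trans hb
    have hs : (0 : ℝ) < √n := Real.sqrt_pos.2 (by exact_mod_cast Nat.pos_of_ne_zero hn0)
    have h2 : ‖(1 / √(n : ℝ)) • h‖ * (δ * √n) = ‖h‖ * δ := by
      rw [hk]; field_simp
    rw [h2, hδ] at hx'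
    have h3 : ‖h‖ * (ε / (2 * (‖h‖ + 1))) < ε := by
      rw [mul_div_assoc', div_lt_iff₀ (by positivity)]
      nlinarith [norm_nonneg h]
    linarith
  refine (key.add (tendstoZeroInProb_sum_logMix_sub θ₀ h _)).congr (Eventually.of_forall
    fun n x => ?_)
  ring

theorem isLAN_zero (θ₀ : Vec d) : IsLAN 0 (fun _ => 0) θ₀ := fun h => by
  refine (tendstoZeroInProb_sum_logMix_sub θ₀ h _).congr (Eventually.of_forall fun n x => ?_)
  congr 1
  have := isingLLR_sub_sum_logMix 0 (0 : Matrix (Fin n) (Fin n) ℝ) θ₀ (localAlt θ₀ h n) x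
  rw [logPart_zero, logPart_zero, Finset.sum_sub_distrib (f := fun i =>
    Real.log (Real.cosh (inner ℝ (localAlt θ₀ h n) (x i))))] at this
  linarith

end Coupling

/-! ### Exponential moments of the normalized score. -/

section MomentLimit

/-- A central limit theorem for complex exponential moments: a second-order expansion with remainder
r³ E[‖ζ‖³ exp ‖ζ‖], then (1 + c_n/n)^n → exp c. Complex ζ treats real tilts and Fourier frequencies
together, so no separate uniform integrability argument is needed. -/
theorem tendsto_integral_cexp_pow {α : Type*} [MeasurableSpace α] {μ : Measure α}
    [IsProbabilityMeasure μ] {ζ : α → ℂ} (h1 : Integrable ζ μ)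
    (h2 : Integrable (fun a => ζ a ^ 2) μ)
    (h3 : Integrable (fun a => ‖ζ a‖ ^ 3 * Real.exp ‖ζ a‖) μ)
    (hexp : ∀ r : ℝ, Integrable (fun a => Complex.exp (r * ζ a)) μ) (h0 : ∫ a, ζ a ∂μ = 0) :
    Tendsto (fun n : ℕ => (∫ a, Complex.exp ((1 / √(n : ℝ) : ℝ) * ζ a) ∂μ) ^ n) atTop
      (𝓝 (Complex.exp ((∫ a, ζ a ^ 2 ∂μ) / 2))) := by
  set K := ∫ a, ‖ζ a‖ ^ 3 * Real.exp ‖ζ a‖ ∂μ with hK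
  have key : ∀ r : ℝ, 0 ≤ r → r ≤ 1 →
      ‖(∫ a, Complex.exp (r * ζ a) ∂μ) - 1 - r ^ 2 * ((∫ a, ζ a ^ 2 ∂μ) / 2)‖ ≤ r ^ 3 * K := by
    intro r hr0 hr1
    have e : (∫ a, Complex.exp (r * ζ a) ∂μ) - 1 - r ^ 2 * ((∫ a, ζ a ^ 2 ∂μ) / 2) =
        ∫ a, (Complex.exp (r * ζ a) - 1 - r * ζ a - r ^ 2 / 2 * ζ a ^ 2) ∂μ := by
      rw [integral_sub (by exact ((hexp r).sub (integrable_const _)).sub (h1.const_mul _))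
        (h2.const_mul _), integral_sub (by exact (hexp r).sub (integrable_const _))
        (h1.const_mul _), integral_sub (hexp r) (integrable_const _), integral_const_mul,
        integral_const_mul, h0]
      simp
      ring
    rw [e, hK, ← integral_const_mul]
    refine norm_integral_le_of_norm_le (h3.const_mul _) (ae_of_all _ fun a => ?_)
    have := Complex.norm_exp_sub_sum_le_norm_mul_exp (r * ζ a) 3
    simp only [Finset.sum_range_succ, Finset.sum_range_zero] at this
    have e2 : Complex.exp (r * ζ a) - 1 - r * ζ a - r ^ 2 / 2 * ζ a ^ 2 = Complex.exp (r * ζ a) -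
        (0 + (r * ζ a) ^ 0 / (Nat.factorial 0 : ℂ) + (r * ζ a) ^ 1 / (Nat.factorial 1 : ℂ) +
        (r * ζ a) ^ 2 / (Nat.factorial 2 : ℂ)) := by
      simp [Nat.factorial]; ring
    rw [e2]
    refine this.trans ?_
    have hn : ‖(r : ℂ) * ζ a‖ = r * ‖ζ a‖ := by
      rw [norm_mul, Complex.norm_real, Real.norm_eq_abs, abs_of_nonneg hr0]
    rw [hn, mul_pow, mul_assoc]
    gcongr
    exact mul_le_of_le_one_left (norm_nonneg _) hr1
  have hlim : Tendsto (fun n : ℕ => (n : ℂ) *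
      ((∫ a, Complex.exp ((1 / √(n : ℝ) : ℝ) * ζ a) ∂μ) - 1)) atTop
      (𝓝 ((∫ a, ζ a ^ 2 ∂μ) / 2)) := by
    rw [← tendsto_sub_nhds_zero_iff]
    have hb := tendsto_one_div_sqrt.mul_const K
    rw [zero_mul] at hb
    refine squeeze_zero_norm' ?_ hb
    filter_upwards [eventually_ge_atTop 1] with n hn
    have hn1 : (1 : ℝ) ≤ n := by exact_mod_cast hn
    have hs : 1 ≤ √(n : ℝ) := Real.one_le_sqrt.2 hn1
    set r := 1 / √(n : ℝ) with hr
    have hr0 : 0 ≤ r := by positivity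
    have hr1 : r ≤ 1 := (div_le_one (by positivity)).2 hs
    have hnr : (n : ℝ) * r ^ 2 = 1 := by
      rw [sq, sqrt_inv_mul_self, mul_inv_cancel₀ (by positivity)]
    have hnrC : (n : ℂ) * (r : ℂ) ^ 2 = 1 := by exact_mod_cast hnr
    have e : (n : ℂ) * ((∫ a, Complex.exp (r * ζ a) ∂μ) - 1) - (∫ a, ζ a ^ 2 ∂μ) / 2 =
        n * ((∫ a, Complex.exp (r * ζ a) ∂μ) - 1 - r ^ 2 * ((∫ a, ζ a ^ 2 ∂μ) / 2)) := by
      linear_combination ((∫ a, ζ a ^ 2 ∂μ) / 2) * hnrC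
    rw [e, norm_mul, Complex.norm_natCast]
    calc (n : ℝ) * _ ≤ n * (r ^ 3 * K) := by gcongr; exact key r hr0 hr1
      _ = n * r ^ 2 * (r * K) := by ring
      _ = r * K := by rw [hnr, one_mul]
  have := Complex.tendsto_one_add_pow_exp_of_tendsto hlim
  simpa using this

variable {d : ℕ}

theorem integrable_of_norm_le_pow_mul_exp {F : Type*} [NormedAddCommGroup F] (θ : Vec d)
    {f : Vec d → F} (hf : AEStronglyMeasurable f (gaussLaw θ)) {C c : ℝ} (hC : 0 ≤ C) (k : ℕ)
    (h : ∀ x, ‖f x‖ ≤ C * (1 + ‖x‖) ^ k * Real.exp (c * ‖x‖)) : Integrable f (gaussLaw θ) := by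
  refine integrable_of_norm_le_exp θ hf (C * (k.factorial * Real.exp 1)) (1 + c) fun x =>
    (h x).trans ?_
  have h1 := Real.pow_div_factorial_le_exp (x := 1 + ‖x‖) (by positivity) k
  rw [div_le_iff₀ (by positivity), Real.exp_add] at h1
  calc C * (1 + ‖x‖) ^ k * Real.exp (c * ‖x‖)
      ≤ C * (Real.exp 1 * Real.exp ‖x‖ * k.factorial) * Real.exp (c * ‖x‖) := by gcongr
    _ = _ := by rw [add_mul, one_mul, Real.exp_add]; ring

theorem abs_inner_score_le (h θ x : Vec d) :
    |inner ℝ h (score θ x)| ≤ ‖h‖ * (1 + ‖θ‖) * (1 + ‖x‖) := by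
  refine (abs_real_inner_le_norm _ _).trans ?_
  rw [mul_assoc]
  gcongr
  nlinarith [norm_nonneg x, norm_nonneg θ, norm_score_le θ x]

/-- The complex linear form of the score with real part `h` and imaginary part `u`. -/
def complexScore (θ h u x : Vec d) : ℂ :=
  (inner ℝ h (score θ x) : ℝ) + (inner ℝ u (score θ x) : ℝ) * Complex.I

@[fun_prop]
theorem continuous_complexScore (θ h u : Vec d) : Continuous (complexScore θ h u) := by
  unfold complexScore; fun_prop

theorem norm_complexScore_le (θ h u x : Vec d) :
    ‖complexScore θ h u x‖ ≤ (‖h‖ + ‖u‖) * (1 + ‖θ‖) * (1 + ‖x‖) := by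
  refine (norm_add_le _ _).trans ?_
  rw [norm_mul, Complex.norm_I, mul_one, Complex.norm_real, Complex.norm_real]
  have h1 := abs_inner_score_le h θ x
  have h2 := abs_inner_score_le u θ x
  rw [Real.norm_eq_abs, Real.norm_eq_abs]
  linarith

theorem integrable_inner_score_mul (θ h k : Vec d) :
    Integrable (fun x => inner ℝ h (score θ x) * inner ℝ k (score θ x)) (gaussLaw θ) := by
  refine integrable_of_norm_le_pow θ ((continuous_inner_score h θ).mul
    (continuous_inner_score k θ)).aestronglyMeasurable
    (C := ‖h‖ * (1 + ‖θ‖) * (‖k‖ * (1 + ‖θ‖))) (by positivity) 2 fun x => ?_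
  rw [norm_mul]
  calc _ ≤ ‖h‖ * (1 + ‖θ‖) * (1 + ‖x‖) * (‖k‖ * (1 + ‖θ‖) * (1 + ‖x‖)) :=
        mul_le_mul (abs_inner_score_le h θ x) (abs_inner_score_le k θ x) (abs_nonneg _)
          (by positivity)
    _ = _ := by ring

theorem integral_complexScore_sq (θ h u : Vec d) :
    ∫ x, complexScore θ h u x ^ 2 ∂(gaussLaw θ) =
      ((infoForm θ h h - infoForm θ u u : ℝ) : ℂ) + (2 * infoForm θ h u : ℝ) * Complex.I := by
  have h1 : ∀ x, complexScore θ h u x ^ 2 =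
      ((inner ℝ h (score θ x) * inner ℝ h (score θ x) -
        inner ℝ u (score θ x) * inner ℝ u (score θ x) : ℝ) : ℂ) +
      ((2 * (inner ℝ h (score θ x) * inner ℝ u (score θ x)) : ℝ) : ℂ) * Complex.I := fun x => by
    rw [complexScore]; push_cast; ring_nf; rw [Complex.I_sq]; ring
  simp only [h1]
  have i1 := (integrable_inner_score_mul θ h h).sub (integrable_inner_score_mul θ u u)
  have i2 := (integrable_inner_score_mul θ h u).const_mul 2
  rw [integral_add (by exact i1.ofReal) (by exact i2.ofReal.mul_const _), integral_mul_const,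
    integral_complex_ofReal, integral_complex_ofReal,
    integral_sub (integrable_inner_score_mul θ h h) (integrable_inner_score_mul θ u u),
    integral_const_mul, integral_inner_score_mul, integral_inner_score_mul,
    integral_inner_score_mul]

theorem integrable_cexp_complexScore (θ h u : Vec d) (r : ℝ) :
    Integrable (fun x => Complex.exp (r * complexScore θ h u x)) (gaussLaw θ) := by
  refine integrable_of_norm_le_exp θ (by fun_prop)
    (Real.exp (|r| * ((‖h‖ + ‖u‖) * (1 + ‖θ‖)))) (|r| * ((‖h‖ + ‖u‖) * (1 + ‖θ‖))) fun x => ?_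
  rw [← Real.exp_add]
  refine (Complex.norm_exp_le_exp_norm _).trans (Real.exp_le_exp.2 ?_)
  rw [norm_mul, Complex.norm_real, Real.norm_eq_abs]
  calc |r| * ‖complexScore θ h u x‖ ≤ |r| * ((‖h‖ + ‖u‖) * (1 + ‖θ‖) * (1 + ‖x‖)) := by
        gcongr; exact norm_complexScore_le θ h u x
    _ = _ := by ring

theorem tendsto_complexScore_pow (θ h u : Vec d) :
    Tendsto (fun n : ℕ =>
      (∫ x, Complex.exp ((1 / √(n : ℝ) : ℝ) * complexScore θ h u x) ∂(gaussLaw θ)) ^ n) atTop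
      (𝓝 (Complex.exp (((infoForm θ h h - infoForm θ u u : ℝ) / 2 : ℂ) +
        (infoForm θ h u : ℝ) * Complex.I))) := by
  set C := (‖h‖ + ‖u‖) * (1 + ‖θ‖) with hC
  have hC0 : 0 ≤ C := by positivity
  have hb := norm_complexScore_le θ h u
  have i1 : Integrable (complexScore θ h u) (gaussLaw θ) :=
    integrable_of_norm_le_pow θ (by fun_prop) hC0 1 fun x => by rw [pow_one]; exact hb x
  have := tendsto_integral_cexp_pow (μ := gaussLaw θ) (ζ := complexScore θ h u) i1
    (integrable_of_norm_le_pow θ (by fun_prop) (C := C ^ 2) (by positivity) 2 fun x => by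
      rw [norm_pow, ← mul_pow]; exact pow_le_pow_left₀ (norm_nonneg _) (hb x) 2)
    (integrable_of_norm_le_pow_mul_exp θ (by fun_prop) (C := C ^ 3 * Real.exp C) (c := C)
      (by positivity) 3 fun x => by
        rw [Real.norm_eq_abs, abs_of_nonneg (by positivity)]
        calc ‖complexScore θ h u x‖ ^ 3 * Real.exp ‖complexScore θ h u x‖
            ≤ (C * (1 + ‖x‖)) ^ 3 * Real.exp (C * (1 + ‖x‖)) := by
              gcongr <;> exact hb x
          _ = _ := by rw [mul_add, mul_one, Real.exp_add]; ring)
    (integrable_cexp_complexScore θ h u) (by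
      have e1 := (integrable_inner_score_mul θ h h)
      have i3 : ∀ k : Vec d, Integrable (fun x => inner ℝ k (score θ x)) (gaussLaw θ) := fun k =>
        integrable_of_norm_le_pow θ (by fun_prop) (C := ‖k‖ * (1 + ‖θ‖)) (by positivity) 1
          fun x => by rw [pow_one]; exact abs_inner_score_le k θ x
      simp only [complexScore]
      rw [integral_add (by exact (i3 h).ofReal) (by exact (i3 u).ofReal.mul_const _),
        integral_mul_const, integral_complex_ofReal, integral_complex_ofReal,
        integral_inner_score, integral_inner_score]
      simp)
  rw [integral_complexScore_sq] at this
  convert! this using 2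
  push_cast
  ring_nf

theorem cexp_normScore_eq_prod {n : ℕ} (θ h u : Vec d) (x : Fin n → Vec d) :
    Complex.exp ((inner ℝ h (normScore θ x) : ℝ) + (inner ℝ u (normScore θ x) : ℝ) * Complex.I) =
      ∏ i, Complex.exp ((1 / √(n : ℝ) : ℝ) * complexScore θ h u (x i)) := by
  rw [← Complex.exp_sum, ← Finset.mul_sum]
  congr 1
  simp only [complexScore, Finset.sum_add_distrib, ← Finset.sum_mul, normScore,
    real_inner_smul_right, inner_sum]
  push_cast
  ring

theorem integrable_cexp_normScore_pi (n : ℕ) (θ h u : Vec d) :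
    Integrable (fun x : Fin n → Vec d => Complex.exp ((inner ℝ h (normScore θ x) : ℝ) +
      (inner ℝ u (normScore θ x) : ℝ) * Complex.I)) (Measure.pi fun _ : Fin n => gaussLaw θ) := by
  simp only [cexp_normScore_eq_prod]
  exact Integrable.fintype_prod fun i => integrable_cexp_complexScore θ h u _

theorem integral_cexp_normScore {n : ℕ} (θ h u : Vec d) (Q : PMF (Labels n)) :
    Integrable (fun x : Fin n → Vec d => Complex.exp ((inner ℝ h (normScore θ x) : ℝ) +
      (inner ℝ u (normScore θ x) : ℝ) * Complex.I)) (dataLaw θ Q) ∧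
    ∫ x, Complex.exp ((inner ℝ h (normScore θ x) : ℝ) +
      (inner ℝ u (normScore θ x) : ℝ) * Complex.I) ∂(dataLaw θ Q) =
      (∫ x, Complex.exp ((1 / √(n : ℝ) : ℝ) * complexScore θ h u x) ∂(gaussLaw θ)) ^ n := by
  have hc : Continuous fun x : Fin n → Vec d => Complex.exp ((inner ℝ h (normScore θ x) : ℝ) +
      (inner ℝ u (normScore θ x) : ℝ) * Complex.I) := by
    have h1 : ∀ k : Vec d, Continuous fun x : Fin n → Vec d => inner ℝ k (normScore θ x) :=
      fun k => continuous_const.inner (continuous_normScore θ)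
    have := h1 h
    have := h1 u
    fun_prop
  obtain ⟨h1, h2⟩ := integral_dataLaw_of_even θ Q hc.stronglyMeasurable
    (fun z y => by rw [normScore_flip]) (integrable_cexp_normScore_pi n θ h u)
  refine ⟨h1, h2.trans ?_⟩
  simp only [cexp_normScore_eq_prod]
  rw [integral_fintype_prod_eq_pow (f := fun x =>
    Complex.exp ((1 / √(n : ℝ) : ℝ) * complexScore θ h u x)), Fintype.card_fin]

/-- The joint exponential moments of the normalized score converge to the Gaussian ones. -/
theorem tendsto_integral_cexp_normScore (θ h u : Vec d) (Q : ∀ n, PMF (Labels n)) :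
    Tendsto (fun n : ℕ => ∫ x, Complex.exp ((inner ℝ h (normScore θ x) : ℝ) +
      (inner ℝ u (normScore θ x) : ℝ) * Complex.I) ∂(dataLaw θ (Q n))) atTop
      (𝓝 (Complex.exp (((infoForm θ h h - infoForm θ u u : ℝ) / 2 : ℂ) +
        (infoForm θ h u : ℝ) * Complex.I))) :=
  (tendsto_complexScore_pow θ h u).congr fun n => (integral_cexp_normScore θ h u (Q n)).2.symm

theorem integrable_exp_inner_normScore {n : ℕ} (θ h : Vec d) (Q : PMF (Labels n)) :
    Integrable (fun x : Fin n → Vec d => Real.exp (inner ℝ h (normScore θ x))) (dataLaw θ Q) := by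
  have h1 := (integral_cexp_normScore θ h 0 Q).1.norm
  refine h1.congr (ae_of_all _ fun x => ?_)
  simp [Complex.norm_exp]

theorem infoForm_zero_left (θ k : Vec d) : infoForm θ 0 k = 0 := by
  rw [infoForm_eq_dotProduct]; simp

theorem tendsto_integral_exp_inner_normScore (θ h : Vec d) (Q : ∀ n, PMF (Labels n)) :
    Tendsto (fun n : ℕ => ∫ x, Real.exp (inner ℝ h (normScore θ x)) ∂(dataLaw θ (Q n))) atTop
      (𝓝 (Real.exp (infoForm θ h h / 2))) := by
  have h1 := tendsto_integral_cexp_normScore θ h 0 Q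
  rw [infoForm_comm θ h 0, infoForm_zero_left, infoForm_zero_left] at h1
  have e : Complex.exp (((infoForm θ h h - 0 : ℝ) / 2 : ℂ) + (0 : ℝ) * Complex.I) =
      ((Real.exp (infoForm θ h h / 2) : ℝ) : ℂ) := by simp
  rw [e] at h1
  have h2 := (Complex.continuous_re.tendsto _).comp h1
  rw [Complex.ofReal_re] at h2
  refine h2.congr fun n => ?_
  have : ∀ x : Fin n → Vec d, Complex.exp ((inner ℝ h (normScore θ x) : ℝ) +
      (inner ℝ (0 : Vec d) (normScore θ x) : ℝ) * Complex.I) =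
      ((Real.exp (inner ℝ h (normScore θ x)) : ℝ) : ℂ) := fun x => by simp
  simp only [Function.comp_apply, this]
  rw [integral_complex_ofReal, Complex.ofReal_re]

theorem exists_bound_integral_exp (θ h : Vec d) (Q : ∀ n, PMF (Labels n)) :
    ∃ K : ℝ, ∀ n, ∫ x, Real.exp (inner ℝ h (normScore θ x)) ∂(dataLaw θ (Q n)) ≤ K := by
  obtain ⟨K, hK⟩ := (tendsto_integral_exp_inner_normScore θ h Q).bddAbove_range
  exact ⟨K, fun n => hK ⟨n, rfl⟩⟩

/-- The normalized score is bounded in probability. -/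
theorem exists_bound_integral_normScore_sq (θ : Vec d) (Q : ∀ n, PMF (Labels n)) :
    ∃ K : ℝ, 0 ≤ K ∧ ∀ n, Integrable (fun x : Fin n → Vec d => ‖normScore θ x‖ ^ 2)
      (dataLaw θ (Q n)) ∧ ∫ x, ‖normScore θ x‖ ^ 2 ∂(dataLaw θ (Q n)) ≤ K := by
  let e : Fin d → Vec d := fun j => EuclideanSpace.single j 1
  choose K1 hK1 using fun j => exists_bound_integral_exp θ (e j) Q
  choose K2 hK2 using fun j => exists_bound_integral_exp θ (-e j) Q
  -- Second moments are controlled coordinate by coordinate by the exponential moments at ± the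
  -- basis vectors.
  have hpt : ∀ a : ℝ, a ^ 2 ≤ 2 * (Real.exp a + Real.exp (-a)) := fun a => by
    have h1 := Real.pow_div_factorial_le_exp |a| (abs_nonneg a) 2
    have h2 : Real.exp |a| ≤ Real.exp a + Real.exp (-a) := by
      rcases abs_choice a with h | h <;> rw [h] <;> linarith [Real.exp_pos a, Real.exp_pos (-a)]
    rw [sq_abs] at h1
    norm_num [Nat.factorial] at h1
    linarith
  have hle : ∀ (n : ℕ) (x : Fin n → Vec d), ‖normScore θ x‖ ^ 2 ≤
      ∑ j, 2 * (Real.exp (inner ℝ (e j) (normScore θ x)) +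
        Real.exp (inner ℝ (-e j) (normScore θ x))) := fun n x => by
    rw [EuclideanSpace.real_norm_sq_eq]
    refine Finset.sum_le_sum fun j _ => ?_
    have h1 : inner ℝ (e j) (normScore θ x) = normScore θ x j := by
      simp [e, EuclideanSpace.inner_single_left]
    rw [inner_neg_left, h1]
    exact hpt _
  have hint : ∀ n, ∀ j ∈ Finset.univ, Integrable (fun x : Fin n → Vec d =>
      2 * (Real.exp (inner ℝ (e j) (normScore θ x)) + Real.exp (inner ℝ (-e j) (normScore θ x))))
      (dataLaw θ (Q n)) := fun n j _ =>
    ((integrable_exp_inner_normScore θ (e j) (Q n)).add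
      (integrable_exp_inner_normScore θ (-e j) (Q n))).const_mul 2
  have hI : ∀ n, Integrable (fun x : Fin n → Vec d => ‖normScore θ x‖ ^ 2) (dataLaw θ (Q n)) :=
    fun n => (integrable_finsetSum _ (hint n)).mono'
      ((continuous_normScore θ).norm.pow 2).aestronglyMeasurable (ae_of_all _ fun x => by
        rw [Real.norm_eq_abs, abs_of_nonneg (by positivity)]; exact hle n x)
  have hb : ∀ n, ∫ x, ‖normScore θ x‖ ^ 2 ∂(dataLaw θ (Q n)) ≤ ∑ j, 2 * (K1 j + K2 j) := fun n => by
    refine (integral_mono (hI n) (integrable_finsetSum _ (hint n)) (hle n)).trans ?_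
    rw [integral_finsetSum _ (hint n)]
    refine Finset.sum_le_sum fun j _ => ?_
    rw [integral_const_mul, integral_add (integrable_exp_inner_normScore θ (e j) (Q n))
      (integrable_exp_inner_normScore θ (-e j) (Q n))]
    linarith [hK1 j n, hK2 j n]
  exact ⟨_, (integral_nonneg fun x => by positivity).trans (hb 0), fun n => ⟨hI n, hb n⟩⟩

end MomentLimit

/-! ### The half-space modulo sign. -/

section HalfSpace

variable {d : ℕ}

theorem mem_thetaOne_or_neg_mem {θ : Vec d} (hθ : θ ≠ 0) : θ ∈ ThetaOne d ∨ -θ ∈ ThetaOne d := by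
  have hne : ({k | θ k ≠ 0} : Set (Fin d)).Nonempty := by
    by_contra h
    rw [Set.not_nonempty_iff_eq_empty] at h
    refine hθ (PiLp.ext fun k => ?_)
    by_contra hk
    exact (Set.eq_empty_iff_forall_notMem.1 h k) hk
  obtain ⟨k, hk, hmin⟩ := WellFounded.has_min (wellFounded_lt (α := Fin d)) _ hne
  have hz : ∀ j < k, θ j = 0 := fun j hj => by
    by_contra h
    exact hmin j h hj
  rcases lt_or_gt_of_ne (show θ k ≠ 0 from hk) with h | h
  · exact Or.inr ⟨k, fun j hj => by simp [hz j hj], by simpa using h⟩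
  · exact Or.inl ⟨k, hz, h⟩

theorem neg_notMem_thetaOne {θ : Vec d} (hθ : θ ∈ ThetaOne d) : -θ ∉ ThetaOne d := by
  rintro ⟨l, hl, hl0⟩
  obtain ⟨k, hk, hk0⟩ := hθ
  simp only [PiLp.neg_apply, neg_eq_zero, Left.neg_pos_iff] at hl hl0
  rcases lt_trichotomy k l with h | h | h
  · exact hk0.ne' (hl k h)
  · subst h; linarith
  · exact hl0.ne (hk l h)

theorem ne_zero_of_mem_thetaOne {θ : Vec d} (hθ : θ ∈ ThetaOne d) : θ ≠ 0 := by
  rintro rfl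
  obtain ⟨k, _, hk⟩ := hθ
  simp at hk

/-- The reflection of the interior is an open neighbourhood of -θ disjoint from the half-space.
Interiority is needed: for a boundary point, minimizers in the half-space could approach -θ. -/
theorem neg_notMem_closure_thetaOne {θ : Vec d} (hθ : θ ∈ interior (ThetaOne d)) :
    -θ ∉ closure (ThetaOne d) := by
  intro h
  have hopen : IsOpen (Neg.neg ⁻¹' interior (ThetaOne d)) := isOpen_interior.preimage continuous_neg
  obtain ⟨t, ht1, ht2⟩ := mem_closure_iff.1 h _ hopen (by simpa using hθ)
  exact neg_notMem_thetaOne ht2 (interior_subset ht1)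

end HalfSpace

/-! ### The criterion, its minimizers and their linearization. -/

section Criterion

variable {n d : ℕ}

theorem negLogLik_neg (x : Fin n → Vec d) (θ : Vec d) : negLogLik x (-θ) = negLogLik x θ := by
  simp [negLogLik]

theorem negLogLik_flip (z : Labels n) (x : Fin n → Vec d) (θ : Vec d) :
    negLogLik (flip z x) θ = negLogLik x θ := by
  have h : ∀ i, Real.cosh (inner ℝ θ (spin z i • x i)) = Real.cosh (inner ℝ θ (x i)) := fun i => by
    rcases spin_eq_or z i with h | h <;> simp [h]
  simp only [negLogLik, flip, h]

theorem negLogLik_zero (x : Fin n → Vec d) : negLogLik x 0 = 0 := by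
  simp [negLogLik]

theorem negLogLik_eq (hn : n ≠ 0) (x : Fin n → Vec d) (θ : Vec d) :
    negLogLik x θ = -((n : ℝ)⁻¹ * ∑ i, logMix θ (x i)) := by
  have hn' : (n : ℝ) ≠ 0 := by exact_mod_cast hn
  simp only [negLogLik, logMix, Finset.sum_sub_distrib, real_inner_self_eq_norm_sq]
  simp
  field_simp
  ring

theorem abs_negLogLik_sub_le (x : Fin n → Vec d) (θ θ' : Vec d) :
    |negLogLik x θ - negLogLik x θ'| ≤
      ‖θ - θ'‖ * ((‖θ‖ + ‖θ'‖) / 2 + (n : ℝ)⁻¹ * ∑ i, ‖x i‖) := by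
  have h1 : |(‖θ‖ ^ 2 - ‖θ'‖ ^ 2) / 2| ≤ ‖θ - θ'‖ * ((‖θ‖ + ‖θ'‖) / 2) := by
    have : (‖θ‖ ^ 2 - ‖θ'‖ ^ 2) / 2 = (‖θ‖ - ‖θ'‖) * ((‖θ‖ + ‖θ'‖) / 2) := by ring
    rw [this, abs_mul, abs_of_nonneg (by positivity : 0 ≤ (‖θ‖ + ‖θ'‖) / 2)]
    gcongr
    exact abs_norm_sub_norm_le θ θ'
  have h2 : |∑ i, (Real.log (Real.cosh (inner ℝ θ (x i))) - Real.log (Real.cosh (inner ℝ θ' (x i))))|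
      ≤ ‖θ - θ'‖ * ∑ i, ‖x i‖ := by
    rw [Finset.mul_sum]
    refine (Finset.abs_sum_le_sum_abs _ _).trans (Finset.sum_le_sum fun i _ => ?_)
    refine (abs_log_cosh_sub_le _ _).trans ?_
    rw [← inner_sub_left]
    exact abs_real_inner_le_norm _ _
  have e : negLogLik x θ - negLogLik x θ' = (‖θ‖ ^ 2 - ‖θ'‖ ^ 2) / 2 - (n : ℝ)⁻¹ *
      ∑ i, (Real.log (Real.cosh (inner ℝ θ (x i))) - Real.log (Real.cosh (inner ℝ θ' (x i)))) := by
    simp only [negLogLik, real_inner_self_eq_norm_sq, Finset.sum_sub_distrib]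
    ring
  rw [e, mul_add]
  refine (abs_sub _ _).trans (add_le_add h1 ?_)
  rw [abs_mul, abs_of_nonneg (by positivity : 0 ≤ (n : ℝ)⁻¹)]
  calc (n : ℝ)⁻¹ * _ ≤ (n : ℝ)⁻¹ * (‖θ - θ'‖ * ∑ i, ‖x i‖) := by gcongr
    _ = _ := by ring

theorem le_negLogLik (x : Fin n → Vec d) (θ : Vec d) :
    ‖θ‖ ^ 2 / 2 - ‖θ‖ * ((n : ℝ)⁻¹ * ∑ i, ‖x i‖) ≤ negLogLik x θ := by
  rw [negLogLik, real_inner_self_eq_norm_sq]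
  have h : ∑ i, Real.log (Real.cosh (inner ℝ θ (x i))) ≤ ‖θ‖ * ∑ i, ‖x i‖ := by
    rw [Finset.mul_sum]
    exact Finset.sum_le_sum fun i _ => (le_abs_self _).trans (abs_log_cosh_inner_le θ (x i))
  have h2 : 1 / (n : ℝ) * ∑ i, Real.log (Real.cosh (inner ℝ θ (x i))) ≤
      ‖θ‖ * ((n : ℝ)⁻¹ * ∑ i, ‖x i‖) := by
    calc _ ≤ 1 / (n : ℝ) * (‖θ‖ * ∑ i, ‖x i‖) := by gcongr
      _ = _ := by ring
  linarith

theorem norm_le_of_negLogLik_nonpos (x : Fin n → Vec d) {θ : Vec d} (h : negLogLik x θ ≤ 0) :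
    ‖θ‖ ≤ 2 * ((n : ℝ)⁻¹ * ∑ i, ‖x i‖) := by
  have h1 := (le_negLogLik x θ).trans h
  have h3 : 0 ≤ (n : ℝ)⁻¹ * ∑ i, ‖x i‖ :=
    mul_nonneg (by positivity) (Finset.sum_nonneg fun i _ => norm_nonneg (x i))
  generalize (n : ℝ)⁻¹ * ∑ i, ‖x i‖ = a at h1 h3
  by_contra! h2
  nlinarith

theorem continuous_negLogLik (x : Fin n → Vec d) : Continuous (negLogLik x) := by
  have h : ∀ i, Continuous fun θ : Vec d => Real.log (Real.cosh (inner ℝ θ (x i))) := fun i =>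
    continuous_log_cosh.comp (by fun_prop : Continuous fun θ : Vec d => inner ℝ θ (x i))
  unfold negLogLik
  exact ((continuous_id.inner continuous_id).div_const 2).sub
    (continuous_const.mul (continuous_finsetSum _ fun i _ => h i))

/-- Outside a ball the criterion is positive, so a global minimizer exists. A negative value
excludes 0 as minimizer, and evenness lets the minimizer be reflected into the half-space, which is
neither open nor closed in general. -/
theorem exists_isMinOn_thetaOne (x : Fin n → Vec d) {θ' : Vec d} (h : negLogLik x θ' < 0) :
    ∃ θ ∈ ThetaOne d, IsMinOn (negLogLik x) (ThetaOne d) θ := by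
  obtain ⟨θ, hθ⟩ := (continuous_negLogLik x).exists_forall_le' 0 (by
    filter_upwards [tendsto_norm_cocompact_atTop.eventually_gt_atTop
      (2 * ((n : ℝ)⁻¹ * ∑ i, ‖x i‖))] with θ hθ
    rw [negLogLik_zero]
    by_contra! hc
    exact absurd (norm_le_of_negLogLik_nonpos x hc.le) (not_le.2 hθ))
  have h0 : θ ≠ 0 := by
    rintro rfl
    have := hθ θ'
    rw [negLogLik_zero] at this
    linarith
  rcases mem_thetaOne_or_neg_mem h0 with h1 | h1
  · exact ⟨θ, h1, fun t _ => hθ t⟩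
  · exact ⟨-θ, h1, fun t _ => by
      simp only [Set.mem_ofPred_eq, negLogLik_neg]; exact hθ t⟩

theorem le_of_isMinOn_thetaOne (x : Fin n → Vec d) {θ' T : Vec d} (h : negLogLik x θ' < 0)
    (hmin : IsMinOn (negLogLik x) (ThetaOne d) T) (θ : Vec d) :
    negLogLik x T ≤ negLogLik x θ := by
  have hne : ∀ t : Vec d, t ≠ 0 → negLogLik x T ≤ negLogLik x t := fun t ht => by
    rcases mem_thetaOne_or_neg_mem ht with h1 | h1
    · exact hmin h1
    · rw [← negLogLik_neg x t]; exact hmin h1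
  by_cases h0 : θ = 0
  · rw [h0, negLogLik_zero]
    refine (hne θ' ?_).trans h.le
    rintro rfl
    rw [negLogLik_zero] at h
    exact lt_irrefl _ h
  · exact hne θ h0

/-- A global minimizer is stationary along every line through it, so the boundary of the half-space
plays no role in the likelihood equation. -/
theorem eq_of_forall_negLogLik_le (x : Fin n → Vec d) {T : Vec d}
    (h : ∀ θ, negLogLik x T ≤ negLogLik x θ) :
    T = (n : ℝ)⁻¹ • ∑ i, Real.tanh (inner ℝ T (x i)) • x i := by
  refine ext_inner_left ℝ fun k => ?_
  have hd : HasDerivAt (fun s : ℝ => negLogLik x (T + s • k))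
      (inner ℝ k T - (n : ℝ)⁻¹ * inner ℝ k (∑ i, Real.tanh (inner ℝ T (x i)) • x i)) 0 := by
    have h1 := hasDerivAt_sum_log_cosh x T k 0
    have h2 : HasDerivAt (fun s : ℝ => (inner ℝ (T + s • k) (T + s • k) : ℝ) / 2)
        (inner ℝ k T) 0 := by
      have e : (fun s : ℝ => (inner ℝ (T + s • k) (T + s • k) : ℝ) / 2) =
          fun s => inner ℝ T T / 2 + (s * inner ℝ k T + s ^ 2 * (inner ℝ k k / 2)) := by
        funext s
        simp only [inner_add_left, inner_add_right, real_inner_smul_left, real_inner_smul_right,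
          real_inner_comm k T]
        ring
      rw [e]
      have h3 := (((hasDerivAt_id (0 : ℝ)).mul_const (inner ℝ k T)).add
        (((hasDerivAt_id (0 : ℝ)).pow 2).mul_const (inner ℝ k k / 2))).const_add (inner ℝ T T / 2)
      simpa using h3
    have h4 := h2.fun_sub (h1.const_mul (1 / (n : ℝ)))
    simp only [zero_smul, add_zero, one_div] at h4
    unfold negLogLik
    simpa only [one_div] using h4
  have hmin : IsLocalMin (fun s : ℝ => negLogLik x (T + s • k)) 0 :=
    Eventually.of_forall fun s => by simpa using h (T + s • k)
  have := hmin.hasDerivAt_eq_zero hd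
  rw [real_inner_smul_right]
  linarith

/-- The observed curvature `sech² ⟪θ, y⟫ y yᵀ`. -/
def curvature (θ y : Vec d) : Vec d →L[ℝ] Vec d :=
  (1 / Real.cosh (inner ℝ θ y)) ^ 2 • InnerProductSpace.rankOne ℝ y y

theorem curvature_apply (θ y v : Vec d) :
    curvature θ y v = ((1 / Real.cosh (inner ℝ θ y)) ^ 2 * inner ℝ y v) • y := by
  simp [curvature, smul_smul]

theorem continuous_curvature (θ : Vec d) : Continuous (curvature θ) := by
  have h : Continuous fun y : Vec d => InnerProductSpace.rankOne ℝ y y :=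
    (InnerProductSpace.rankOne ℝ).continuous.clm_apply continuous_id
  exact (continuous_sech_sq θ).smul h

theorem integrable_curvature (θ : Vec d) : Integrable (curvature θ) (gaussLaw θ) := by
  refine integrable_of_norm_le_pow θ (continuous_curvature θ).aestronglyMeasurable zero_le_one 2
    fun x => ?_
  rw [curvature, norm_smul, InnerProductSpace.norm_rankOne, Real.norm_eq_abs]
  have h1 := abs_sech_sq_le_one (inner ℝ θ x)
  have h2 := norm_nonneg x
  calc _ ≤ 1 * (‖x‖ * ‖x‖) := by gcongr
    _ ≤ _ := by nlinarith

/-- The Fisher information as an operator. -/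
def infoOp (θ : Vec d) : Vec d →L[ℝ] Vec d :=
  ContinuousLinearMap.id ℝ (Vec d) - ∫ y, curvature θ y ∂(gaussLaw θ)

theorem inner_infoOp (θ k v : Vec d) : inner ℝ k (infoOp θ v) = infoForm θ k v := by
  rw [infoOp, sub_apply, ContinuousLinearMap.integral_apply
    (integrable_curvature θ), inner_sub_right, infoForm,
    ← integral_inner ((integrable_curvature θ).apply_continuousLinearMap v)]
  congr 2
  funext y
  rw [curvature_apply, real_inner_smul_right, real_inner_comm y v]
  ring

/-- The inverse Fisher information as an operator. -/
def invInfoOp (θ : Vec d) : Vec d →L[ℝ] Vec d :=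
  Matrix.toEuclideanCLM (𝕜 := ℝ) (infoMatrix θ)⁻¹

theorem infoOp_eq_toEuclideanCLM (θ : Vec d) :
    infoOp θ = Matrix.toEuclideanCLM (𝕜 := ℝ) (infoMatrix θ) := by
  ext v : 1
  refine ext_inner_left ℝ fun k => ?_
  rw [inner_infoOp, infoForm_eq_dotProduct, Matrix.inner_toEuclideanCLM]

theorem invInfoOp_infoOp {θ : Vec d} (hθ : θ ≠ 0) (v : Vec d) : invInfoOp θ (infoOp θ v) = v := by
  have hu : IsUnit (infoMatrix θ).det := (infoMatrix_posDef hθ).det_pos.ne'.isUnit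
  rw [infoOp_eq_toEuclideanCLM, invInfoOp, ← mul_apply_eq_comp, ← map_mul,
    Matrix.nonsing_inv_mul _ hu, map_one]
  rfl

theorem infoOp_invInfoOp {θ : Vec d} (hθ : θ ≠ 0) (v : Vec d) : infoOp θ (invInfoOp θ v) = v := by
  have hu : IsUnit (infoMatrix θ).det := (infoMatrix_posDef hθ).det_pos.ne'.isUnit
  rw [infoOp_eq_toEuclideanCLM, invInfoOp, ← mul_apply_eq_comp, ← map_mul,
    Matrix.mul_nonsing_inv _ hu, map_one]
  rfl

/-- The linearization error of a solution of the likelihood equation. -/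
theorem norm_sqrt_smul_sub_le {θ₀ T : Vec d} (hθ : θ₀ ≠ 0) (hn : n ≠ 0) (x : Fin n → Vec d)
    (hT : T = (n : ℝ)⁻¹ • ∑ i, Real.tanh (inner ℝ T (x i)) • x i) :
    ‖√(n : ℝ) • (T - θ₀) - invInfoOp θ₀ (normScore θ₀ x)‖ ≤
      ‖invInfoOp θ₀‖ * (2 * ‖T - θ₀‖ * ((n : ℝ)⁻¹ * ∑ i, ‖x i‖ ^ 3) +
        ‖(n : ℝ)⁻¹ • ∑ i, curvature θ₀ (x i) - ∫ y, curvature θ₀ y ∂(gaussLaw θ₀)‖) *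
        ‖√(n : ℝ) • (T - θ₀)‖ := by
  set δ := T - θ₀ with hδ
  set E := (n : ℝ)⁻¹ • ∑ i, curvature θ₀ (x i) - ∫ y, curvature θ₀ y ∂(gaussLaw θ₀) with hE
  have hn' : (n : ℝ) ≠ 0 := by exact_mod_cast hn
  have hs0 : (0 : ℝ) < √n := Real.sqrt_pos.2 (by positivity)
  let R : Fin n → Vec d := fun i => (Real.tanh (inner ℝ T (x i)) - Real.tanh (inner ℝ θ₀ (x i)) -
    (inner ℝ T (x i) - inner ℝ θ₀ (x i)) * (1 / Real.cosh (inner ℝ θ₀ (x i))) ^ 2) • x i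
  have hR : ∀ i, ‖R i‖ ≤ 2 * ‖δ‖ ^ 2 * ‖x i‖ ^ 3 := fun i => by
    rw [norm_smul, Real.norm_eq_abs]
    have h1 := abs_tanh_taylor_le (inner ℝ θ₀ (x i)) (inner ℝ T (x i))
    rw [← inner_sub_left, ← hδ] at h1
    have h2 := abs_real_inner_le_norm δ (x i)
    calc _ ≤ 2 * |inner ℝ δ (x i)| ^ 2 * ‖x i‖ := by
          rw [← inner_sub_left, ← hδ]; gcongr
      _ ≤ 2 * (‖δ‖ * ‖x i‖) ^ 2 * ‖x i‖ := by gcongr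
      _ = _ := by ring
  have hterm : ∀ i, Real.tanh (inner ℝ T (x i)) • x i =
      score θ₀ (x i) + θ₀ + curvature θ₀ (x i) δ + R i := fun i => by
    simp only [score, R, curvature_apply, hδ, inner_sub_right, real_inner_comm (x i)]
    module
  -- The empirical curvature is its mean, identity minus information, plus the fluctuation `E`.
  -- Cancelling δ leaves an equation for the information operator applied to δ, which is then
  -- inverted.
  have hsum : δ = (1 / √(n : ℝ)) • normScore θ₀ x + (δ - infoOp θ₀ δ + E δ) +
      (n : ℝ)⁻¹ • ∑ i, R i := by
    have h1 : T = (n : ℝ)⁻¹ • ∑ i, score θ₀ (x i) + θ₀ +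
        ((n : ℝ)⁻¹ • ∑ i, curvature θ₀ (x i)) δ + (n : ℝ)⁻¹ • ∑ i, R i := by
      conv_lhs => rw [hT]
      simp only [hterm, Finset.sum_add_distrib, smul_add, smul_apply,
        sum_apply]
      congr 3
      rw [Finset.sum_const, Finset.card_univ, Fintype.card_fin, ← Nat.cast_smul_eq_nsmul ℝ,
        smul_smul, inv_mul_cancel₀ hn', one_smul]
    have h2 : δ - infoOp θ₀ δ + E δ = ((n : ℝ)⁻¹ • ∑ i, curvature θ₀ (x i)) δ := by
      rw [infoOp, hE, sub_apply, sub_apply]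
      simp
    rw [h2, normScore, smul_smul, sqrt_inv_mul_self]
    conv_lhs => rw [hδ, h1]
    abel
  have hinfo : infoOp θ₀ δ = (1 / √(n : ℝ)) • normScore θ₀ x + (E δ + (n : ℝ)⁻¹ • ∑ i, R i) := by
    have h3 := congrArg (fun v => v - δ + infoOp θ₀ δ) hsum
    simp only [sub_self, zero_add] at h3
    rw [h3]; abel
  have hdiff : √(n : ℝ) • δ - invInfoOp θ₀ (normScore θ₀ x) =
      √(n : ℝ) • invInfoOp θ₀ (E δ + (n : ℝ)⁻¹ • ∑ i, R i) := by
    have h4 := congrArg (invInfoOp θ₀) hinfo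
    rw [invInfoOp_infoOp hθ, map_add, map_smul] at h4
    conv_lhs => rw [h4]
    rw [smul_add, smul_smul, mul_one_div_cancel hs0.ne', one_smul, add_sub_cancel_left]
  have hRsum : ‖(n : ℝ)⁻¹ • ∑ i, R i‖ ≤ 2 * ‖δ‖ ^ 2 * ((n : ℝ)⁻¹ * ∑ i, ‖x i‖ ^ 3) := by
    rw [norm_smul, Real.norm_eq_abs, abs_of_nonneg (by positivity : 0 ≤ (n : ℝ)⁻¹)]
    calc (n : ℝ)⁻¹ * ‖∑ i, R i‖ ≤ (n : ℝ)⁻¹ * ∑ i, 2 * ‖δ‖ ^ 2 * ‖x i‖ ^ 3 := by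
          gcongr; exact norm_sum_le_of_le _ fun i _ => hR i
      _ = _ := by rw [← Finset.mul_sum]; ring
  rw [hdiff, norm_smul, norm_smul, Real.norm_eq_abs, abs_of_pos hs0]
  calc √(n : ℝ) * ‖invInfoOp θ₀ (E δ + (n : ℝ)⁻¹ • ∑ i, R i)‖
      ≤ √(n : ℝ) * (‖invInfoOp θ₀‖ * (‖E‖ * ‖δ‖ + 2 * ‖δ‖ ^ 2 * ((n : ℝ)⁻¹ * ∑ i, ‖x i‖ ^ 3))) := by
        gcongr
        refine ((invInfoOp θ₀).le_opNorm _).trans ?_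
        gcongr
        exact (norm_add_le _ _).trans (add_le_add (E.le_opNorm δ) hRsum)
    _ = _ := by ring

end Criterion

/-! ### Consistency and asymptotic linearity of the estimator. -/

section Consistency

variable {d : ℕ}

/-- A single null set serves all θ: the strong law is applied on a countable dense set, and local
Lipschitz bounds for the empirical and limiting criteria extend it to every parameter. -/
theorem ae_tendsto_negLogLik (θ₀ : Vec d) :
    ∀ᵐ ω ∂(seqLaw θ₀), ∀ θ : Vec d, Tendsto (fun n => negLogLik (trunc n ω) θ) atTop
      (𝓝 (-∫ x, logMix θ x ∂(gaussLaw θ₀))) := by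
  have h1 : ∀ᵐ ω ∂(seqLaw θ₀), ∀ j, Tendsto (fun n =>
      negLogLik (trunc n ω) (TopologicalSpace.denseSeq (Vec d) j)) atTop
      (𝓝 (-∫ x, logMix (TopologicalSpace.denseSeq (Vec d) j) x ∂(gaussLaw θ₀))) := by
    rw [ae_all_iff]
    intro j
    filter_upwards [strong_law_seqLaw θ₀ (continuous_logMix (TopologicalSpace.denseSeq (Vec d)
      j)).measurable (integrable_logMix _ θ₀)] with ω hω
    refine hω.neg.congr' ?_
    filter_upwards [eventually_ne_atTop 0] with n hn
    rw [negLogLik_eq hn]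
  have h2 := strong_law_seqLaw θ₀ (g := fun x => ‖x‖) measurable_norm
    (by simpa using integrable_norm_pow θ₀ 1)
  filter_upwards [h1, h2] with ω h1 h2
  intro θ
  set m := ∫ x, ‖x‖ ∂(gaussLaw θ₀) with hm
  have hm0 : 0 ≤ m := integral_nonneg fun x => norm_nonneg x
  have hM : ∀ t : Vec d, |(-∫ x, logMix t x ∂(gaussLaw θ₀)) - -∫ x, logMix θ x ∂(gaussLaw θ₀)| ≤
      ‖t - θ‖ * ((‖t‖ + ‖θ‖) / 2 + m) := fun t => by
    have e : (-∫ x, logMix t x ∂(gaussLaw θ₀)) - -∫ x, logMix θ x ∂(gaussLaw θ₀) =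
        ∫ x, (logMix θ x - logMix t x) ∂(gaussLaw θ₀) := by
      rw [integral_sub (integrable_logMix _ _) (integrable_logMix _ _)]; ring
    have hi : Integrable (fun x : Vec d => ‖x‖) (gaussLaw θ₀) := by
      simpa using integrable_norm_pow θ₀ 1
    have e2 : ‖t - θ‖ * ((‖t‖ + ‖θ‖) / 2 + m) =
        ∫ x, ‖t - θ‖ * ((‖t‖ + ‖θ‖) / 2 + ‖x‖) ∂(gaussLaw θ₀) := by
      rw [integral_const_mul, integral_add (integrable_const _) hi]; simp [hm]
    rw [e, e2, ← Real.norm_eq_abs]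
    refine norm_integral_le_of_norm_le (((integrable_const _).add hi).const_mul _)
      (ae_of_all _ fun x => ?_)
    -- For sample size one the criterion is minus the log-density, so its Lipschitz bound passes to
    -- the limit after integration.
    have := abs_negLogLik_sub_le (fun _ : Fin 1 => x) t θ
    rw [negLogLik_eq one_ne_zero, negLogLik_eq one_ne_zero] at this
    simp only [Finset.univ_unique, Finset.sum_singleton, Nat.cast_one, inv_one, one_mul] at this
    rw [Real.norm_eq_abs]
    convert! this using 2
    ring
  rw [Metric.tendsto_atTop]
  intro ε hε
  set C := 2 * ‖θ‖ + 2 + m with hC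
  have hC0 : 0 < C := by positivity
  obtain ⟨j, hd⟩ := (TopologicalSpace.denseRange_denseSeq (Vec d)).exists_dist_lt θ
    (show 0 < min 1 (ε / (4 * C)) by positivity)
  set t := TopologicalSpace.denseSeq (Vec d) j with htdef
  rw [dist_comm, dist_eq_norm] at hd
  have hd1 : ‖t - θ‖ < 1 := hd.trans_le (min_le_left _ _)
  have hd2 : ‖t - θ‖ < ε / (4 * C) := hd.trans_le (min_le_right _ _)
  have htn : ‖t‖ ≤ ‖θ‖ + 1 := by
    have := norm_add_le (t - θ) θ
    rw [sub_add_cancel] at this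
    linarith
  have hlast : ∀ a : ℝ, a ≤ m + 1 → ‖t - θ‖ * ((‖t‖ + ‖θ‖) / 2 + a) ≤ ε / 4 := fun a ha => by
    calc ‖t - θ‖ * ((‖t‖ + ‖θ‖) / 2 + a) ≤ ‖t - θ‖ * C := by
          gcongr; rw [hC]; linarith [norm_nonneg θ]
      _ ≤ ε / (4 * C) * C := by gcongr
      _ = ε / 4 := by field_simp
  obtain ⟨N1, hN1⟩ := Metric.tendsto_atTop.1 (h1 j) (ε / 4) (by positivity)
  obtain ⟨N2, hN2⟩ := eventually_atTop.1 (h2.eventually (gt_mem_nhds (lt_add_one m)))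
  refine ⟨max N1 N2, fun n hn => ?_⟩
  have a1 := hN1 n (le_of_max_le_left hn)
  have a2 := hN2 n (le_of_max_le_right hn)
  have a3 := (abs_negLogLik_sub_le (trunc n ω) t θ).trans (hlast _ a2.le)
  have a4 := (hM t).trans (hlast m (by linarith))
  rw [Real.dist_eq] at a1 ⊢
  rw [abs_lt] at a1 ⊢
  rw [abs_le] at a3 a4
  constructor <;> linarith

/-- Global minimizers of the criterion in the half-space are consistent. -/
theorem ae_eventually_minimizer_near {θ₀ : Vec d} (hθ₀ : θ₀ ∈ interior (ThetaOne d)) :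
    ∀ᵐ ω ∂(seqLaw θ₀), ∀ ε : ℝ, 0 < ε → ∀ᶠ n in atTop, negLogLik (trunc n ω) θ₀ < 0 ∧
      ∀ T ∈ ThetaOne d, (∀ θ, negLogLik (trunc n ω) T ≤ negLogLik (trunc n ω) θ) →
        ‖T - θ₀‖ < ε := by
  have h2 := strong_law_seqLaw θ₀ (g := fun x => ‖x‖) measurable_norm
    (by simpa using integrable_norm_pow θ₀ 1)
  have hne : θ₀ ≠ 0 := ne_zero_of_mem_thetaOne (interior_subset hθ₀)
  filter_upwards [ae_tendsto_negLogLik θ₀, h2] with ω h1 h2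
  intro ε hε
  set m := ∫ x, ‖x‖ ∂(gaussLaw θ₀) with hm
  have hm0 : 0 ≤ m := integral_nonneg fun x => norm_nonneg x
  have hneg : ∀ᶠ n in atTop, negLogLik (trunc n ω) θ₀ < 0 :=
    (h1 θ₀).eventually (gt_mem_nhds (neg_lt_zero.2 (integral_logMix_pos hne)))
  have hmean : ∀ᶠ n : ℕ in atTop, (n : ℝ)⁻¹ * ∑ i : Fin n, ‖trunc n ω i‖ < m + 1 :=
    h2.eventually (gt_mem_nhds (lt_add_one m))
  -- A minimizer at distance at least ε from θ₀ would lie in this compact set: a nonpositive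
  -- criterion value bounds its norm by twice the empirical mean norm, eventually below m + 1.
  set K : Set (Vec d) := (Metric.closedBall 0 (2 * (m + 1)) ∩ closure (ThetaOne d)) \
    Metric.ball θ₀ ε with hK
  have hKc : IsCompact K := by
    refine ((isCompact_closedBall 0 _).inter_right isClosed_closure).diff Metric.isOpen_ball
  have hKev : ∀ᶠ n in atTop, ∀ t ∈ K, negLogLik (trunc n ω) θ₀ < negLogLik (trunc n ω) t := by
    -- Wald's argument. Near each point of K the limiting gap and the Lipschitz bound keep the
    -- criterion above its value at θ₀; compactness reduces to finitely many neighbourhoods.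
    refine hKc.induction_on (p := fun s => ∀ᶠ n in atTop, ∀ t ∈ s,
      negLogLik (trunc n ω) θ₀ < negLogLik (trunc n ω) t) (by simp) (fun s t hst ht =>
        ht.mono fun n hn x hx => hn x (hst hx)) (fun s t hs ht => by
        filter_upwards [hs, ht] with n h3 h4 x hx
        exact hx.elim (h3 x) (h4 x)) fun t ht => ?_
    have hlt : -∫ x, logMix θ₀ x ∂(gaussLaw θ₀) < -∫ x, logMix t x ∂(gaussLaw θ₀) := by
      by_contra! hc
      rcases eq_or_eq_neg_of_integral_logMix_le (neg_le_neg_iff.1 hc) with h | h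
      · rw [h] at ht; exact ht.2 (Metric.mem_ball_self hε)
      · rw [h] at ht; exact neg_notMem_closure_thetaOne hθ₀ ht.1.2
    set g := (-∫ x, logMix t x ∂(gaussLaw θ₀)) - (-∫ x, logMix θ₀ x ∂(gaussLaw θ₀)) with hg
    have hg0 : 0 < g := sub_pos.2 hlt
    set C := ‖t‖ + 1 + (m + 1) with hC
    have hC0 : 0 < C := by positivity
    refine ⟨Metric.ball t (min 1 (g / (2 * C))), mem_nhdsWithin_of_mem_nhds
      (Metric.ball_mem_nhds t (by positivity)), ?_⟩
    filter_upwards [hmean, ((h1 t).sub (h1 θ₀)).eventually (lt_mem_nhds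
      (show g / 2 < _ by rw [← hg]; linarith))] with n h3 h4 s hs
    rw [Metric.mem_ball, dist_eq_norm] at hs
    have hs1 : ‖s - t‖ < 1 := hs.trans_le (min_le_left _ _)
    have hs2 : ‖s - t‖ < g / (2 * C) := hs.trans_le (min_le_right _ _)
    have hsn : ‖s‖ ≤ ‖t‖ + 1 := by
      have := norm_add_le (s - t) t
      rw [sub_add_cancel] at this
      linarith
    have h5 := abs_negLogLik_sub_le (trunc n ω) s t
    have h6 : ‖s - t‖ * ((‖s‖ + ‖t‖) / 2 + (n : ℝ)⁻¹ * ∑ i, ‖trunc n ω i‖) ≤ g / 2 := by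
      calc _ ≤ ‖s - t‖ * C := by gcongr; rw [hC]; linarith
        _ ≤ g / (2 * C) * C := by gcongr
        _ = g / 2 := by field_simp
    have h7 := (abs_le.1 (h5.trans h6)).1
    linarith
  filter_upwards [hneg, hmean, hKev] with n h3 h4 h5
  refine ⟨h3, fun T hT hmin => ?_⟩
  by_contra! hc
  refine absurd (hmin θ₀) (not_le.2 (h5 T ⟨⟨?_, subset_closure hT⟩, ?_⟩))
  · rw [mem_closedBall_zero_iff]
    have := norm_le_of_negLogLik_nonpos (trunc n ω) ((hmin θ₀).trans h3.le)
    linarith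
  · rw [Metric.mem_ball, dist_eq_norm]; exact not_lt.2 hc

/-- The estimator itself need not be flip-invariant, since minimizers may be chosen differently. The
criterion is, so the expansion holds for all flips at once. The error is relative to the score norm
because the score is only bounded in probability. -/
theorem ae_eventually_estimator_expansion {θ₀ : Vec d} (hθ₀ : θ₀ ∈ interior (ThetaOne d))
    {T : ∀ n : ℕ, (Fin n → Vec d) → Vec d} (hT : IsIIDEstimator T) :
    ∀ᵐ ω ∂(seqLaw θ₀), ∀ ε : ℝ, 0 < ε → ∀ᶠ n in atTop, ∀ z : Labels n,
      ‖√(n : ℝ) • (T n (flip z (trunc n ω)) - θ₀) - invInfoOp θ₀ (normScore θ₀ (trunc n ω))‖ ≤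
        ε * ‖normScore θ₀ (trunc n ω)‖ := by
  have hne : θ₀ ≠ 0 := ne_zero_of_mem_thetaOne (interior_subset hθ₀)
  have h3 := strong_law_seqLaw θ₀ (g := fun x => ‖x‖ ^ 3) (by fun_prop) (integrable_norm_pow θ₀ 3)
  have hcurv := strong_law_seqLaw_smul θ₀ (continuous_curvature θ₀).measurable
    (integrable_curvature θ₀)
  filter_upwards [ae_eventually_minimizer_near hθ₀, h3, hcurv] with ω h1 h3 hcurv
  intro ε hε
  set m := ∫ x, ‖x‖ ^ 3 ∂(gaussLaw θ₀) with hm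
  have hm0 : 0 ≤ m := integral_nonneg fun x => by positivity
  set G := ‖invInfoOp θ₀‖ with hG
  have hG0 : 0 ≤ G := norm_nonneg _
  -- The value 1/2 lets the error term κ‖√n(t - θ₀)‖ be absorbed on the left; the other value turns
  -- the resulting bound 2G‖Δ_n‖ into ε‖Δ_n‖. Below, η makes the third-moment term contribute at
  -- most κ/2.
  set κ := min (1 / 2) (ε / (2 * (G + 1))) with hκ
  have hκ0 : 0 < κ := by positivity
  set η := κ / (4 * (G + 1) * (m + 1)) with hη
  have hη0 : 0 < η := by positivity
  have hcurv' := (tendsto_iff_norm_sub_tendsto_zero.1 hcurv).eventually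
    (gt_mem_nhds (show 0 < κ / (2 * (G + 1)) by positivity))
  filter_upwards [h1 η hη0, h3.eventually (gt_mem_nhds (lt_add_one m)), hcurv',
    eventually_ne_atTop 0] with n hn1 hn2 hn3 hn0 z
  set y := trunc n ω with hy
  set t := T n (flip z y) with ht
  obtain ⟨hneg, hnear⟩ := hn1
  obtain ⟨ht1, htmin⟩ := hT.isMinOn n (flip z y) (exists_isMinOn_thetaOne _
    (by rwa [negLogLik_flip]))
  have hglob : ∀ θ, negLogLik y t ≤ negLogLik y θ := fun θ => by
    have := le_of_isMinOn_thetaOne (flip z y) (by rwa [negLogLik_flip]) htmin θ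
    rwa [negLogLik_flip, negLogLik_flip] at this
  have hclose := hnear t ht1 hglob
  have hb := norm_sqrt_smul_sub_le hne hn0 y (eq_of_forall_negLogLik_le y hglob)
  have hfac : G * (2 * ‖t - θ₀‖ * ((n : ℝ)⁻¹ * ∑ i, ‖y i‖ ^ 3) +
      ‖(n : ℝ)⁻¹ • ∑ i, curvature θ₀ (y i) - ∫ y, curvature θ₀ y ∂(gaussLaw θ₀)‖) ≤ κ := by
    calc _ ≤ (G + 1) * (2 * η * (m + 1) + κ / (2 * (G + 1))) := by
          gcongr; linarith
      _ = κ := by rw [hη]; field_simp; ring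
  have hb2 := hb.trans (mul_le_mul_of_nonneg_right hfac (norm_nonneg _))
  have h4 : ‖√(n : ℝ) • (t - θ₀)‖ ≤ 2 * (G * ‖normScore θ₀ y‖) := by
    have h5 := norm_add_le (√(n : ℝ) • (t - θ₀) - invInfoOp θ₀ (normScore θ₀ y))
      (invInfoOp θ₀ (normScore θ₀ y))
    rw [sub_add_cancel] at h5
    have h6 := (invInfoOp θ₀).le_opNorm (normScore θ₀ y)
    have h7 : κ * ‖√(n : ℝ) • (t - θ₀)‖ ≤ 1 / 2 * ‖√(n : ℝ) • (t - θ₀)‖ := by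
      gcongr; exact min_le_left _ _
    linarith
  calc _ ≤ κ * ‖√(n : ℝ) • (t - θ₀)‖ := hb2
    _ ≤ ε / (2 * (G + 1)) * (2 * ((G + 1) * ‖normScore θ₀ y‖)) := by
        gcongr
        · exact min_le_right _ _
        · refine h4.trans ?_
          gcongr; linarith
    _ = ε * ‖normScore θ₀ y‖ := by field_simp

/-- The estimator is asymptotically linear under any label law. -/
theorem tendstoZeroInProb_estimator_sub {θ₀ : Vec d} (hθ₀ : θ₀ ∈ interior (ThetaOne d))
    {T : ∀ n : ℕ, (Fin n → Vec d) → Vec d} (hT : IsIIDEstimator T) (Q : ∀ n, PMF (Labels n)) :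
    TendstoZeroInProb (fun n => dataLaw θ₀ (Q n)) fun (n : ℕ) (x : Fin n → Vec d) =>
      √(n : ℝ) • (T n x - θ₀) - invInfoOp θ₀ (normScore θ₀ x) := by
  have hmeas : ∀ n : ℕ, Measurable fun x : Fin n → Vec d =>
      √(n : ℝ) • (T n x - θ₀) - invInfoOp θ₀ (normScore θ₀ x) := fun n => by
    have h1 := hT.measurable n
    have h2 : Measurable fun x : Fin n → Vec d => invInfoOp θ₀ (normScore θ₀ x) :=
      ((invInfoOp θ₀).continuous.comp (continuous_normScore θ₀)).measurable
    have h3 : Measurable fun x : Fin n → Vec d => √(n : ℝ) • (T n x - θ₀) :=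
      (h1.sub_const θ₀).const_smul (√(n : ℝ))
    exact h3.sub h2
  obtain ⟨K, hK0, hK⟩ := exists_bound_integral_normScore_sq θ₀ Q
  refine TendstoZeroInProb.of_forall_le fun ε hε δ hδ => ?_
  obtain ⟨η, hη0, hη⟩ : ∃ η : ℝ, 0 < η ∧ ENNReal.ofReal (η ^ 2 * K / ε ^ 2) ≤ δ := by
    have hc : Tendsto (fun η : ℝ => ENNReal.ofReal (η ^ 2 * K / ε ^ 2)) (𝓝[>] 0) (𝓝 0) := by
      have : Continuous fun η : ℝ => ENNReal.ofReal (η ^ 2 * K / ε ^ 2) :=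
        ENNReal.continuous_ofReal.comp (by fun_prop)
      have h := this.tendsto 0
      simp only [ne_eq, OfNat.ofNat_ne_zero, not_false_eq_true, zero_pow, zero_mul, zero_div,
        ENNReal.ofReal_zero] at h
      exact h.mono_left nhdsWithin_le_nhds
    obtain ⟨η, h1, h2⟩ := ((hc.eventually (gt_mem_nhds hδ)).and self_mem_nhdsWithin).exists
    exact ⟨η, h2, h1.le⟩
  -- The exceptional event for some flip. Its i.i.d. probability bounds the probability under any
  -- label law and tends to 0; a large score is handled by Chebyshev's inequality.
  set S : ∀ n : ℕ, Set (Fin n → Vec d) := fun n => ⋃ z : Labels n, {y | η * ‖normScore θ₀ y‖ <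
    ‖√(n : ℝ) • (T n (flip z y) - θ₀) - invInfoOp θ₀ (normScore θ₀ (flip z y))‖} with hS
  have hSm : ∀ n, MeasurableSet (S n) := fun n => MeasurableSet.iUnion fun z =>
    measurableSet_lt (by fun_prop) ((hmeas n).comp (continuous_flip z).measurable).norm
  refine ⟨_, tendsto_pi_measure_zero θ₀ hSm ?_, Eventually.of_forall fun n => ?_⟩
  · filter_upwards [ae_eventually_estimator_expansion hθ₀ hT] with ω hω
    filter_upwards [hω η hη0] with n hn
    simp only [hS, Set.mem_iUnion, Set.mem_ofPred_eq, not_exists, not_lt, normScore_flip]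
    exact hn
  · have hsub : {x : Fin n → Vec d | ε ≤ ‖√(n : ℝ) • (T n x - θ₀) -
        invInfoOp θ₀ (normScore θ₀ x)‖} ⊆ {x | η * ‖normScore θ₀ x‖ <
        ‖√(n : ℝ) • (T n x - θ₀) - invInfoOp θ₀ (normScore θ₀ x)‖} ∪
        {x | ε ^ 2 / η ^ 2 ≤ ‖normScore θ₀ x‖ ^ 2} := fun x hx => by
      by_contra hc
      simp only [Set.mem_union, Set.mem_ofPred_eq, not_or, not_lt, not_le] at hc hx
      have h1 := hx.trans hc.1
      rw [lt_div_iff₀ (by positivity), ← mul_pow, mul_comm] at hc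
      exact absurd (lt_of_pow_lt_pow_left₀ 2 hε.le hc.2) (not_lt.2 (h1.trans_eq (mul_comm _ _)))
    refine (measure_mono hsub).trans ((measure_union_le _ _).trans (add_le_add ?_ ?_))
    · refine dataLaw_le_of_flip θ₀ (Q n) fun z y hy => Set.mem_iUnion.2 ⟨z, ?_⟩
      simpa only [Set.mem_preimage, Set.mem_ofPred_eq, normScore_flip] using hy
    · refine le_trans ?_ hη
      have h2 := mul_meas_ge_le_integral_of_nonneg (μ := dataLaw θ₀ (Q n))
        (ae_of_all _ fun x => by positivity) (hK n).1 (ε ^ 2 / η ^ 2)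
      rw [← ofReal_measureReal]
      refine ENNReal.ofReal_le_ofReal ?_
      rw [le_div_iff₀ (by positivity)]
      have h3 := h2.trans (hK n).2
      rw [div_mul_eq_mul_div, div_le_iff₀ (by positivity)] at h3
      linarith

end Consistency

/-! ### Convergence in mean of likelihood ratios. -/

section ChangeOfMeasure

variable {Ω : ℕ → Type*} [∀ n, MeasurableSpace (Ω n)] {P : ∀ n, Measure (Ω n)}
  [∀ n, IsProbabilityMeasure (P n)]

theorem integrable_of_measurable_bounded {α : Type*} [MeasurableSpace α] {μ : Measure α}
    [IsFiniteMeasure μ] {g : α → ℝ} (hg : Measurable g) {C : ℝ} (hC : ∀ x, |g x| ≤ C) :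
    Integrable g μ :=
  Integrable.of_bound hg.aestronglyMeasurable C (ae_of_all _ hC)

/-- Bounded convergence in probability implies convergence of second moments. -/
theorem tendsto_integral_sq_of_inProb {g : ∀ n, Ω n → ℝ} (hg : ∀ n, Measurable (g n)) {C : ℝ}
    (hC : ∀ n x, |g n x| ≤ C) (h : TendstoZeroInProb P g) :
    Tendsto (fun n => ∫ x, g n x ^ 2 ∂(P n)) atTop (𝓝 0) := by
  have hle : ∀ ε : ℝ, 0 < ε → ∀ n, ∫ x, g n x ^ 2 ∂(P n) ≤
      ε ^ 2 + C ^ 2 * (P n).real {x | ε ≤ ‖g n x‖} := fun ε hε n => by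
    have hm : MeasurableSet {x | ε ≤ ‖g n x‖} := measurableSet_le measurable_const (hg n).norm
    have hi : Integrable (fun x => ε ^ 2 + {x | ε ≤ ‖g n x‖}.indicator (fun _ => C ^ 2) x) (P n) :=
      (integrable_const _).add ((integrable_const _).indicator hm)
    have hi2 : Integrable (fun x => g n x ^ 2) (P n) :=
      integrable_of_measurable_bounded ((hg n).pow_const 2) (C := C ^ 2) fun x => by
        rw [abs_pow]; exact pow_le_pow_left₀ (abs_nonneg _) (hC n x) 2
    refine (integral_mono hi2 hi fun x => ?_).trans (le_of_eq ?_)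
    · by_cases hx : x ∈ {x | ε ≤ ‖g n x‖}
      · simp only [Set.indicator_of_mem hx]
        have := pow_le_pow_left₀ (abs_nonneg _) (hC n x) 2
        rw [sq_abs] at this
        nlinarith [sq_nonneg ε]
      · simp only [Set.indicator_of_notMem hx, add_zero]
        have h1 : |g n x| ≤ ε := (not_le.1 hx).le
        have := pow_le_pow_left₀ (abs_nonneg _) h1 2
        rwa [sq_abs] at this
    · rw [integral_add (integrable_const _) ((integrable_const _).indicator hm),
        integral_indicator_const _ hm]
      simp [mul_comm]
  rw [Metric.tendsto_atTop]
  intro η hη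
  have hs : 0 < √(η / 2) := Real.sqrt_pos.2 (half_pos hη)
  have h1 : Tendsto (fun n => C ^ 2 * (P n).real {x | √(η / 2) ≤ ‖g n x‖}) atTop (𝓝 0) := by
    have := (ENNReal.tendsto_toReal ENNReal.zero_ne_top).comp (h _ hs)
    have h2 := this.const_mul (C ^ 2)
    rw [ENNReal.toReal_zero, mul_zero] at h2
    exact h2
  obtain ⟨N, hN⟩ := eventually_atTop.1 (h1.eventually (gt_mem_nhds (half_pos hη)))
  refine ⟨N, fun n hn => ?_⟩
  rw [Real.dist_eq, sub_zero, abs_of_nonneg (integral_nonneg fun x => sq_nonneg _)]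
  have h2 := hle _ hs n
  rw [Real.sq_sqrt (half_pos hη).le] at h2
  linarith [hN n hn]

/-- Young's inequality |g|b ≤ δb² + g²/(4δ): the first term is small with δ by the uniform L² bound,
the second vanishes for fixed δ. -/
theorem tendsto_integral_abs_mul_of_inProb {g b : ∀ n, Ω n → ℝ} (hg : ∀ n, Measurable (g n)) {C : ℝ}
    (hC : ∀ n x, |g n x| ≤ C) (h : TendstoZeroInProb P g) (hb0 : ∀ n x, 0 ≤ b n x)
    (hb2 : ∀ n, Integrable (fun x => b n x ^ 2) (P n)) {K : ℝ}
    (hK : ∀ n, ∫ x, b n x ^ 2 ∂(P n) ≤ K) :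
    Tendsto (fun n => ∫ x, |g n x| * b n x ∂(P n)) atTop (𝓝 0) := by
  have hK0 : 0 ≤ K := (integral_nonneg fun x => sq_nonneg _).trans (hK 0)
  have hg2 : ∀ n, Integrable (fun x => g n x ^ 2) (P n) := fun n =>
    integrable_of_measurable_bounded ((hg n).pow_const 2) (C := C ^ 2) fun x => by
      rw [abs_pow]; exact pow_le_pow_left₀ (abs_nonneg _) (hC n x) 2
  have hle : ∀ δ : ℝ, 0 < δ → ∀ n, ∫ x, |g n x| * b n x ∂(P n) ≤
      δ * K + (∫ x, g n x ^ 2 ∂(P n)) / (4 * δ) := fun δ hδ n => by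
    have hpt : ∀ x, |g n x| * b n x ≤ δ * b n x ^ 2 + g n x ^ 2 / (4 * δ) := fun x => by
      rw [← sub_nonneg]
      have e : δ * b n x ^ 2 + g n x ^ 2 / (4 * δ) - |g n x| * b n x =
          (2 * δ * b n x - |g n x|) ^ 2 / (4 * δ) := by
        rw [← sq_abs (g n x)]; field_simp; ring
      rw [e]; positivity
    have hi : Integrable (fun x => δ * b n x ^ 2 + g n x ^ 2 / (4 * δ)) (P n) :=
      ((hb2 n).const_mul δ).add ((hg2 n).div_const (4 * δ))
    refine (integral_mono_of_nonneg (ae_of_all _ fun x => mul_nonneg (abs_nonneg _) (hb0 n x))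
      hi (ae_of_all _ hpt)).trans ?_
    rw [integral_add ((hb2 n).const_mul δ) ((hg2 n).div_const (4 * δ)), integral_const_mul,
      integral_div]
    gcongr
    exact hK n
  rw [Metric.tendsto_atTop]
  intro η hη
  set δ := η / (2 * (K + 1)) with hδ
  have hδ0 : 0 < δ := by positivity
  have h1 := (tendsto_integral_sq_of_inProb hg hC h).div_const (4 * δ)
  rw [zero_div] at h1
  obtain ⟨N, hN⟩ := eventually_atTop.1 (h1.eventually (gt_mem_nhds (half_pos hη)))
  refine ⟨N, fun n hn => ?_⟩
  rw [Real.dist_eq, sub_zero, abs_of_nonneg (integral_nonneg fun x =>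
    mul_nonneg (abs_nonneg _) (hb0 n x))]
  have h2 : δ * K ≤ η / 2 := by
    calc δ * K ≤ δ * (K + 1) := by gcongr; linarith
      _ = η / 2 := by rw [hδ]; field_simp
  linarith [hle δ hδ0 n, hN n hn]

/-- Le Cam: an asymptotically quadratic log-likelihood ratio converges in mean after
exponentiation. -/
theorem tendsto_integral_abs_exp_sub {l q : ∀ n, Ω n → ℝ} (hl : ∀ n, Measurable (l n))
    (hq : ∀ n, Measurable (q n)) (hli : ∀ n, Integrable (fun x => Real.exp (l n x)) (P n))
    (hl1 : ∀ n, ∫ x, Real.exp (l n x) ∂(P n) = 1)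
    (hqi : ∀ n, Integrable (fun x => Real.exp (q n x)) (P n))
    (hq1 : Tendsto (fun n => ∫ x, Real.exp (q n x) ∂(P n)) atTop (𝓝 1))
    (hq2 : ∀ n, Integrable (fun x => Real.exp (q n x) ^ 2) (P n)) {K : ℝ}
    (hK : ∀ n, ∫ x, Real.exp (q n x) ^ 2 ∂(P n) ≤ K)
    (h : TendstoZeroInProb P fun n x => l n x - q n x) :
    Tendsto (fun n => ∫ x, |Real.exp (l n x) - Real.exp (q n x)| ∂(P n)) atTop (𝓝 0) := by
  -- As in Scheffé's lemma, |e^l - e^q| = e^l - e^q + 2g e^q. The signed part integrates to a null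
  -- sequence because both masses tend to 1, and g is bounded, so only e^q needs second moments.
  let g : ∀ n, Ω n → ℝ := fun n x => max (1 - Real.exp (l n x - q n x)) 0
  have hgm : ∀ n, Measurable (g n) := fun n =>
    (measurable_const.sub (Real.measurable_exp.comp ((hl n).sub (hq n)))).max measurable_const
  have hg0 : ∀ n x, 0 ≤ g n x := fun n x => le_max_right _ _
  have hg1 : ∀ n x, |g n x| ≤ 1 := fun n x => by
    rw [abs_of_nonneg (hg0 n x)]
    exact max_le (by linarith [Real.exp_pos (l n x - q n x)]) zero_le_one
  have hgp : TendstoZeroInProb P g := h.mono fun n x => by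
    rw [Real.norm_eq_abs, Real.norm_eq_abs, abs_of_nonneg (hg0 n x)]
    refine max_le ?_ (abs_nonneg _)
    linarith [Real.add_one_le_exp (l n x - q n x), neg_abs_le (l n x - q n x)]
  have hlim := tendsto_integral_abs_mul_of_inProb hgm hg1 hgp (b := fun n x => Real.exp (q n x))
    (fun n x => (Real.exp_pos _).le) hq2 hK
  have e : ∀ n x, |Real.exp (l n x) - Real.exp (q n x)| =
      Real.exp (l n x) - Real.exp (q n x) + 2 * (|g n x| * Real.exp (q n x)) := fun n x => by
    have hlq : Real.exp (l n x) = Real.exp (l n x - q n x) * Real.exp (q n x) := by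
      rw [← Real.exp_add]; ring_nf
    have hp := Real.exp_pos (q n x)
    rw [abs_of_nonneg (hg0 n x), hlq]
    rcases le_total (Real.exp (l n x - q n x)) 1 with h1 | h1
    · have : g n x = 1 - Real.exp (l n x - q n x) := max_eq_left (by linarith)
      rw [this, abs_of_nonpos (by nlinarith)]
      ring
    · have : g n x = 0 := max_eq_right (by linarith)
      rw [this, abs_of_nonneg (by nlinarith)]
      ring
  have hgi : ∀ n, Integrable (fun x => |g n x| * Real.exp (q n x)) (P n) := fun n =>
    (hqi n).bdd_mul (c := 1) (hgm n).norm.aestronglyMeasurable (ae_of_all _ fun x => by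
      rw [Real.norm_eq_abs, abs_abs]; exact hg1 n x)
  have h2 := (hq1.const_sub 1).add (hlim.const_mul 2)
  simp only [sub_self, mul_zero, add_zero] at h2
  refine h2.congr fun n => ?_
  simp only [e]
  rw [integral_add (by exact (hli n).sub (hqi n)) ((hgi n).const_mul 2),
    integral_sub (hli n) (hqi n), hl1, integral_const_mul]

end ChangeOfMeasure

/-! ### Analytic continuation of limits. -/

section AnalyticContinuation

/-- Power series with uniform geometric bounds converging on a real segment converge
throughout the unit disc. -/
theorem tendsto_of_tendsto_on_reals {f : ℕ → ℂ → ℂ} {a : ℕ → ℕ → ℂ} {G : ℂ → ℂ}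
    (hG : Differentiable ℂ G) {C : ℝ} (ha : ∀ n k, ‖a n k‖ ≤ C * (1 / 2) ^ k)
    (hf : ∀ n w, ‖w‖ ≤ 1 → HasSum (fun k => a n k * w ^ k) (f n w))
    (hlim : ∀ s : ℝ, 0 < s → s < 1 → Tendsto (fun n => f n s) atTop (𝓝 (G s)))
    {w : ℂ} (hw : ‖w‖ ≤ 1) : Tendsto (fun n => f n w) atTop (𝓝 (G w)) := by
  let g : ℕ → ℂ := fun k => (k.factorial : ℂ)⁻¹ * iteratedDeriv k G 0
  have hg : ∀ w, HasSum (fun k => g k * w ^ k) (G w) := fun w => by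
    refine (Complex.hasSum_taylorSeries_of_entire hG 0 w).congr_fun ?_
    intro k
    simp only [g, sub_zero, smul_eq_mul]
    ring
  -- The Taylor series of the entire limit converges at 2, so its terms there are bounded.
  obtain ⟨C', hC'⟩ : ∃ C' : ℝ, ∀ k, ‖g k‖ ≤ C' * (1 / 2) ^ k := by
    obtain ⟨C', hC'⟩ := (hg 2).summable.tendsto_atTop_zero.norm.bddAbove_range
    refine ⟨C', fun k => ?_⟩
    have h1 : ‖g k * 2 ^ k‖ ≤ C' := hC' ⟨k, rfl⟩
    rw [norm_mul, norm_pow, Complex.norm_ofNat] at h1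
    rw [one_div, inv_pow, ← div_eq_mul_inv, le_div_iff₀ (by positivity)]
    exact h1
  set B := C + C' with hB
  let b : ℕ → ℕ → ℂ := fun n k => a n k - g k
  have hb : ∀ n k, ‖b n k‖ ≤ B * (1 / 2) ^ k := fun n k => by
    rw [hB, add_mul]
    exact (norm_sub_le _ _).trans (add_le_add (ha n k) (hC' k))
  have hB0 : 0 ≤ B := by
    have := (norm_nonneg _).trans (hb 0 0)
    simpa using this
  have hD : ∀ n w, ‖w‖ ≤ 1 → HasSum (fun k => b n k * w ^ k) (f n w - G w) := fun n w hw => by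
    refine ((hf n w hw).sub (hg w)).congr_fun fun k => ?_
    simp only [b]; ring
  -- Vitali's theorem by hand. At a small real s the coefficients below k vanish in the limit by
  -- induction and the tail above k is at most 2B s^(k+1), so after division by s^k the k-th one is
  -- eventually below ε.
  have hcoef : ∀ k, Tendsto (fun n => b n k) atTop (𝓝 0) := by
    intro k
    induction k using Nat.strong_induction_on with
    | _ k ih =>
      rw [Metric.tendsto_atTop]
      intro ε hε
      set s := min (1 / 2) (ε / (4 * (B + 1))) with hs
      have hs0 : 0 < s := by positivity
      have hs1 : s ≤ 1 / 2 := min_le_left _ _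
      have hs2 : s ≤ ε / (4 * (B + 1)) := min_le_right _ _
      have hsn : ‖(s : ℂ)‖ ≤ 1 := by
        rw [Complex.norm_real, Real.norm_eq_abs, abs_of_pos hs0]; linarith
      have hhead : Tendsto (fun n => (f n s - G s) - ∑ j ∈ Finset.range k, b n j * (s : ℂ) ^ j)
          atTop (𝓝 0) := by
        have h1 := (hlim s hs0 (by linarith)).sub_const (G s)
        rw [sub_self] at h1
        have h2 : Tendsto (fun n => ∑ j ∈ Finset.range k, b n j * (s : ℂ) ^ j) atTop (𝓝 0) := by
          have := tendsto_finsetSum (Finset.range k) (f := fun j n => b n j * (s : ℂ) ^ j)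
            (a := fun _ => 0) (x := atTop) fun j hj => by
              have := (ih j (Finset.mem_range.1 hj)).mul_const ((s : ℂ) ^ j)
              rwa [zero_mul] at this
          simpa using this
        simpa using h1.sub h2
      have htail : ∀ n, ‖(f n s - G s) - ∑ j ∈ Finset.range k, b n j * (s : ℂ) ^ j -
          b n k * (s : ℂ) ^ k‖ ≤ 2 * B * s ^ (k + 1) := fun n => by
        have h1 := (hasSum_nat_add_iff' (k + 1)).2 (hD n s hsn)
        rw [Finset.sum_range_succ, ← sub_sub] at h1
        rw [← h1.tsum_eq]
        have hgeo : HasSum (fun j : ℕ => B * s ^ (k + 1) * (1 / 2 : ℝ) ^ j)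
            (B * s ^ (k + 1) * 2) := hasSum_geometric_two.mul_left _
        refine (tsum_of_norm_bounded hgeo fun j => ?_).trans (le_of_eq (by ring))
        rw [norm_mul, norm_pow, Complex.norm_real, Real.norm_eq_abs, abs_of_pos hs0]
        have h2 : (1 / 2 : ℝ) ^ (j + (k + 1)) ≤ 1 := pow_le_one₀ (by norm_num) (by norm_num)
        calc ‖b n (j + (k + 1))‖ * s ^ (j + (k + 1))
            ≤ B * (1 / 2) ^ (j + (k + 1)) * s ^ (j + (k + 1)) := by gcongr; exact hb n _
          _ ≤ B * 1 * s ^ (j + (k + 1)) := by gcongr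
          _ = B * s ^ (k + 1) * s ^ j := by rw [pow_add]; ring
          _ ≤ B * s ^ (k + 1) * (1 / 2) ^ j := by gcongr
      obtain ⟨N, hN⟩ := Metric.tendsto_atTop.1 hhead (ε / 2 * s ^ k) (by positivity)
      refine ⟨N, fun n hn => ?_⟩
      have h1 := hN n hn
      have h2 := htail n
      rw [dist_zero_right] at h1 ⊢
      set R := (f n s - G s) - ∑ j ∈ Finset.range k, b n j * (s : ℂ) ^ j with hR
      have h3 : ‖b n k‖ * s ^ k ≤ ‖R‖ + 2 * B * s ^ (k + 1) := by
        have h4 : ‖b n k * (s : ℂ) ^ k‖ = ‖b n k‖ * s ^ k := by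
          rw [norm_mul, norm_pow, Complex.norm_real, Real.norm_eq_abs, abs_of_pos hs0]
        rw [← h4]
        have h5 := norm_sub_le R (R - b n k * (s : ℂ) ^ k)
        rw [sub_sub_cancel] at h5
        linarith
      have h6 : 2 * B * s ≤ ε / 2 := by
        calc 2 * B * s ≤ 2 * (B + 1) * (ε / (4 * (B + 1))) := by gcongr; linarith
          _ = ε / 2 := by field_simp; ring
      have h7 : ‖b n k‖ * s ^ k < ε * s ^ k := by
        calc ‖b n k‖ * s ^ k ≤ ‖R‖ + 2 * B * s ^ (k + 1) := h3
          _ < ε / 2 * s ^ k + 2 * B * s ^ (k + 1) := by gcongr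
          _ = (ε / 2 + 2 * B * s) * s ^ k := by ring
          _ ≤ (ε / 2 + ε / 2) * s ^ k := by gcongr
          _ = ε * s ^ k := by ring
      exact lt_of_mul_lt_mul_right h7 (by positivity)
  have hsum : Summable fun k : ℕ => B * (1 / 2 : ℝ) ^ k := summable_geometric_two.mul_left _
  have h1 := tendsto_tsum_of_dominated_convergence (𝓕 := atTop) (f := fun n k => b n k * w ^ k)
    (g := fun _ => 0) hsum (fun k => by
      have := (hcoef k).mul_const (w ^ k)
      rwa [zero_mul] at this) (Eventually.of_forall fun n k => by
      rw [norm_mul, norm_pow]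
      exact (mul_le_of_le_one_right (norm_nonneg _) (pow_le_one₀ (norm_nonneg _) hw)).trans (hb n k))
  rw [tsum_zero] at h1
  refine tendsto_sub_nhds_zero_iff.1 (h1.congr fun n => ?_)
  exact (hD n w hw).tsum_eq

/-- The exponential moments of a weighted random variable, as a power series. -/
theorem hasSum_integral_mul_cexp {α : Type*} [MeasurableSpace α] {μ : Measure α}
    {f : α → ℂ} (hf : Measurable f) (hf1 : ∀ x, ‖f x‖ ≤ 1) {X : α → ℝ} (hX : Measurable X)
    (hi : Integrable (fun x => Real.exp (2 * X x) + Real.exp (-(2 * X x))) μ) :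
    (∀ k : ℕ, ‖∫ x, f x * ((X x : ℂ) ^ k / k.factorial) ∂μ‖ ≤
      (∫ x, (Real.exp (2 * X x) + Real.exp (-(2 * X x))) ∂μ) * (1 / 2) ^ k) ∧
    ∀ w : ℂ, ‖w‖ ≤ 1 → HasSum (fun k : ℕ => (∫ x, f x * ((X x : ℂ) ^ k / k.factorial) ∂μ) * w ^ k)
      (∫ x, f x * Complex.exp (w * X x) ∂μ) := by
  -- Moments at ±2 rather than ±1 produce the factor 2^(-k), hence a power series converging beyond
  -- the unit disc.
  have hpt : ∀ (k : ℕ) x, ‖f x * ((X x : ℂ) ^ k / k.factorial)‖ ≤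
      (Real.exp (2 * X x) + Real.exp (-(2 * X x))) * (1 / 2) ^ k := fun k x => by
    have h1 := Real.pow_div_factorial_le_exp |2 * X x| (abs_nonneg _) k
    have h2 : Real.exp |2 * X x| ≤ Real.exp (2 * X x) + Real.exp (-(2 * X x)) := by
      rcases abs_choice (2 * X x) with h | h <;> rw [h] <;>
        linarith [Real.exp_pos (2 * X x), Real.exp_pos (-(2 * X x))]
    rw [norm_mul, norm_div, norm_pow, Complex.norm_real, Complex.norm_natCast, Real.norm_eq_abs]
    calc ‖f x‖ * (|X x| ^ k / k.factorial) ≤ 1 * (|X x| ^ k / k.factorial) := by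
          gcongr; exact hf1 x
      _ = |2 * X x| ^ k / k.factorial * (1 / 2) ^ k := by
          rw [abs_mul, abs_two, mul_pow, one_mul, one_div, inv_pow]; field_simp
      _ ≤ _ := by gcongr; exact h1.trans h2
  have hm : ∀ k : ℕ, AEStronglyMeasurable (fun x => f x * ((X x : ℂ) ^ k / k.factorial)) μ :=
    fun k => (by fun_prop : Measurable fun x => f x * ((X x : ℂ) ^ k / k.factorial)).aestronglyMeasurable
  have hI : ∀ k : ℕ, Integrable (fun x => f x * ((X x : ℂ) ^ k / k.factorial)) μ := fun k =>
    (hi.mul_const ((1 / 2) ^ k)).mono' (hm k) (ae_of_all _ (hpt k))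
  have hN : ∀ k : ℕ, ∫ x, ‖f x * ((X x : ℂ) ^ k / k.factorial)‖ ∂μ ≤
      (∫ x, (Real.exp (2 * X x) + Real.exp (-(2 * X x))) ∂μ) * (1 / 2) ^ k := fun k => by
    rw [← integral_mul_const]
    exact integral_mono (hI k).norm (hi.mul_const _) (hpt k)
  refine ⟨fun k => (norm_integral_le_integral_norm _).trans (hN k), fun w hw => ?_⟩
  have h1 := hasSum_integral_of_summable_integral_norm (μ := μ)
    (F := fun (k : ℕ) x => f x * ((X x : ℂ) ^ k / k.factorial) * w ^ k)
    (fun k => (hI k).mul_const _) (by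
      refine Summable.of_nonneg_of_le (fun k => integral_nonneg fun x => norm_nonneg _) (fun k => ?_)
        (summable_geometric_two.mul_left
          (∫ x, (Real.exp (2 * X x) + Real.exp (-(2 * X x))) ∂μ))
      refine le_trans ?_ (hN k)
      refine integral_mono ((hI k).mul_const _).norm (hI k).norm fun x => ?_
      simp only [norm_mul _ (w ^ k), norm_pow w]
      exact mul_le_of_le_one_right (norm_nonneg _) (pow_le_one₀ (norm_nonneg _) hw))
  convert! h1 using 1
  · funext k
    rw [integral_mul_const]
  · refine integral_congr_ae (ae_of_all _ fun x => ?_)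
    have h2 := (NormedSpace.expSeries_div_hasSum_exp (w * (X x : ℂ))).mul_left (f x)
    rw [← Complex.exp_eq_exp_ℂ] at h2
    simp only
    rw [← h2.tsum_eq]
    refine tsum_congr fun k => ?_
    rw [mul_pow]
    ring

end AnalyticContinuation

/-! ### Lévy's continuity theorem with an unspecified limit. -/

section Levy

variable {E : Type*} [NormedAddCommGroup E] [InnerProductSpace ℝ E] [FiniteDimensional ℝ E]
  [MeasurableSpace E] [BorelSpace E]

/-- A limit of characteristic functions that is continuous at zero is a characteristic function. -/
theorem exists_charFun_eq_of_tendsto {μ : ℕ → Measure E} [hμ : ∀ n, IsProbabilityMeasure (μ n)]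
    {φ : E → ℂ} (hφ : ContinuousAt φ 0)
    (h : ∀ t, Tendsto (fun n => charFun (μ n) t) atTop (𝓝 (φ t))) :
    ∃ M : Measure E, IsProbabilityMeasure M ∧ ∀ t, charFun M t = φ t := by
  have ht := isTightMeasureSet_of_tendsto_charFun hφ h
  let ν : ℕ → ProbabilityMeasure E := fun n => ⟨μ n, hμ n⟩
  have hc : IsCompact (closure (Set.range ν)) := by
    refine isCompact_closure_of_isTightMeasureSet (ht.subset ?_)
    rintro _ ⟨_, ⟨n, rfl⟩, rfl⟩
    exact ⟨n, rfl⟩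
  -- Tightness gives compactness, and a limit along an ultrafilter finer than `atTop` replaces a
  -- convergent subsequence.
  let U : Ultrafilter ℕ := Ultrafilter.of atTop
  have hU : (U : Filter ℕ) ≤ atTop := Ultrafilter.of_le atTop
  obtain ⟨M, -, hM⟩ := hc.ultrafilter_le_nhds (U.map ν) (by
    refine le_principal_iff.2 (mem_of_superset (x := Set.range ν) ?_ subset_closure)
    exact Filter.mem_map.2 (by simp))
  have hM' : Tendsto ν U (𝓝 M) := hM
  refine ⟨M, inferInstance, fun t => ?_⟩
  rw [ProbabilityMeasure.tendsto_iff_forall_integral_rclike_tendsto ℂ] at hM'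
  have h1 := hM' (BoundedContinuousFunction.innerProbChar t)
  simp only [← charFun_eq_integral_innerProbChar] at h1
  exact tendsto_nhds_unique h1 ((h t).mono_left hU)

end Levy

/-! ### Regularity under local asymptotic normality. -/

section Regularity

variable {d : ℕ} {β : ℝ} {A : ∀ n : ℕ, Matrix (Fin n) (Fin n) ℝ} {θ₀ : Vec d}

/-- Under local asymptotic normality, bounded statistics have the same limiting means under a
local alternative as their exponentially tilted versions under `θ₀`. -/
theorem tendsto_integral_localAlt_iff (hLAN : IsLAN β A θ₀) (h : Vec d)
    {f : ∀ n : ℕ, (Fin n → Vec d) → ℂ} (hf : ∀ n, Measurable (f n)) (hf1 : ∀ n x, ‖f n x‖ ≤ 1)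
    (c : ℂ) :
    Tendsto (fun n => ∫ x, f n x ∂(dataLaw (localAlt θ₀ h n) (ising β (A n)))) atTop (𝓝 c) ↔
    Tendsto (fun n => ∫ x, f n x * Complex.exp (inner ℝ h (normScore θ₀ x) : ℝ)
      ∂(dataLaw θ₀ (ising β (A n)))) atTop
      (𝓝 (c * Complex.exp ((infoForm θ₀ h h : ℝ) / 2))) := by
  set P : ∀ n : ℕ, Measure (Fin n → Vec d) := fun n => dataLaw θ₀ (ising β (A n)) with hP
  have hPp : ∀ n, IsProbabilityMeasure (P n) := fun n => by rw [hP]; infer_instance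
  set J := infoForm θ₀ h h with hJ
  let l : ∀ n : ℕ, (Fin n → Vec d) → ℝ := fun n x => isingLLR β (A n) θ₀ (localAlt θ₀ h n) x
  let q : ∀ n : ℕ, (Fin n → Vec d) → ℝ := fun n x => inner ℝ h (normScore θ₀ x) - J / 2
  have hl : ∀ n, Measurable (l n) := fun n => (continuous_isingLLR _ _ _ _).measurable
  have hq : ∀ n, Measurable (q n) := fun n =>
    (by fun_prop : Continuous fun x : Fin n → Vec d =>
      inner ℝ h (normScore θ₀ x) - J / 2).measurable
  have hli : ∀ n, Integrable (fun x => Real.exp (l n x)) (P n) := fun n =>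
    integrable_exp_isingLLR _ _ _ _
  have hqe : ∀ n x, Real.exp (q n x) =
      Real.exp (inner ℝ h (normScore θ₀ x)) * Real.exp (-(J / 2)) := fun n x => by
    rw [← Real.exp_add]; rfl
  have hqi : ∀ n, Integrable (fun x => Real.exp (q n x)) (P n) := fun n => by
    simp only [hqe]
    exact (integrable_exp_inner_normScore θ₀ h _).mul_const _
  have hq1 : Tendsto (fun n => ∫ x, Real.exp (q n x) ∂(P n)) atTop (𝓝 1) := by
    have := (tendsto_integral_exp_inner_normScore θ₀ h fun n => ising β (A n)).mul_const
      (Real.exp (-(J / 2)))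
    rw [← Real.exp_add, add_neg_cancel, Real.exp_zero] at this
    refine this.congr fun n => ?_
    simp only [hqe]
    rw [integral_mul_const]
  have hqe2 : ∀ n x, Real.exp (q n x) ^ 2 =
      Real.exp (inner ℝ ((2 : ℝ) • h) (normScore θ₀ x)) * Real.exp (-J) := fun n x => by
    rw [← Real.exp_nat_mul, ← Real.exp_add, real_inner_smul_left]
    congr 1
    simp only [q]; push_cast; ring
  obtain ⟨K, hK⟩ := exists_bound_integral_exp θ₀ ((2 : ℝ) • h) fun n => ising β (A n)
  have hL1 := tendsto_integral_abs_exp_sub hl hq hli (fun n => integral_exp_isingLLR _ _ _ _)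
    hqi hq1 (fun n => by
      simp only [hqe2]; exact (integrable_exp_inner_normScore θ₀ _ _).mul_const _)
    (K := K * Real.exp (-J)) (fun n => by
      simp only [hqe2]; rw [integral_mul_const]
      exact mul_le_mul_of_nonneg_right (hK n) (Real.exp_pos _).le) (hLAN h)
  have hfm : ∀ n, AEStronglyMeasurable (f n) (P n) := fun n => (hf n).aestronglyMeasurable
  have hfl : ∀ n, Integrable (fun x => f n x * (Real.exp (l n x) : ℂ)) (P n) := fun n =>
    (hli n).ofReal.bdd_mul (c := 1) (hfm n) (ae_of_all _ (hf1 n))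
  have hfq : ∀ n, Integrable (fun x => f n x * (Real.exp (q n x) : ℂ)) (P n) := fun n =>
    (hqi n).ofReal.bdd_mul (c := 1) (hfm n) (ae_of_all _ (hf1 n))
  -- Statistics of modulus at most 1 see at most the L¹ distance between the likelihood ratio and
  -- its quadratic approximation.
  have hdiff : Tendsto (fun n => ∫ x, f n x ∂(dataLaw (localAlt θ₀ h n) (ising β (A n))) -
      (∫ x, f n x * Complex.exp (inner ℝ h (normScore θ₀ x) : ℝ) ∂(P n)) *
        Complex.exp (-((J : ℝ) / 2))) atTop (𝓝 0) := by
    refine squeeze_zero_norm (fun n => ?_) hL1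
    rw [integral_dataLaw_ising β (A n) θ₀, ← integral_mul_const]
    have e1 : ∫ x, Real.exp (isingLLR β (A n) θ₀ (localAlt θ₀ h n) x) • f n x ∂(P n) =
        ∫ x, f n x * (Real.exp (l n x) : ℂ) ∂(P n) :=
      integral_congr_ae (ae_of_all _ fun x => by
        simp only [Complex.real_smul, l]; rw [mul_comm])
    have e2 : ∫ x, f n x * Complex.exp (inner ℝ h (normScore θ₀ x) : ℝ) *
        Complex.exp (-((J : ℝ) / 2)) ∂(P n) = ∫ x, f n x * (Real.exp (q n x) : ℂ) ∂(P n) :=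
      integral_congr_ae (ae_of_all _ fun x => by
        simp only [hqe]; push_cast; ring)
    rw [e1, e2, ← integral_sub (hfl n) (hfq n)]
    refine (norm_integral_le_integral_norm _).trans ?_
    refine integral_mono ((hfl n).sub (hfq n)).norm ((hli n).sub (hqi n)).abs fun x => ?_
    simp only
    rw [← mul_sub, norm_mul, ← Complex.ofReal_sub, Complex.norm_real, Real.norm_eq_abs]
    exact mul_le_of_le_one_left (abs_nonneg _) (hf1 n x)
  have hc : Complex.exp ((J : ℝ) / 2) * Complex.exp (-((J : ℝ) / 2)) = 1 := by
    rw [← Complex.exp_add, add_neg_cancel, Complex.exp_zero]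
  constructor
  · intro h1
    have h2 := (h1.sub hdiff).mul_const (Complex.exp ((J : ℝ) / 2))
    rw [sub_zero] at h2
    refine h2.congr fun n => ?_
    rw [sub_sub_cancel, mul_assoc, mul_comm (Complex.exp _), hc, mul_one]
  · intro h1
    have h2 := hdiff.add (h1.mul_const (Complex.exp (-((J : ℝ) / 2))))
    rw [zero_add, mul_assoc, hc, mul_one] at h2
    exact h2.congr fun n => sub_add_cancel _ _

/-- Regularity in terms of characteristic functions under the local alternatives. -/
theorem isRegularEst_iff {Q : ∀ n, PMF (Labels n)} {T : ∀ n : ℕ, (Fin n → Vec d) → Vec d}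
    (hT : ∀ n, Measurable (T n)) {L : Measure (Vec d)} [IsProbabilityMeasure L] :
    IsRegularEst Q θ₀ T L ↔ ∀ h t : Vec d, Tendsto (fun n : ℕ =>
      ∫ x, Complex.exp ((inner ℝ (√(n : ℝ) • (T n x - θ₀)) t : ℝ) * Complex.I)
        ∂(dataLaw (localAlt θ₀ h n) (Q n))) atTop
      (𝓝 (charFun L t * Complex.exp ((inner ℝ h t : ℝ) * Complex.I))) := by
  have hm : ∀ (h : Vec d) (n : ℕ),
      Measurable fun x : Fin n → Vec d => √(n : ℝ) • (T n x - localAlt θ₀ h n) := fun h n =>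
    (continuous_const_smul (√(n : ℝ))).measurable.comp ((hT n).sub_const (localAlt θ₀ h n))
  have key : ∀ h t : Vec d, (∀ᶠ n : ℕ in atTop,
      charFun ((dataLaw (localAlt θ₀ h n) (Q n)).map fun x =>
        √(n : ℝ) • (T n x - localAlt θ₀ h n)) t =
      (∫ x, Complex.exp ((inner ℝ (√(n : ℝ) • (T n x - θ₀)) t : ℝ) * Complex.I)
        ∂(dataLaw (localAlt θ₀ h n) (Q n))) * Complex.exp (-((inner ℝ h t : ℝ) * Complex.I))) := by
    intro h t
    -- At n = 0 the factor 1/√n is 0, and √n · (1/√n) = 1 fails.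
    filter_upwards [eventually_ge_atTop 1] with n hn
    have hs : √(n : ℝ) * (1 / √(n : ℝ)) = 1 :=
      mul_one_div_cancel (Real.sqrt_pos.2 (by exact_mod_cast hn)).ne'
    rw [charFun_apply, integral_map (hm h n).aemeasurable
      (by fun_prop : Continuous fun x : Vec d =>
        Complex.exp ((inner ℝ x t : ℝ) * Complex.I)).aestronglyMeasurable, ← integral_mul_const]
    refine integral_congr_ae (ae_of_all _ fun x => ?_)
    simp only
    rw [← Complex.exp_add]
    congr 1
    rw [localAlt, ← sub_sub, smul_sub _ _ ((1 / √(n : ℝ)) • h), smul_smul, hs, one_smul,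
      inner_sub_left]
    push_cast; ring
  have hc : ∀ h t : Vec d, Complex.exp (-((inner ℝ h t : ℝ) * Complex.I)) *
      Complex.exp ((inner ℝ h t : ℝ) * Complex.I) = 1 := fun h t => by
    rw [← Complex.exp_add, neg_add_cancel, Complex.exp_zero]
  have hL : L.map id = L := Measure.map_id
  constructor
  · intro hreg h t
    have h1 := ProbabilityMeasure.tendsto_iff_tendsto_charFun.1 (hreg h).tendsto t
    have h2 := (h1.congr' (key h t)).mul_const (Complex.exp ((inner ℝ h t : ℝ) * Complex.I))
    simp only [mul_assoc, hc, mul_one, ProbabilityMeasure.coe_mk, hL] at h2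
    exact h2
  · intro hreg h
    refine ⟨fun n => (hm h n).aemeasurable, aemeasurable_id, ?_⟩
    refine ProbabilityMeasure.tendsto_iff_tendsto_charFun.2 fun t => ?_
    simp only [ProbabilityMeasure.coe_mk, hL]
    have h2 := (hreg h t).mul_const (Complex.exp (-((inner ℝ h t : ℝ) * Complex.I)))
    rw [mul_assoc, mul_comm (Complex.exp _), hc, mul_one] at h2
    exact h2.congr' ((key h t).mono fun n hn => hn.symm)

theorem measurable_cexp_inner {n : ℕ} {T : (Fin n → Vec d) → Vec d} (hT : Measurable T)
    (c : ℝ) (t : Vec d) : Measurable fun x : Fin n → Vec d =>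
      Complex.exp ((inner ℝ (c • (T x - θ₀)) t : ℝ) * Complex.I) :=
  (by fun_prop : Continuous fun y : Vec d =>
    Complex.exp ((inner ℝ (c • (y - θ₀)) t : ℝ) * Complex.I)).measurable.comp hT

/-- Regularity in terms of tilted characteristic functions under `θ₀`. -/
theorem isRegularEst_iff_of_isLAN (hLAN : IsLAN β A θ₀) {T : ∀ n : ℕ, (Fin n → Vec d) → Vec d}
    (hT : ∀ n, Measurable (T n)) {L : Measure (Vec d)} [IsProbabilityMeasure L] :
    IsRegularEst (fun n => ising β (A n)) θ₀ T L ↔ ∀ h t : Vec d, Tendsto (fun n : ℕ =>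
      ∫ x, Complex.exp ((inner ℝ (√(n : ℝ) • (T n x - θ₀)) t : ℝ) * Complex.I) *
        Complex.exp (inner ℝ h (normScore θ₀ x) : ℝ) ∂(dataLaw θ₀ (ising β (A n)))) atTop
      (𝓝 (charFun L t * Complex.exp ((inner ℝ h t : ℝ) * Complex.I) *
        Complex.exp ((infoForm θ₀ h h : ℝ) / 2))) := by
  rw [isRegularEst_iff hT]
  refine forall₂_congr fun h t => ?_
  exact tendsto_integral_localAlt_iff hLAN h (fun n => measurable_cexp_inner (hT n) _ t)
    (fun n x => (Complex.norm_exp_ofReal_mul_I _).le) _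

theorem infoForm_invInfoOp (hθ : θ₀ ≠ 0) (h t : Vec d) :
    infoForm θ₀ h (invInfoOp θ₀ t) = inner ℝ h t := by
  rw [← inner_infoOp, infoOp_invInfoOp hθ]

theorem inner_invInfoOp_comm (hθ : θ₀ ≠ 0) (a t : Vec d) :
    inner ℝ (invInfoOp θ₀ a) t = inner ℝ (invInfoOp θ₀ t) a := by
  rw [← infoForm_invInfoOp hθ, infoForm_comm, infoForm_invInfoOp hθ]

theorem dotProduct_inv_infoMatrix (t : Vec d) :
    t.ofLp ⬝ᵥ (infoMatrix θ₀)⁻¹ *ᵥ t.ofLp = inner ℝ (invInfoOp θ₀ t) t := by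
  rw [EuclideanSpace.inner_eq_star_dotProduct]
  simp [invInfoOp]

theorem charFun_gaussian_inv_infoMatrix (hθ : θ₀ ≠ 0) (t : Vec d) :
    charFun (multivariateGaussian (0 : Vec d) (infoMatrix θ₀)⁻¹) t =
      Complex.exp (-((inner ℝ (invInfoOp θ₀ t) t : ℝ) / 2)) := by
  rw [charFun_multivariateGaussian (infoMatrix_posDef hθ).inv.posSemidef,
    dotProduct_inv_infoMatrix, inner_zero_right]
  simp

theorem TendstoZeroInProb.of_le_mul {Ω : ℕ → Type*} [∀ n, MeasurableSpace (Ω n)]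
    {P : ∀ n, Measure (Ω n)} {F G : Type*} [Norm F] [Norm G]
    {f : ∀ n, Ω n → F} {g : ∀ n, Ω n → G} (hf : TendstoZeroInProb P f) {C : ℝ} (hC : 0 < C)
    (h : ∀ n x, ‖g n x‖ ≤ C * ‖f n x‖) : TendstoZeroInProb P g := fun ε hε =>
  tendsto_of_tendsto_of_tendsto_of_le_of_le tendsto_const_nhds (hf (ε / C) (by positivity))
    (fun _ => zero_le) fun n => measure_mono fun x hx =>
      (div_le_iff₀' hC).2 (le_trans hx (h n x))

theorem norm_cexp_sub_cexp_le (a b : ℝ) :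
    ‖Complex.exp (a * Complex.I) - Complex.exp (b * Complex.I)‖ ≤ |a - b| := by
  have e : Complex.exp (a * Complex.I) - Complex.exp (b * Complex.I) =
      Complex.exp (b * Complex.I) * (Complex.exp (Complex.I * ((a - b : ℝ) : ℂ)) - 1) := by
    rw [mul_sub, ← Complex.exp_add, mul_one]
    congr 2
    push_cast; ring
  rw [e, norm_mul, Complex.norm_exp_ofReal_mul_I, one_mul]
  exact Real.norm_exp_I_mul_ofReal_sub_one_le

/-- An asymptotically linear estimator with the efficient influence function is regular. -/
theorem isRegularEst_of_asymptoticallyLinear (hLAN : IsLAN β A θ₀) (hθ : θ₀ ≠ 0)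
    {T : ∀ n : ℕ, (Fin n → Vec d) → Vec d} (hT : ∀ n, Measurable (T n))
    (hlin : TendstoZeroInProb (fun n => dataLaw θ₀ (ising β (A n))) fun (n : ℕ) x =>
      √(n : ℝ) • (T n x - θ₀) - invInfoOp θ₀ (normScore θ₀ x)) :
    IsRegularEst (fun n => ising β (A n)) θ₀ T (multivariateGaussian 0 (infoMatrix θ₀)⁻¹) := by
  rw [isRegularEst_iff_of_isLAN hLAN hT]
  intro h t
  -- With this v, symmetry gives ⟪I⁻¹Δ, t⟫ = ⟪v, Δ⟫, while I(v,v) = ⟪v, t⟫ and I(h,v) = ⟪h, t⟫. The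
  -- score limit is then exactly the regularity limit.
  set v := invInfoOp θ₀ t with hv
  have hlim := tendsto_integral_cexp_normScore θ₀ h v fun n => ising β (A n)
  have e1 : infoForm θ₀ v v = inner ℝ v t := infoForm_invInfoOp hθ v t
  have e2 : infoForm θ₀ h v = inner ℝ h t := infoForm_invInfoOp hθ h t
  let f : ∀ n : ℕ, (Fin n → Vec d) → ℂ := fun n x =>
    Complex.exp ((inner ℝ (√(n : ℝ) • (T n x - θ₀)) t : ℝ) * Complex.I)
  let f' : ∀ n : ℕ, (Fin n → Vec d) → ℂ := fun n x =>
    Complex.exp ((inner ℝ v (normScore θ₀ x) : ℝ) * Complex.I)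
  have hfm : ∀ n, Measurable (f n) := fun n => measurable_cexp_inner (hT n) _ t
  have hfm' : ∀ n, Measurable (f' n) := fun n =>
    (by fun_prop : Continuous fun x : Fin n → Vec d =>
      Complex.exp ((inner ℝ v (normScore θ₀ x) : ℝ) * Complex.I)).measurable
  have hf1 : ∀ n x, ‖f n x‖ ≤ 1 := fun n x => (Complex.norm_exp_ofReal_mul_I _).le
  have hf1' : ∀ n x, ‖f' n x‖ ≤ 1 := fun n x => (Complex.norm_exp_ofReal_mul_I _).le
  have hprob : TendstoZeroInProb (fun n => dataLaw θ₀ (ising β (A n)))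
      fun n x => ‖f n x - f' n x‖ := by
    refine hlin.of_le_mul (C := ‖t‖ + 1) (by positivity) fun n x => ?_
    rw [norm_norm]
    refine (norm_cexp_sub_cexp_le _ _).trans ?_
    rw [hv, inner_invInfoOp_comm hθ t, ← inner_sub_left]
    refine (abs_real_inner_le_norm _ _).trans ?_
    rw [mul_comm]
    gcongr
    linarith
  obtain ⟨K, hK⟩ := exists_bound_integral_exp θ₀ ((2 : ℝ) • h) fun n => ising β (A n)
  have hsq : ∀ (n : ℕ) (x : Fin n → Vec d), Real.exp (inner ℝ h (normScore θ₀ x)) ^ 2 =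
      Real.exp (inner ℝ ((2 : ℝ) • h) (normScore θ₀ x)) := fun n x => by
    rw [← Real.exp_nat_mul, real_inner_smul_left]; norm_num
  have h0 := tendsto_integral_abs_mul_of_inProb (fun n => ((hfm n).sub (hfm' n)).norm) (C := 2)
    (fun n x => by
      rw [abs_norm]
      exact (norm_sub_le _ _).trans (by linarith [hf1 n x, hf1' n x])) hprob
    (b := fun n x => Real.exp (inner ℝ h (normScore θ₀ x))) (fun n x => (Real.exp_pos _).le)
    (fun n => by simp only [hsq]; exact integrable_exp_inner_normScore θ₀ _ _) (K := K)
    (fun n => by simp only [hsq]; exact hK n)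
  have hie : ∀ n, Integrable (fun x => (Real.exp (inner ℝ h (normScore θ₀ x)) : ℂ))
      (dataLaw θ₀ (ising β (A n))) := fun n => (integrable_exp_inner_normScore θ₀ h _).ofReal
  have hdiff : Tendsto (fun n => ∫ x, f n x * (Real.exp (inner ℝ h (normScore θ₀ x)) : ℂ)
      ∂(dataLaw θ₀ (ising β (A n))) - ∫ x, f' n x * (Real.exp (inner ℝ h (normScore θ₀ x)) : ℂ)
      ∂(dataLaw θ₀ (ising β (A n)))) atTop (𝓝 0) := by
    refine squeeze_zero_norm (fun n => ?_) h0
    rw [← integral_sub ((hie n).bdd_mul (c := 1) (hfm n).aestronglyMeasurable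
        (ae_of_all _ (hf1 n))) ((hie n).bdd_mul (c := 1) (hfm' n).aestronglyMeasurable
        (ae_of_all _ (hf1' n)))]
    refine (norm_integral_le_integral_norm _).trans (le_of_eq ?_)
    refine integral_congr_ae (ae_of_all _ fun x => ?_)
    simp only
    rw [← sub_mul, norm_mul, Complex.norm_real, Real.norm_eq_abs, Real.abs_exp, abs_norm]
    rfl
  have hsum := hdiff.add hlim
  rw [zero_add] at hsum
  convert hsum using 1
  · funext n
    have e3 : ∫ x, f' n x * (Real.exp (inner ℝ h (normScore θ₀ x)) : ℂ)
        ∂(dataLaw θ₀ (ising β (A n))) = ∫ x, Complex.exp ((inner ℝ h (normScore θ₀ x) : ℝ) +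
        (inner ℝ v (normScore θ₀ x) : ℝ) * Complex.I) ∂(dataLaw θ₀ (ising β (A n))) :=
      integral_congr_ae (ae_of_all _ fun x => by
        simp only [f']
        rw [Complex.exp_add, Complex.ofReal_exp, mul_comm])
    rw [e3, sub_add_cancel]
    simp only [f, Complex.ofReal_exp]
  · rw [charFun_gaussian_inv_infoMatrix hθ, e1, e2, ← Complex.exp_add, ← Complex.exp_add]
    congr 2
    push_cast; ring

end Regularity

/-! ### The convolution theorem. -/

section Convolution

variable {d : ℕ} {β : ℝ} {A : ∀ n : ℕ, Matrix (Fin n) (Fin n) ℝ} {θ₀ : Vec d}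

/-- The convolution theorem under local asymptotic normality. -/
theorem exists_conv_of_isRegularEst (hLAN : IsLAN β A θ₀) (hθ : θ₀ ≠ 0)
    {T : ∀ n : ℕ, (Fin n → Vec d) → Vec d} (hT : ∀ n, Measurable (T n))
    {L : Measure (Vec d)} [IsProbabilityMeasure L]
    (hreg : IsRegularEst (fun n => ising β (A n)) θ₀ T L) :
    ∃ M : Measure (Vec d), IsProbabilityMeasure M ∧
      L = Measure.conv (multivariateGaussian 0 (infoMatrix θ₀)⁻¹) M := by
  rw [isRegularEst_iff_of_isLAN hLAN hT] at hreg
  let P : ∀ n : ℕ, Measure (Fin n → Vec d) := fun n => dataLaw θ₀ (ising β (A n))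
  let D : ∀ n : ℕ, (Fin n → Vec d) → Vec d := fun n x =>
    √(n : ℝ) • (T n x - θ₀) - invInfoOp θ₀ (normScore θ₀ x)
  have hD : ∀ n, Measurable (D n) := fun n =>
    ((continuous_const_smul (√(n : ℝ))).measurable.comp ((hT n).sub_const θ₀)).sub
      ((invInfoOp θ₀).continuous.comp (continuous_normScore θ₀)).measurable
  have hlim : ∀ t : Vec d, Tendsto (fun n => charFun ((P n).map (D n)) t) atTop
      (𝓝 (charFun L t * Complex.exp ((inner ℝ (invInfoOp θ₀ t) t : ℝ) / 2))) := by
    intro t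
    set v := invInfoOp θ₀ t with hv
    set q : ℝ := inner ℝ v t with hq
    let f : ∀ n : ℕ, (Fin n → Vec d) → ℂ := fun n x =>
      Complex.exp ((inner ℝ (√(n : ℝ) • (T n x - θ₀)) t : ℝ) * Complex.I)
    have hfm : ∀ n, Measurable (f n) := fun n => measurable_cexp_inner (hT n) _ t
    have hf1 : ∀ n x, ‖f n x‖ ≤ 1 := fun n x => (Complex.norm_exp_ofReal_mul_I _).le
    obtain ⟨K₁, hK₁⟩ := exists_bound_integral_exp θ₀ ((2 : ℝ) • v) fun n => ising β (A n)
    obtain ⟨K₂, hK₂⟩ := exists_bound_integral_exp θ₀ (-((2 : ℝ) • v)) fun n => ising β (A n)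
    have hi₁ := fun n : ℕ => integrable_exp_inner_normScore θ₀ ((2 : ℝ) • v) (ising β (A n))
    have hi₂ := fun n : ℕ => integrable_exp_inner_normScore θ₀ (-((2 : ℝ) • v)) (ising β (A n))
    simp only [inner_neg_left, real_inner_smul_left] at hK₁ hK₂ hi₁ hi₂
    have hX : ∀ n, Measurable fun x : Fin n → Vec d => (inner ℝ v (normScore θ₀ x) : ℝ) := fun n =>
      (by fun_prop : Continuous fun x : Fin n → Vec d => (inner ℝ v (normScore θ₀ x) : ℝ)).measurable
    have hps := fun n : ℕ => hasSum_integral_mul_cexp (μ := P n) (hfm n) (hf1 n) (hX n)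
      ((hi₁ n).add (hi₂ n))
    have hbd : ∀ n : ℕ, ∫ x, (Real.exp (2 * inner ℝ v (normScore θ₀ x)) +
        Real.exp (-(2 * inner ℝ v (normScore θ₀ x)))) ∂(P n) ≤ K₁ + K₂ := fun n => by
      rw [integral_add (hi₁ n) (hi₂ n)]
      exact add_le_add (hK₁ n) (hK₂ n)
    -- The tilt runs along h = wv. Regularity gives the limit for real w in (0, 1); at w = -i the
    -- tilt becomes exp(-i⟪v, Δ_n⟫), which subtracts I⁻¹Δ_n inside the characteristic function. The
    -- limiting exponent there is q - q/2 = q/2.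
    have h1 := tendsto_of_tendsto_on_reals (C := K₁ + K₂)
      (G := fun w : ℂ => charFun L t * Complex.exp (w * q * Complex.I) *
        Complex.exp (w ^ 2 * q / 2)) (by fun_prop)
      (fun n k => ((hps n).1 k).trans (by gcongr; exact hbd n)) (fun n => (hps n).2)
      (fun s _ _ => by
        have h2 := hreg (s • v) t
        rw [← inner_infoOp, map_smul, real_inner_smul_left, real_inner_smul_left,
          real_inner_smul_right, inner_infoOp, infoForm_invInfoOp hθ v t] at h2
        convert h2 using 1
        · funext n
          refine integral_congr_ae (ae_of_all _ fun x => ?_)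
          simp only [f, real_inner_smul_left]
          push_cast; rfl
        · congr 3
          · rw [← hq]; push_cast; ring
          · rw [← hq]; push_cast; ring)
      (w := -Complex.I) (by simp)
    convert h1 using 1
    · funext n
      rw [charFun_apply, integral_map (hD n).aemeasurable
        (by fun_prop : Continuous fun x : Vec d =>
          Complex.exp ((inner ℝ x t : ℝ) * Complex.I)).aestronglyMeasurable]
      refine integral_congr_ae (ae_of_all _ fun x => ?_)
      simp only [f, D]
      rw [← Complex.exp_add, inner_sub_left, inner_invInfoOp_comm hθ]
      congr 1
      push_cast; ring
    · rw [mul_assoc, ← Complex.exp_add]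
      congr 3
      rw [neg_sq, Complex.I_sq]
      linear_combination (q : ℂ) * Complex.I_mul_I
  have hφ : Continuous fun t : Vec d =>
      charFun L t * Complex.exp ((inner ℝ (invInfoOp θ₀ t) t : ℝ) / 2) := by
    have := continuous_charFun (μ := L)
    fun_prop
  have hp : ∀ n, IsProbabilityMeasure ((P n).map (D n)) := fun n =>
    Measure.isProbabilityMeasure_map (hD n).aemeasurable
  obtain ⟨M, hM, hMφ⟩ := exists_charFun_eq_of_tendsto hφ.continuousAt hlim
  refine ⟨M, hM, Measure.ext_of_charFun (funext fun t => ?_)⟩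
  rw [charFun_conv, hMφ, charFun_gaussian_inv_infoMatrix hθ, mul_left_comm, ← Complex.exp_add,
    neg_add_cancel, Complex.exp_zero, mul_one]

end Convolution

/-! ### Covariance of a convolution. -/

section Covariance

variable {d : ℕ}

theorem memLp_coord {L : Measure (Vec d)} (hL : MemLp id 2 L) (i : Fin d) :
    MemLp (fun y : Vec d => y i) 2 L :=
  hL.continuousLinearMap_comp (EuclideanSpace.proj i : Vec d →L[ℝ] ℝ)

theorem covMat_posSemidef {M : Measure (Vec d)} [IsProbabilityMeasure M] (hM : MemLp id 2 M) :
    (covMat M).PosSemidef := by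
  refine Matrix.PosSemidef.of_dotProduct_mulVec_nonneg ?_ fun a => ?_
  · ext i j
    simp only [Matrix.conjTranspose_apply, covMat, Matrix.of_apply, star_trivial]
    exact covariance_comm _ _
  · have hX : ∀ i, MemLp (fun y : Vec d => a i * y i) 2 M := fun i =>
      (memLp_coord hM i).const_mul (a i)
    have h1 := covariance_fun_sum_fun_sum hX hX
    have h2 : 0 ≤ cov[fun y : Vec d => ∑ i, a i * y i, fun y : Vec d => ∑ i, a i * y i; M] := by
      rw [covariance_self (memLp_finsetSum _ fun i _ => hX i).aestronglyMeasurable.aemeasurable]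
      exact variance_nonneg _ _
    rw [h1] at h2
    refine h2.trans (le_of_eq ?_)
    simp only [dotProduct, Matrix.mulVec, covMat, Matrix.of_apply, Finset.mul_sum, star_trivial,
      Pi.star_apply, covariance_const_mul_left, covariance_const_mul_right]
    refine Finset.sum_congr rfl fun i _ => Finset.sum_congr rfl fun j _ => ?_
    ring

theorem covMat_conv {N M : Measure (Vec d)} [IsProbabilityMeasure N] [IsProbabilityMeasure M]
    (hN : MemLp id 2 N) (hM : MemLp id 2 M) : covMat (Measure.conv N M) = covMat N + covMat M := by
  have hfst : ∀ i, MemLp (fun p : Vec d × Vec d => p.1 i) 2 (N.prod M) := fun i =>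
    (memLp_coord hN i).comp_fst M
  have hsnd : ∀ i, MemLp (fun p : Vec d × Vec d => p.2 i) 2 (N.prod M) := fun i =>
    (memLp_coord hM i).comp_snd N
  have hmi : ∀ i : Fin d, Measurable fun y : Vec d => y i := fun i => by fun_prop
  ext i j
  simp only [covMat, Matrix.of_apply, Matrix.add_apply]
  have h1 : cov[fun y : Vec d => y i, fun y => y j; Measure.conv N M] =
      cov[fun p : Vec d × Vec d => (p.1 + p.2) i, fun p => (p.1 + p.2) j; N.prod M] :=
    covariance_map (hmi i).aestronglyMeasurable (hmi j).aestronglyMeasurable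
      (by fun_prop : Measurable fun p : Vec d × Vec d => p.1 + p.2).aemeasurable
  have e : ∀ i, (fun p : Vec d × Vec d => (p.1 + p.2) i) =
      (fun p => p.1 i) + fun p => p.2 i := fun i => rfl
  have hind : ∀ i j, cov[fun p : Vec d × Vec d => p.1 i, fun p => p.2 j; N.prod M] = 0 :=
    fun i j => (indepFun_prod (hmi i) (hmi j)).covariance_eq_zero (hfst i) (hsnd j)
  rw [h1, e, e, covariance_add_left (hfst i) (hsnd i) ((hfst j).add (hsnd j)),
    covariance_add_right (hfst i) (hfst j) (hsnd j), covariance_add_right (hsnd i) (hfst j) (hsnd j),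
    hind, covariance_comm (fun p : Vec d × Vec d => p.2 i), hind, add_zero, zero_add]
  congr 1
  · have := covariance_map (μ := N.prod M) (Z := Prod.fst) (hmi i).aestronglyMeasurable
      (hmi j).aestronglyMeasurable measurable_fst.aemeasurable
    rw [Measure.map_fst_prod, measure_univ, one_smul] at this
    exact this.symm
  · have := covariance_map (μ := N.prod M) (Z := Prod.snd) (hmi i).aestronglyMeasurable
      (hmi j).aestronglyMeasurable measurable_snd.aemeasurable
    rw [Measure.map_snd_prod, measure_univ, one_smul] at this
    exact this.symm

/-- On the product space the second coordinate is the sum minus the first coordinate, and both of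
these are square integrable. -/
theorem memLp_right_of_conv {N M : Measure (Vec d)} [IsProbabilityMeasure N]
    [IsProbabilityMeasure M] (hN : MemLp id 2 N) (h : MemLp id 2 (Measure.conv N M)) :
    MemLp id 2 M := by
  have h1 : MemLp (fun p : Vec d × Vec d => p.1 + p.2) 2 (N.prod M) :=
    h.comp_of_map (f := fun p : Vec d × Vec d => p.1 + p.2) (by fun_prop)
  have h2 : MemLp (fun p : Vec d × Vec d => p.2) 2 (N.prod M) := by
    have := h1.sub (hN.comp_fst M)
    refine this.congr_norm (by fun_prop) (ae_of_all _ fun p => ?_)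
    simp
  have h3 := (memLp_map_measure_iff (μ := N.prod M) (f := Prod.snd) (g := (id : Vec d → Vec d))
    aestronglyMeasurable_id measurable_snd.aemeasurable).2 h2
  rwa [Measure.map_snd_prod, measure_univ, one_smul] at h3

theorem covMat_gaussian {V : Matrix (Fin d) (Fin d) ℝ} (hV : V.PosSemidef) :
    covMat (multivariateGaussian (0 : Vec d) V) = V := by
  ext i j
  exact covariance_eval_multivariateGaussian hV i j

theorem covMat_sub_posSemidef_of_conv {V : Matrix (Fin d) (Fin d) ℝ} (hV : V.PosSemidef)
    {M : Measure (Vec d)} [IsProbabilityMeasure M]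
    (h : MemLp id 2 (Measure.conv (multivariateGaussian (0 : Vec d) V) M)) :
    (covMat (Measure.conv (multivariateGaussian (0 : Vec d) V) M) - V).PosSemidef := by
  have hN : MemLp id 2 (multivariateGaussian (0 : Vec d) V) := IsGaussian.memLp_two_id
  have hM := memLp_right_of_conv hN h
  rw [covMat_conv hN hM, covMat_gaussian hV, add_sub_cancel_left]
  exact covMat_posSemidef hM

end Covariance

theorem isEfficiencyBound_of_isLAN {d : ℕ} {β : ℝ} {A : ∀ n : ℕ, Matrix (Fin n) (Fin n) ℝ}
    {θ₀ : Vec d} (hLAN : IsLAN β A θ₀) (hθ : θ₀ ≠ 0) :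
    IsEfficiencyBound (fun n => ising β (A n)) θ₀ (infoMatrix θ₀)⁻¹ := by
  intro T hT L hL hreg
  obtain ⟨M, hM, hconv⟩ := exists_conv_of_isRegularEst hLAN hθ hT hreg
  refine ⟨⟨M, hM, hconv⟩, fun hL2 => ?_⟩
  rw [hconv] at hL2 ⊢
  exact covMat_sub_posSemidef_of_conv (infoMatrix_posDef hθ).inv.posSemidef hL2

end HiddenIsing

end

theorem corollary1 (d : ℕ) (β : ℝ) (hβ : 0 ≤ β)
    (A : ∀ n : ℕ, Matrix (Fin n) (Fin n) ℝ) (hA : ∀ n, IsCoupling (A n))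
    (θ₀ : Vec d) (hθ₀ : θ₀ ∈ interior (ThetaOne d))
    (hunif : UniformExpansion β A θ₀)
    (θhat : ∀ n : ℕ, (Fin n → Vec d) → Vec d) (hθhat : IsIIDEstimator θhat) :
    (infoMatrix θ₀).PosDef ∧
    (IsRegularEst (fun n => ising β (A n)) θ₀ θhat (multivariateGaussian 0 (infoMatrix θ₀)⁻¹) ∧
      IsEfficiencyBound (fun n => ising β (A n)) θ₀ (infoMatrix θ₀)⁻¹) ∧
    (IsRegularEst iidLabels θ₀ θhat (multivariateGaussian 0 (infoMatrix θ₀)⁻¹) ∧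
      IsEfficiencyBound iidLabels θ₀ (infoMatrix θ₀)⁻¹) := by
  have hθ : θ₀ ≠ 0 := ne_zero_of_mem_thetaOne (interior_subset hθ₀)
  -- Local asymptotic normality is the only input depending on the label law, so one argument serves
  -- the given couplings and the uncoupled model.
  have key : ∀ {b : ℝ} {B : ∀ n : ℕ, Matrix (Fin n) (Fin n) ℝ}, IsLAN b B θ₀ →
      IsRegularEst (fun n => ising b (B n)) θ₀ θhat (multivariateGaussian 0 (infoMatrix θ₀)⁻¹) ∧
        IsEfficiencyBound (fun n => ising b (B n)) θ₀ (infoMatrix θ₀)⁻¹ := fun hLAN =>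
    ⟨isRegularEst_of_asymptoticallyLinear hLAN hθ hθhat.measurable
      (tendstoZeroInProb_estimator_sub hθ₀ hθhat _), isEfficiencyBound_of_isLAN hLAN hθ⟩
  rw [show iidLabels = fun n => ising 0 (0 : Matrix (Fin n) (Fin n) ℝ) from
    funext iidLabels_eq_ising]
  exact ⟨infoMatrix_posDef hθ, key (isLAN_of_uniformExpansion hθ hunif), key (isLAN_zero θ₀)⟩
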